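/- Let $n\ge 1$, let $\mathcal M$ be a smooth $n$-dimensional manifold, $I\subset\mathbb R$ an open interval, and let $$g=-N^2dt^2+g_{ij}(dx^i+\beta^i dt)(dx^j+\beta^j dt)$$ be a $C^3$ metric on $\mathcal V=\mathcal M\times I$, with lapse $N>0$, shift $\beta$ (a time-dependent vector field on $\mathcal M$) and properly Riemannian space metrics $g_{ij}$. Use the Cauchy adapted frame $e_0=\partial_t-\beta^j\partial_j$, $e_i=\partial/\partial x^i$, with dual coframe $\theta^0=dt$, $\theta^i=dx^i+\beta^i dt$, and write $\partial_0=\partial_t-\beta^j\partial_j$. For a symmetric 2-tensor $\rho$ of class $C^1$ on $\mathcal V$ put $T_{\alpha\beta}=\rho_{\alpha\beta}-\frac12 g_{\alpha\beta}\,g^{\lambda\mu}\rho_{\lambda\mu}$; let $R_{\alpha\beta}$ be the Ricci tensor of $g$ and $S_{\alpha\beta}=R_{\alpha\beta}-\frac12 g_{\alpha\beta}R$. Say that $\rho$ is *admissible* if the evolution equations $R_{ij}=\rho_{ij}$ $(i,j=1,\dots,n)$ and the conservation laws $\nabla_\alpha T^{\alpha\beta}=0$ hold on $\mathcal V$. The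 constraints are the equations $\Sigma^0_0=0$, $\Sigma^i_0=0$, where $\Sigma^\alpha_0=S^\alpha_0-T^\alpha_0$. 1. For every chart of $\mathcal M$ there is a continuous matrix function $B$ of the coordinates $(t,x)$, depending on the metric and the chart but not on $\rho$, such that for every admissible $\rho$ the functions $u=(\Sigma^0_0,\Sigma^i_0)$ are of class $C^1$ and satisfy, in these coordinates, the linear homogeneous first-order system $$\partial_0u^0+\partial_iu^i+(Bu)^0=0,\qquad N^{-2}\partial_0u^i+g^{ij}\partial_ju^0+(Bu)^i=0 .$$ This system is symmetrizable hyperbolic for the slices $t=\mathrm{const}$: after multiplication by a suitable continuous matrix field, all coefficient matrices of the derivatives $\partial/\partial t,\partial/\partial x^j$ are symmetric, and that of $\partial/\partial t$ is positive definite. Its characteristic determinant in a covector $\eta$ is $(N^{-2}\eta(e_0))^{n-1}\,(-g^{\alpha\beta}\eta_\alpha\eta_\beta)$. 2. Let $\rho$ be admissible and $t_0\in I$. If $U\subset\mathcal M$ is open and the constraints hold on $U\times\{t_0\}$, then they hold at every point of the domain of dependence of $U\times\{t_0\}$, i.e. at every point of $\mathcal V$ such that every inextendible (locally Lipschitz)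 causal curve of $g$ through it meets $U\times\{t_0\}$. In particular, if $\mathcal M\times\{t_0\}$ is a Cauchy slice (every inextendible causal curve meets it) and the constraints hold on it, then they hold on all of $\mathcal V$. -/

import Mathlib

open Set Filter Topology MeasureTheory Matrix
open scoped Manifold ContDiff

noncomputable section

/-! ### Tensor calculus in local coordinates -/

section LocalCoordinates

variable {m : ℕ}

/-- The partial derivative `∂f / ∂y^μ`. -/
def partialDeriv (μ : Fin m) (f : (Fin m → ℝ) → ℝ) (y : Fin m → ℝ) : ℝ :=
  fderiv ℝ f y (Pi.single μ 1)

/-- The Christoffel symbols `Γ^l_{a b}` of the metric `G = (g_{μν})`. -/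
def christoffel (G : (Fin m → ℝ) → Matrix (Fin m) (Fin m) ℝ) (l a b : Fin m)
    (y : Fin m → ℝ) : ℝ :=
  (1 / 2) * ∑ μ, (G y)⁻¹ l μ *
    (partialDeriv a (fun z => G z b μ) y + partialDeriv b (fun z => G z a μ) y
      - partialDeriv μ (fun z => G z a b) y)

/-- The Ricci tensor
`R_{ab} = ∂_l Γ^l_{ab} - ∂_a Γ^l_{bl} + Γ^l_{ab} Γ^k_{lk} - Γ^l_{ak} Γ^k_{bl}`. -/
def ricci (G : (Fin m → ℝ) → Matrix (Fin m) (Fin m) ℝ) (y : Fin m → ℝ) :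
    Matrix (Fin m) (Fin m) ℝ :=
  Matrix.of fun a b =>
    (∑ l, partialDeriv l (christoffel G l a b) y)
      - (∑ l, partialDeriv a (christoffel G l b l) y)
      + (∑ l, ∑ k, christoffel G l a b y * christoffel G k l k y)
      - (∑ l, ∑ k, christoffel G l a k y * christoffel G k b l y)

/-- The trace `g^{μν} h_{μν}` of a covariant 2-tensor. -/
def metricTrace (G h : Matrix (Fin m) (Fin m) ℝ) : ℝ :=
  ∑ μ, ∑ ν, G⁻¹ μ ν * h μ ν

/-- The trace reversal `h_{μν} - (1/2) g_{μν} (g^{αβ} h_{αβ})` of a covariant 2-tensor. -/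
def traceReverse (G h : Matrix (Fin m) (Fin m) ℝ) : Matrix (Fin m) (Fin m) ℝ :=
  h - ((1 / 2) * metricTrace G h) • G

/-- The Einstein tensor `S_{μν} = R_{μν} - (1/2) g_{μν} R`. -/
def einstein (G : (Fin m → ℝ) → Matrix (Fin m) (Fin m) ℝ) (y : Fin m → ℝ) :
    Matrix (Fin m) (Fin m) ℝ :=
  traceReverse (G y) (ricci G y)

/-- Both indices raised: `h^{μν} = g^{μα} g^{νβ} h_{αβ}`. -/
def raiseBoth (G h : Matrix (Fin m) (Fin m) ℝ) : Matrix (Fin m) (Fin m) ℝ :=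
  G⁻¹ * h * (G⁻¹)ᵀ

/-- The divergence `∇_a h^{ab} = ∂_a h^{ab} + Γ^a_{al} h^{lb} + Γ^b_{al} h^{al}` of the covariant
2-tensor field `h` (its indices being raised first). -/
def tensorDivergence (G h : (Fin m → ℝ) → Matrix (Fin m) (Fin m) ℝ) (b : Fin m)
    (y : Fin m → ℝ) : ℝ :=
  (∑ a, partialDeriv a (fun z => raiseBoth (G z) (h z) a b) y)
    + (∑ a, ∑ l, christoffel G a a l y * raiseBoth (G y) (h y) l b)
    + (∑ a, ∑ l, christoffel G b a l y * raiseBoth (G y) (h y) a l)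

/-! ### Linear homogeneous first-order systems -/

/-- The linear homogeneous first-order system `∑_μ A^μ ∂_μ u + B u = 0` on functions of
`(y^0, …, y^{m-1})` with values in `ℝ^k`. -/
structure LinearFirstOrderSystem (m k : ℕ) where
  /-- the coefficient matrices `A^μ` of the derivatives (the principal part) -/
  A : Fin m → (Fin m → ℝ) → Matrix (Fin k) (Fin k) ℝ
  /-- the coefficient matrix of the undifferentiated unknown -/
  B : (Fin m → ℝ) → Matrix (Fin k) (Fin k) ℝ

namespace LinearFirstOrderSystem

/-- `u` is a classical solution of the system on the set `Ω`. -/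
def IsSolutionOn {k : ℕ} (L : LinearFirstOrderSystem m k) (u : (Fin m → ℝ) → Fin k → ℝ)
    (Ω : Set (Fin m → ℝ)) : Prop :=
  ContDiffOn ℝ 1 u Ω ∧
    ∀ y ∈ Ω, (∑ μ, L.A μ y *ᵥ (fun a => partialDeriv μ (fun z => u z a) y)) + L.B y *ᵥ u y = 0

/-- The system is symmetrizable hyperbolic on `Ω` for the slices `y^0 = const`: its coefficients are
continuous and, after multiplication by a continuous matrix field `H`, the coefficient matrices
of all derivatives are symmetric and that of `∂/∂y^0` is symmetric positive definite. -/
def IsSymmetrizableHyperbolicOn {d k : ℕ} (L : LinearFirstOrderSystem (d + 1) k)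
    (Ω : Set (Fin (d + 1) → ℝ)) : Prop :=
  (∀ μ, ContinuousOn (L.A μ) Ω) ∧ ContinuousOn L.B Ω ∧
    ∃ H : (Fin (d + 1) → ℝ) → Matrix (Fin k) (Fin k) ℝ, ContinuousOn H Ω ∧
      ∀ y ∈ Ω, (H y * L.A 0 y).PosDef ∧ ∀ μ, (H y * L.A μ y).IsSymm

/-- The characteristic matrix `∑_μ η_μ A^μ` at `y` in the covector `η`. -/
def symbol {k : ℕ} (L : LinearFirstOrderSystem m k) (y η : Fin m → ℝ) :
    Matrix (Fin k) (Fin k) ℝ :=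
  ∑ μ, η μ • L.A μ y

end LinearFirstOrderSystem

end LocalCoordinates

/-! ### Spacetimes split by space slices -/

/-- A lapse `N`, a shift `β` and a space metric on `M`, all depending on time. -/
structure SplitData (n : ℕ) (M : Type*) [TopologicalSpace M]
    [ChartedSpace (EuclideanSpace ℝ (Fin n)) M] where
  /-- the lapse `N` -/
  lapse : M → ℝ → ℝ
  /-- the shift `β`, a time-dependent vector field on `M` -/
  shift : (x : M) → ℝ → TangentSpace (𝓡 n) x
  /-- the space metric, a time-dependent bilinear form on the tangent spaces of `M` -/
  spatial : (x : M) → ℝ → LinearMap.BilinForm ℝ (TangentSpace (𝓡 n) x)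

/-- A covariant 2-tensor field on the spacetime `M × ℝ`, the tangent space at `(x, t)` being
`T_x M × ℝ`. -/
abbrev SpacetimeTwoTensor (n : ℕ) (M : Type*) [TopologicalSpace M]
    [ChartedSpace (EuclideanSpace ℝ (Fin n)) M] : Type _ :=
  (x : M) → ℝ → LinearMap.BilinForm ℝ (TangentSpace (𝓡 n) x × ℝ)

/-- The point of space with coordinates `y^1, …, y^n`, for spacetime coordinates
`y = (t, y^1, …, y^n)`. -/
def spacePart {n : ℕ} (y : Fin (n + 1) → ℝ) : EuclideanSpace ℝ (Fin n) :=
  WithLp.toLp 2 fun i => y i.succ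

section Manifold

variable {n : ℕ} {M : Type*} [TopologicalSpace M] [ChartedSpace (EuclideanSpace ℝ (Fin n)) M]

/-- The coordinates `(t, x^1, …, x^n)` of the event `(x, t)` in the chart `e` of `M`. -/
def eventCoords (e : OpenPartialHomeomorph M (EuclideanSpace ℝ (Fin n))) (x : M) (t : ℝ) :
    Fin (n + 1) → ℝ :=
  Fin.cons t fun i => e x i

/-- The range of the coordinates `(t, x^1, …, x^n)` on `e.source × I`. -/
def coordDomain (e : OpenPartialHomeomorph M (EuclideanSpace ℝ (Fin n))) (I : Set ℝ) :
    Set (Fin (n + 1) → ℝ) :=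
  {y | y 0 ∈ I ∧ spacePart y ∈ e.target}

/-- The coordinate vector `∂ / ∂x^i` of the chart `e`, at the point with coordinates `y`. -/
def spaceCoordVector (e : OpenPartialHomeomorph M (EuclideanSpace ℝ (Fin n)))
    (y : Fin (n + 1) → ℝ) (i : Fin n) : TangentSpace (𝓡 n) (e.symm (spacePart y)) :=
  mfderiv (𝓡 n) (𝓡 n) e.symm (spacePart y) (EuclideanSpace.single i (1 : ℝ))

/-- The coordinate vectors of spacetime: `∂ / ∂t` (index `0`) and `∂ / ∂x^i` (index `i + 1`). -/
def coordVector (e : OpenPartialHomeomorph M (EuclideanSpace ℝ (Fin n)))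
    (y : Fin (n + 1) → ℝ) :
    Fin (n + 1) → TangentSpace (𝓡 n) (e.symm (spacePart y)) × ℝ :=
  Fin.cons (0, 1) fun i => (spaceCoordVector e y i, 0)

/-- The components `h_{μν}` of a spacetime tensor in the coordinates `(t, x^1, …, x^n)`. -/
def SpacetimeTwoTensor.comp (h : SpacetimeTwoTensor n M)
    (e : OpenPartialHomeomorph M (EuclideanSpace ℝ (Fin n))) (y : Fin (n + 1) → ℝ) :
    Matrix (Fin (n + 1)) (Fin (n + 1)) ℝ :=
  Matrix.of fun μ ν =>
    h (e.symm (spacePart y)) (y 0) (coordVector e y μ) (coordVector e y ν)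

namespace SplitData

/-- The linear map `(v, τ) ↦ v + τ β` from the tangent space of spacetime, with components
`θ^i = dx^i + β^i dt`. -/
def spaceForm (D : SplitData n M) (x : M) (t : ℝ) :
    TangentSpace (𝓡 n) x × ℝ →ₗ[ℝ] TangentSpace (𝓡 n) x :=
  LinearMap.fst ℝ _ _ + (LinearMap.snd ℝ _ _).smulRight (D.shift x t)

/-- The spacetime metric `-N² dt² + g_{ij} (dx^i + β^i dt) (dx^j + β^j dt)`. -/
def metric (D : SplitData n M) : SpacetimeTwoTensor n M := fun x t =>
  (D.spatial x t).compl₁₂ (D.spaceForm x t) (D.spaceForm x t)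
    - (D.lapse x t) ^ 2 •
      (LinearMap.mul ℝ ℝ).compl₁₂ (LinearMap.snd ℝ _ ℝ) (LinearMap.snd ℝ _ ℝ)

/-- The lapse in local coordinates. -/
def lapseComp (D : SplitData n M) (e : OpenPartialHomeomorph M (EuclideanSpace ℝ (Fin n)))
    (y : Fin (n + 1) → ℝ) : ℝ :=
  D.lapse (e.symm (spacePart y)) (y 0)

/-- The components `β^i` of the shift in local coordinates. -/
def shiftComp (D : SplitData n M) (e : OpenPartialHomeomorph M (EuclideanSpace ℝ (Fin n)))
    (y : Fin (n + 1) → ℝ) (i : Fin n) : ℝ :=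
  (show EuclideanSpace ℝ (Fin n) from
    mfderiv (𝓡 n) (𝓡 n) e (e.symm (spacePart y)) (D.shift (e.symm (spacePart y)) (y 0))) i

/-- The components `g_{ij}` of the space metric in local coordinates. -/
def spatialComp (D : SplitData n M) (e : OpenPartialHomeomorph M (EuclideanSpace ℝ (Fin n)))
    (y : Fin (n + 1) → ℝ) : Matrix (Fin n) (Fin n) ℝ :=
  Matrix.of fun i j =>
    D.spatial (e.symm (spacePart y)) (y 0) (spaceCoordVector e y i) (spaceCoordVector e y j)

/-- The data are of class `C^3` on `M × I`, the lapse is positive and the space metric is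
properly Riemannian. -/
structure IsRegular (D : SplitData n M) (I : Set ℝ) : Prop where
  lapse_pos : ∀ x, ∀ t ∈ I, 0 < D.lapse x t
  spatial_symm : ∀ x, ∀ t ∈ I, ∀ v w, D.spatial x t v w = D.spatial x t w v
  spatial_pos : ∀ x, ∀ t ∈ I, ∀ v, v ≠ 0 → 0 < D.spatial x t v v
  lapse_contDiff : ∀ e ∈ IsManifold.maximalAtlas (𝓡 n) ∞ M,
    ContDiffOn ℝ 3 (D.lapseComp e) (coordDomain e I)
  shift_contDiff : ∀ e ∈ IsManifold.maximalAtlas (𝓡 n) ∞ M, ∀ i,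
    ContDiffOn ℝ 3 (fun y => D.shiftComp e y i) (coordDomain e I)
  spatial_contDiff : ∀ e ∈ IsManifold.maximalAtlas (𝓡 n) ∞ M, ∀ i j,
    ContDiffOn ℝ 3 (fun y => D.spatialComp e y i j) (coordDomain e I)

/-- The Cauchy adapted frame: row `0` holds the components of `e_0 = ∂_t - β^j ∂_j` and row `i + 1`
those of `e_i = ∂_i`, in the coordinates `(t, x^1, …, x^n)`. -/
def frame (D : SplitData n M) (e : OpenPartialHomeomorph M (EuclideanSpace ℝ (Fin n)))
    (y : Fin (n + 1) → ℝ) : Matrix (Fin (n + 1)) (Fin (n + 1)) ℝ :=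
  Matrix.of (Fin.cons (Fin.cons 1 fun j => -D.shiftComp e y j) fun i => Pi.single i.succ 1)

/-- The dual coframe: row `0` holds the components of `θ^0 = dt` and row `i + 1` those of
`θ^i = dx^i + β^i dt`. -/
def coframe (D : SplitData n M) (e : OpenPartialHomeomorph M (EuclideanSpace ℝ (Fin n)))
    (y : Fin (n + 1) → ℝ) : Matrix (Fin (n + 1)) (Fin (n + 1)) ℝ :=
  Matrix.of (Fin.cons (Pi.single 0 1) fun i => Fin.cons (D.shiftComp e y i) (Pi.single i 1))

/-- The stress-energy tensor `T_{μν} = ρ_{μν} - (1/2) g_{μν} g^{αβ} ρ_{αβ}` in local coordinates. -/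
def stressEnergy (D : SplitData n M) (ρ : SpacetimeTwoTensor n M)
    (e : OpenPartialHomeomorph M (EuclideanSpace ℝ (Fin n))) (y : Fin (n + 1) → ℝ) :
    Matrix (Fin (n + 1)) (Fin (n + 1)) ℝ :=
  traceReverse (D.metric.comp e y) (ρ.comp e y)

/-- The constraint quantities `Σ^α_0 = S^α_0 - T^α_0`, that is
`θ^α_μ g^{μν} (S_{νλ} - T_{νλ}) (e_0)^λ`, in the Cauchy adapted frame: index `0` is
`S^0_0 - T^0_0` and index `i + 1` is `S^i_0 - T^i_0`. -/
def constraint (D : SplitData n M) (ρ : SpacetimeTwoTensor n M)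
    (e : OpenPartialHomeomorph M (EuclideanSpace ℝ (Fin n))) (y : Fin (n + 1) → ℝ) :
    Fin (n + 1) → ℝ :=
  D.coframe e y *ᵥ ((D.metric.comp e y)⁻¹ *ᵥ
    ((einstein (D.metric.comp e) y - D.stressEnergy ρ e y) *ᵥ D.frame e y 0))

/-- The constraints hold at the event `(x, t)`: the quantities `S^0_0 - T^0_0` and `S^i_0 - T^i_0`
vanish there. -/
def ConstraintsAt (D : SplitData n M) (ρ : SpacetimeTwoTensor n M) (x : M) (t : ℝ) : Prop :=
  ∀ e ∈ IsManifold.maximalAtlas (𝓡 n) ∞ M, x ∈ e.source →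
    D.constraint ρ e (eventCoords e x t) = 0

/-- `ρ` is a symmetric 2-tensor of class `C^1` on `M × I`, the stress-energy tensor satisfies the
conservation laws `∇_a T^{ab} = 0` and the evolution equations `R_{ij} = ρ_{ij}` hold on
`M × I`. -/
structure SolvesEvolution (D : SplitData n M) (ρ : SpacetimeTwoTensor n M) (I : Set ℝ) : Prop where
  source_symm : ∀ x, ∀ t ∈ I, ∀ v w, ρ x t v w = ρ x t w v
  source_contDiff : ∀ e ∈ IsManifold.maximalAtlas (𝓡 n) ∞ M, ∀ μ ν,
    ContDiffOn ℝ 1 (fun y => ρ.comp e y μ ν) (coordDomain e I)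
  conservation : ∀ e ∈ IsManifold.maximalAtlas (𝓡 n) ∞ M, ∀ y ∈ coordDomain e I, ∀ b,
    tensorDivergence (D.metric.comp e) (D.stressEnergy ρ e) b y = 0
  evolution : ∀ e ∈ IsManifold.maximalAtlas (𝓡 n) ∞ M, ∀ y ∈ coordDomain e I, ∀ i j : Fin n,
    ricci (D.metric.comp e) y i.succ j.succ = ρ.comp e y i.succ j.succ

/-- The matrix multiplying `∂_0 = ∂_t - β^j ∂_j` in the principal part of the constraint system:
`1` in the equation of index `0`, `N⁻²` in the equations of index `i + 1`. -/
def principalTime (D : SplitData n M) (e : OpenPartialHomeomorph M (EuclideanSpace ℝ (Fin n)))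
    (y : Fin (n + 1) → ℝ) : Matrix (Fin (n + 1)) (Fin (n + 1)) ℝ :=
  Matrix.diagonal (Fin.cons 1 fun _ => ((D.lapseComp e y) ^ 2)⁻¹)

/-- The matrix multiplying `∂_j` (beside `∂_0`) in the principal part of the constraint system: the
equation of index `0` contains `∂_j u^j`, that of index `i + 1` contains `g^{ij} ∂_j u^0`. -/
def principalSpace (D : SplitData n M) (e : OpenPartialHomeomorph M (EuclideanSpace ℝ (Fin n)))
    (j : Fin n) (y : Fin (n + 1) → ℝ) : Matrix (Fin (n + 1)) (Fin (n + 1)) ℝ :=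
  Matrix.of (Fin.cons (Pi.single j.succ 1)
    fun i => Fin.cons ((D.spatialComp e y)⁻¹ i j) fun _ => 0)

/-- The linear homogeneous first-order system with principal parts
`∂_0 u^0 + ∂_i u^i` and `N⁻² ∂_0 u^i + g^{ij} ∂_j u^0`, where `∂_0 = ∂_t - β^j ∂_j`, and with
coefficient matrix `B` of the undifferentiated unknown. The coefficient of `∂ / ∂t` is that
of `∂_0`, and the coefficient of `∂ / ∂x^j` is that of `∂_j` minus `β^j` times that of `∂_0`. -/
def constraintSystem (D : SplitData n M) (e : OpenPartialHomeomorph M (EuclideanSpace ℝ (Fin n)))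
    (B : (Fin (n + 1) → ℝ) → Matrix (Fin (n + 1)) (Fin (n + 1)) ℝ) :
    LinearFirstOrderSystem (n + 1) (n + 1) where
  A := Fin.cons (D.principalTime e)
    fun j y => D.principalSpace e j y - D.shiftComp e y j • D.principalTime e y
  B := B

/-! ### Causal curves and domains of dependence -/

/-- A causal curve of the spacetime, parametrized by `t` on the interval `J`: `s ↦ (c s, s)` with
`c` continuous and locally Lipschitz (in charts), and with velocity `(c', 1)` in the solid light
cone `g(V, V) ≤ 0` at almost every time. (As the slices are spacelike, `t` is strictly monotone
along every causal curve and can serve as its parameter.) -/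
structure IsCausalCurve (D : SplitData n M) (J : Set ℝ) (c : ℝ → M) : Prop where
  continuousOn : ContinuousOn c J
  locallyLipschitz : ∀ s ∈ J, ∃ K : NNReal, ∃ w ∈ 𝓝[J] s,
    LipschitzOnWith K (fun r => chartAt (EuclideanSpace ℝ (Fin n)) (c s) (c r)) w
  causal : ∀ᵐ s ∂(volume.restrict J), MDifferentiableAt 𝓘(ℝ, ℝ) (𝓡 n) c s ∧
    D.metric (c s) s (mfderiv 𝓘(ℝ, ℝ) (𝓡 n) c s (1 : ℝ), 1)
      (mfderiv 𝓘(ℝ, ℝ) (𝓡 n) c s (1 : ℝ), 1) ≤ 0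

/-- The curve `s ↦ (c s, s)`, `s ∈ J`, has neither a past nor a future endpoint in `M × I`. -/
def IsInextendible (I J : Set ℝ) (c : ℝ → M) : Prop :=
  ∀ a ∈ I, (IsGLB J a ∨ IsLUB J a) → ¬ ∃ q : M, Tendsto c (𝓝[J] a) (𝓝 q)

/-- The event `(x, t)` belongs to the domain of dependence of `U × {t₀}` in `M × I`: every
inextendible causal curve through `(x, t)` meets `U × {t₀}`. -/
def InDomainOfDependence (D : SplitData n M) (I : Set ℝ) (t₀ : ℝ) (U : Set M)
    (x : M) (t : ℝ) : Prop :=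
  ∀ (J : Set ℝ) (c : ℝ → M), J.OrdConnected → J ⊆ I → t ∈ J → c t = x →
    D.IsCausalCurve J c → IsInextendible I J c → t₀ ∈ J ∧ c t₀ ∈ U

/-- `M × {t₀}` is a Cauchy slice of `M × I`: every inextendible causal curve meets it. -/
def IsCauchySlice (D : SplitData n M) (I : Set ℝ) (t₀ : ℝ) : Prop :=
  ∀ x, ∀ t ∈ I, D.InDomainOfDependence I t₀ univ x t

end SplitData

end Manifold

end

/-! ### Calculus of coordinate partial derivatives. -/

section PartialDerivatives

variable {m : ℕ} {f g : (Fin m → ℝ) → ℝ} {y : Fin m → ℝ}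

/-! The system. Put `Σ = S - T`. The contracted Bianchi identity and the conservation laws give `∇_α
Σ^{αβ} = 0`. By the evolution equations the difference of the Ricci tensor and `ρ` has, in the
Cauchy adapted frame, only the components `00` and `0i`. Its trace reversal `Σ` is then determined
by `u^α = Σ^α_0` alone: `Σ^{00} = -N⁻² u^0`, `Σ^{0i} = -N⁻² u^i`, `Σ^{ij} = -u^0 g^{ij}`
(`raiseBoth_traceReverse_bordered`, `raiseBoth_residual`). Substituted into the divergence, this
becomes a linear homogeneous system for `u` whose coefficients see only the metric
(`isSolutionOn_constraint`). Lowering the index `i` with `g_{ij}` symmetrizes it, and its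
characteristic matrix is a multiple of the identity bordered by one row and one column, whose
determinant is explicit (`det_symbol_constraintSystem`).

The Bianchi identity is derived from the coordinate definitions. Ricci tensor and divergence are
covariant under coordinate changes (`ricci_pullTensor`, `jac_mulVec_tensorDivergence_pullTensor`),
so it suffices to argue at a point where the Christoffel symbols vanish. There the identity reduces
to the symmetries of the third derivatives of the metric (`sum_partialDeriv_ricci_of_flat`,
`tensorDivergence_einstein`).

Propagation. An energy estimate is used only locally. Freeze at an event the cone `g(V, V) ≤ ε`,
slightly wider than the light cone. The energy current of the system crosses the sides of this cone
outwards (`current_pos`), so a solution vanishing on the base of a small cone of this shape vanishes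
at its vertex (`eq_zero_of_eq_zero_on_cone_base`). Read contrapositively, a violation of the
constraints at the vertex forces a violation somewhere on the base of every sufficiently small such
cone, towards the past as well as towards the future (`exists_coneAt_constraint_ne_zero`).

Iterating such steps gives discrete paths of violations. As the step size and `ε` tend to zero they
converge to a Lipschitz curve with causal velocities, contained in the closure of the set of
violations (`HasConeSteps.exists_curve`, `HasChartSteps.exists_local_causalCurve`). Local curves are
concatenated greedily into a half-curve without endpoint (`exists_maximal_curve`), and the other
half is any causal curve.

Suppose the constraints failed at an event of the domain of dependence of `U × {t₀}`. The
inextendible causal curve so obtained would meet `U × {t₀}` at a point of the closure of the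
violations. But constraints that hold on an open part of a slice hold in a spacetime neighbourhood
of it, by the same cone argument (`not_mem_eventClosure_of_slice`). This contradiction proves the
propagation, and the Cauchy slice is the case where `U` is everything. No causality theory enters
beyond the existence of these curves. -/

lemma partialDeriv_congr (h : f =ᶠ[𝓝 y] g) (a : Fin m) :
    partialDeriv a f y = partialDeriv a g y := by
  simp only [partialDeriv, h.fderiv_eq]

lemma partialDeriv_const (a : Fin m) (c : ℝ) : partialDeriv a (fun _ => c) y = 0 := by
  simp [partialDeriv]

lemma partialDeriv_add (hf : DifferentiableAt ℝ f y) (hg : DifferentiableAt ℝ g y) (a : Fin m) :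
    partialDeriv a (fun z => f z + g z) y = partialDeriv a f y + partialDeriv a g y := by
  simp only [partialDeriv]
  rw [fderiv_fun_add hf hg]; rfl

lemma partialDeriv_sub (hf : DifferentiableAt ℝ f y) (hg : DifferentiableAt ℝ g y) (a : Fin m) :
    partialDeriv a (fun z => f z - g z) y = partialDeriv a f y - partialDeriv a g y := by
  simp only [partialDeriv]
  rw [fderiv_fun_sub hf hg]; rfl

lemma partialDeriv_mul (hf : DifferentiableAt ℝ f y) (hg : DifferentiableAt ℝ g y) (a : Fin m) :
    partialDeriv a (fun z => f z * g z) y =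
      partialDeriv a f y * g y + f y * partialDeriv a g y := by
  simp only [partialDeriv]
  rw [fderiv_fun_mul hf hg]
  simp
  ring

lemma partialDeriv_const_mul (hf : DifferentiableAt ℝ f y) (c : ℝ) (a : Fin m) :
    partialDeriv a (fun z => c * f z) y = c * partialDeriv a f y := by
  rw [partialDeriv_mul (differentiableAt_const c) hf, partialDeriv_const]; ring

lemma partialDeriv_sum {ι : Type*} {s : Finset ι} {F : ι → (Fin m → ℝ) → ℝ}
    (hF : ∀ i ∈ s, DifferentiableAt ℝ (F i) y) (a : Fin m) :
    partialDeriv a (fun z => ∑ i ∈ s, F i z) y = ∑ i ∈ s, partialDeriv a (F i) y := by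
  simp only [partialDeriv]
  rw [fderiv_fun_sum hF]
  simp

lemma ContDiffAt.partialDeriv {k n : WithTop ℕ∞} (h : ContDiffAt ℝ n f y) (hk : k + 1 ≤ n)
    (a : Fin m) : ContDiffAt ℝ k (partialDeriv a f) y :=
  (h.fderiv_right hk).clm_apply contDiffAt_const

lemma partialDeriv_comm (h : ContDiffAt ℝ 2 f y) (a b : Fin m) :
    partialDeriv a (partialDeriv b f) y = partialDeriv b (partialDeriv a f) y := by
  have hs : IsSymmSndFDerivAt ℝ f y := h.isSymmSndFDerivAt (by simp)
  have hd : DifferentiableAt ℝ (fderiv ℝ f) y :=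
    (h.fderiv_right (m := 1) (by norm_num)).differentiableAt (by norm_num)
  have key : ∀ c d : Fin m, _root_.partialDeriv c (_root_.partialDeriv d f) y =
      fderiv ℝ (fderiv ℝ f) y (Pi.single c 1) (Pi.single d 1) := by
    intro c d
    have : _root_.partialDeriv d f = fun z => fderiv ℝ f z (Pi.single d 1) := rfl
    rw [this, _root_.partialDeriv, fderiv_clm_apply hd (differentiableAt_const _)]
    simp
  rw [key, key]
  exact hs _ _

/-- The chain rule for partial derivatives. -/
lemma partialDeriv_comp {k : ℕ} {φ : (Fin k → ℝ) → Fin m → ℝ} {x : Fin k → ℝ}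
    (hf : DifferentiableAt ℝ f (φ x)) (hφ : ∀ p, DifferentiableAt ℝ (fun z => φ z p) x)
    (a : Fin k) :
    partialDeriv a (fun z => f (φ z)) x =
      ∑ q, partialDeriv a (fun z => φ z q) x * partialDeriv q f (φ x) := by
  have hφ' : DifferentiableAt ℝ φ x := differentiableAt_pi.2 hφ
  have h1 : fderiv ℝ (fun z => f (φ z)) x = (fderiv ℝ f (φ x)).comp (fderiv ℝ φ x) :=
    fderiv_comp x hf hφ'
  simp only [partialDeriv, h1, ContinuousLinearMap.comp_apply]
  conv_lhs => rw [pi_eq_sum_univ' (fderiv ℝ φ x (Pi.single a 1))]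
  rw [map_sum]
  refine Finset.sum_congr rfl fun q _ => ?_
  rw [map_smul, smul_eq_mul, ((hasFDerivAt_pi'.1 hφ'.hasFDerivAt) q).fderiv]
  rfl

end PartialDerivatives

/-! ### Entrywise differential calculus of matrix fields. -/

section MatrixCalculus

variable {m : ℕ} {ι κ τ : Type*} {y : Fin m → ℝ}

/-- All entries of a matrix field are of class `C^k` at a point. -/
def MatContDiffAt (k : WithTop ℕ∞) (F : (Fin m → ℝ) → Matrix ι κ ℝ) (y : Fin m → ℝ) : Prop :=
  ∀ i j, ContDiffAt ℝ k (fun z => F z i j) y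

/-- The entrywise partial derivative of a matrix field. -/
noncomputable def matDeriv (a : Fin m) (F : (Fin m → ℝ) → Matrix ι κ ℝ) (y : Fin m → ℝ) :
    Matrix ι κ ℝ :=
  Matrix.of fun i j => partialDeriv a (fun z => F z i j) y

lemma matDeriv_apply (a : Fin m) (F : (Fin m → ℝ) → Matrix ι κ ℝ) (y : Fin m → ℝ) (i : ι) (j : κ) :
    matDeriv a F y i j = partialDeriv a (fun z => F z i j) y := rfl

variable {F H : (Fin m → ℝ) → Matrix ι κ ℝ} {k n : WithTop ℕ∞}

lemma MatContDiffAt.of_le (h : MatContDiffAt n F y) (hk : k ≤ n) : MatContDiffAt k F y :=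
  fun i j => (h i j).of_le hk

lemma MatContDiffAt.diff (h : MatContDiffAt 1 F y) (i : ι) (j : κ) :
    DifferentiableAt ℝ (fun z => F z i j) y := (h i j).differentiableAt (by norm_num)

lemma MatContDiffAt.congr (h : MatContDiffAt k F y) (he : H =ᶠ[𝓝 y] F) : MatContDiffAt k H y :=
  fun i j => (h i j).congr_of_eventuallyEq (he.mono fun z hz => by simp only [hz])

lemma MatContDiffAt.matDeriv (h : MatContDiffAt n F y) (hk : k + 1 ≤ n) (a : Fin m) :
    MatContDiffAt k (matDeriv a F) y := fun i j => (h i j).partialDeriv hk a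

lemma MatContDiffAt.add (hF : MatContDiffAt k F y) (hH : MatContDiffAt k H y) :
    MatContDiffAt k (fun z => F z + H z) y := fun i j => (hF i j).add (hH i j)

lemma MatContDiffAt.sub (hF : MatContDiffAt k F y) (hH : MatContDiffAt k H y) :
    MatContDiffAt k (fun z => F z - H z) y := fun i j => (hF i j).sub (hH i j)

lemma MatContDiffAt.transpose (hF : MatContDiffAt k F y) : MatContDiffAt k (fun z => (F z)ᵀ) y :=
  fun i j => hF j i

lemma MatContDiffAt.smul {f : (Fin m → ℝ) → ℝ} (hf : ContDiffAt ℝ k f y)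
    (hF : MatContDiffAt k F y) : MatContDiffAt k (fun z => f z • F z) y :=
  fun i j => hf.mul (hF i j)

lemma MatContDiffAt.mul [Fintype κ] {K : (Fin m → ℝ) → Matrix κ τ ℝ} (hF : MatContDiffAt k F y)
    (hK : MatContDiffAt k K y) : MatContDiffAt k (fun z => F z * K z) y := fun i j => by
  simp only [Matrix.mul_apply]
  exact ContDiffAt.sum fun l _ => (hF i l).mul (hK l j)

lemma MatContDiffAt.sum {σ : Type*} {s : Finset σ} {E : σ → (Fin m → ℝ) → Matrix ι κ ℝ}
    (hE : ∀ i ∈ s, MatContDiffAt k (E i) y) : MatContDiffAt k (fun z => ∑ i ∈ s, E i z) y :=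
  fun i j => by
    simp only [Matrix.sum_apply]
    exact ContDiffAt.sum fun l hl => hE l hl i j

lemma MatContDiffAt.det [Fintype ι] [DecidableEq ι] {A : (Fin m → ℝ) → Matrix ι ι ℝ}
    (hA : MatContDiffAt k A y) : ContDiffAt ℝ k (fun z => (A z).det) y := by
  simp only [Matrix.det_apply]
  exact ContDiffAt.sum fun σ _ => (contDiffAt_prod fun i _ => hA _ _).const_smul _

/-- Cramer's rule: every entry of the inverse is a cofactor determinant divided by `det A`, so its
regularity follows from that of determinants. -/
lemma MatContDiffAt.inv [Fintype ι] [DecidableEq ι] {A : (Fin m → ℝ) → Matrix ι ι ℝ}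
    (hA : MatContDiffAt k A y) (hd : (A y).det ≠ 0) : MatContDiffAt k (fun z => (A z)⁻¹) y := by
  intro i j
  have h1 : ∀ z, (A z)⁻¹ i j = ((A z).det)⁻¹ * ((A z).updateRow j (Pi.single i 1)).det := by
    intro z
    rw [Matrix.inv_def, Matrix.smul_apply, Matrix.adjugate_apply, Ring.inverse_eq_inv',
      smul_eq_mul]
  simp only [h1]
  refine (hA.det.inv hd).mul (MatContDiffAt.det fun p q => ?_)
  by_cases hp : p = j
  · subst hp; simpa using contDiffAt_const
  · simpa [Matrix.updateRow_ne hp] using hA p q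

lemma matDeriv_congr (h : F =ᶠ[𝓝 y] H) (a : Fin m) : matDeriv a F y = matDeriv a H y := by
  ext i j
  exact partialDeriv_congr (h.mono fun z hz => by simp only [hz]) a

lemma matDeriv_add (hF : MatContDiffAt 1 F y) (hH : MatContDiffAt 1 H y) (a : Fin m) :
    matDeriv a (fun z => F z + H z) y = matDeriv a F y + matDeriv a H y := by
  ext i j
  exact partialDeriv_add (hF.diff i j) (hH.diff i j) a

lemma matDeriv_sub (hF : MatContDiffAt 1 F y) (hH : MatContDiffAt 1 H y) (a : Fin m) :
    matDeriv a (fun z => F z - H z) y = matDeriv a F y - matDeriv a H y := by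
  ext i j
  exact partialDeriv_sub (hF.diff i j) (hH.diff i j) a

lemma matDeriv_smul {f : (Fin m → ℝ) → ℝ} (hf : DifferentiableAt ℝ f y) (hF : MatContDiffAt 1 F y)
    (a : Fin m) :
    matDeriv a (fun z => f z • F z) y = partialDeriv a f y • F y + f y • matDeriv a F y := by
  ext i j
  exact partialDeriv_mul hf (hF.diff i j) a

lemma matDeriv_sum {σ : Type*} {s : Finset σ} {E : σ → (Fin m → ℝ) → Matrix ι κ ℝ}
    (hE : ∀ i ∈ s, MatContDiffAt 1 (E i) y) (a : Fin m) :
    matDeriv a (fun z => ∑ i ∈ s, E i z) y = ∑ i ∈ s, matDeriv a (E i) y := by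
  ext i j
  simp only [matDeriv_apply, Matrix.sum_apply]
  exact partialDeriv_sum (fun l hl => (hE l hl).diff i j) a

lemma matDeriv_transpose (a : Fin m) : matDeriv a (fun z => (F z)ᵀ) y = (matDeriv a F y)ᵀ := rfl

lemma matDeriv_const (a : Fin m) (C : Matrix ι κ ℝ) : matDeriv a (fun _ => C) y = 0 := by
  ext i j
  exact partialDeriv_const a _

lemma matDeriv_mul [Fintype κ] {K : (Fin m → ℝ) → Matrix κ τ ℝ} (hF : MatContDiffAt 1 F y)
    (hK : MatContDiffAt 1 K y) (a : Fin m) :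
    matDeriv a (fun z => F z * K z) y = matDeriv a F y * K y + F y * matDeriv a K y := by
  ext i j
  simp only [matDeriv_apply, Matrix.mul_apply, Matrix.add_apply]
  rw [partialDeriv_sum (F := fun l z => F z i l * K z l j)
    fun l _ => (hF.diff i l).mul (hK.diff l j), ← Finset.sum_add_distrib]
  exact Finset.sum_congr rfl fun l _ => partialDeriv_mul (hF.diff i l) (hK.diff l j) a

lemma matDeriv_matDeriv_comm (hF : MatContDiffAt 2 F y) (a b : Fin m) :
    matDeriv a (matDeriv b F) y = matDeriv b (matDeriv a F) y := by
  ext i j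
  exact partialDeriv_comm (hF i j) a b

/-- Differentiate `A⁻¹ A = 1`, which holds in a neighbourhood because `det A` is continuous and
nonzero at the point. -/
lemma matDeriv_inv [Fintype ι] [DecidableEq ι] {A : (Fin m → ℝ) → Matrix ι ι ℝ}
    (hA : MatContDiffAt 1 A y) (hd : (A y).det ≠ 0) (a : Fin m) :
    matDeriv a (fun z => (A z)⁻¹) y = -((A y)⁻¹ * matDeriv a A y * (A y)⁻¹) := by
  have hev : (fun z => (A z)⁻¹ * A z) =ᶠ[𝓝 y] fun _ => 1 := by
    filter_upwards [(hA.det.continuousAt).eventually_ne hd] with z hz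
    exact Matrix.nonsing_inv_mul _ (isUnit_iff_ne_zero.2 hz)
  have h := matDeriv_congr hev a
  rw [matDeriv_mul (hA.inv hd) hA, matDeriv_const] at h
  have h2 : matDeriv a (fun z => (A z)⁻¹) y * A y * (A y)⁻¹ =
      -((A y)⁻¹ * matDeriv a A y) * (A y)⁻¹ := by rw [eq_neg_of_add_eq_zero_left h]
  rwa [Matrix.mul_nonsing_inv_cancel_right _ _ (isUnit_iff_ne_zero.2 hd), Matrix.neg_mul] at h2

end MatrixCalculus

/-! ### The Levi-Civita connection and curvature in matrix form. -/

section Connection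

variable {m : ℕ} {G : (Fin m → ℝ) → Matrix (Fin m) (Fin m) ℝ} {y : Fin m → ℝ}

/-- A symmetric nondegenerate matrix field of class `C^k` at a point. -/
structure IsMetricAt (k : ℕ) (G : (Fin m → ℝ) → Matrix (Fin m) (Fin m) ℝ) (y : Fin m → ℝ) :
    Prop where
  smooth : MatContDiffAt k G y
  symm : ∀ᶠ z in 𝓝 y, (G z)ᵀ = G z
  det_ne : (G y).det ≠ 0

lemma MatContDiffAt.eventually {ι κ : Type*} [Finite ι] [Finite κ] {k : ℕ}
    {F : (Fin m → ℝ) → Matrix ι κ ℝ} (h : MatContDiffAt k F y) :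
    ∀ᶠ z in 𝓝 y, MatContDiffAt k F z :=
  eventually_all.2 fun i => eventually_all.2 fun j => (h i j).eventually (by simp)

lemma IsMetricAt.eventually {k : ℕ} (h : IsMetricAt k G y) : ∀ᶠ z in 𝓝 y, IsMetricAt k G z := by
  filter_upwards [h.smooth.eventually, h.symm.eventually_nhds,
    h.smooth.det.continuousAt.eventually_ne h.det_ne] with z h1 h2 h3 using ⟨h1, h2, h3⟩

lemma IsMetricAt.of_le {j k : ℕ} (h : IsMetricAt k G y) (hjk : j ≤ k) : IsMetricAt j G y :=
  ⟨h.smooth.of_le (by exact_mod_cast hjk), h.symm, h.det_ne⟩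

lemma IsMetricAt.symm_apply {k : ℕ} (h : IsMetricAt k G y) : (G y)ᵀ = G y := h.symm.self_of_nhds

lemma IsMetricAt.partialDeriv_symm {k : ℕ} (h : IsMetricAt k G y) (a b c : Fin m) :
    partialDeriv a (fun z => G z b c) y = partialDeriv a (fun z => G z c b) y :=
  partialDeriv_congr (h.symm.mono fun z hz => by
    show G z b c = G z c b
    conv_lhs => rw [← hz]
    rfl) a

/-- The connection matrices `(Γ_a)^l_b = Γ^l_{ab}`. -/
noncomputable def connMatrix (G : (Fin m → ℝ) → Matrix (Fin m) (Fin m) ℝ) (a : Fin m)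
    (y : Fin m → ℝ) : Matrix (Fin m) (Fin m) ℝ :=
  Matrix.of fun l b => christoffel G l a b y

lemma christoffel_symm {k : ℕ} (h : IsMetricAt k G y) (l a b : Fin m) :
    christoffel G l a b y = christoffel G l b a y := by
  simp only [christoffel]
  congr 1
  refine Finset.sum_congr rfl fun μ _ => ?_
  rw [h.partialDeriv_symm μ a b]
  ring

/-- The Christoffel symbols of the first kind, as matrices. -/
noncomputable def lowerConn (G : (Fin m → ℝ) → Matrix (Fin m) (Fin m) ℝ) (a : Fin m)
    (y : Fin m → ℝ) : Matrix (Fin m) (Fin m) ℝ :=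
  Matrix.of fun c b => (1 / 2) * (partialDeriv a (fun z => G z b c) y
    + partialDeriv b (fun z => G z a c) y - partialDeriv c (fun z => G z a b) y)

lemma connMatrix_eq (a : Fin m) (y : Fin m → ℝ) :
    connMatrix G a y = (G y)⁻¹ * lowerConn G a y := by
  ext l b
  simp only [connMatrix, lowerConn, christoffel, Matrix.of_apply, Matrix.mul_apply, Finset.mul_sum]
  exact Finset.sum_congr rfl fun μ _ => by ring

lemma mul_connMatrix (hd : (G y).det ≠ 0) (a : Fin m) :
    G y * connMatrix G a y = lowerConn G a y := by
  rw [connMatrix_eq, Matrix.mul_nonsing_inv_cancel_left _ _ (isUnit_iff_ne_zero.2 hd)]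

lemma MatContDiffAt.lowerConn {k n : WithTop ℕ∞} (h : MatContDiffAt n G y) (hk : k + 1 ≤ n)
    (a : Fin m) : MatContDiffAt k (lowerConn G a) y := fun _ _ =>
  contDiffAt_const.mul (((h _ _).partialDeriv hk _).add ((h _ _).partialDeriv hk _) |>.sub
    ((h _ _).partialDeriv hk _))

lemma MatContDiffAt.connMatrix {k n : WithTop ℕ∞} (h : MatContDiffAt n G y) (hk : k + 1 ≤ n)
    (hd : (G y).det ≠ 0) (a : Fin m) : MatContDiffAt k (connMatrix G a) y := by
  have : _root_.connMatrix G a = fun z => (G z)⁻¹ * _root_.lowerConn G a z :=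
    funext fun z => connMatrix_eq a z
  rw [this]
  exact ((h.of_le (le_trans le_self_add hk)).inv hd).mul (h.lowerConn hk a)

/-- Metric compatibility. In the sum of the first-kind symbols and their transpose, two of the three
kinds of derivatives cancel and `∂_a g` remains. -/
lemma matDeriv_metric {k : ℕ} (h : IsMetricAt k G y) (a : Fin m) :
    matDeriv a G y = (connMatrix G a y)ᵀ * G y + G y * connMatrix G a y := by
  have h1 : (connMatrix G a y)ᵀ * G y = (lowerConn G a y)ᵀ := by
    rw [← mul_connMatrix h.det_ne, Matrix.transpose_mul, h.symm_apply]
  rw [h1, mul_connMatrix h.det_ne]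
  ext b c
  simp only [matDeriv_apply, lowerConn, Matrix.add_apply, Matrix.transpose_apply, Matrix.of_apply]
  rw [h.partialDeriv_symm a c b, h.partialDeriv_symm c a b, h.partialDeriv_symm b a c]
  rw [h.partialDeriv_symm b c a, h.partialDeriv_symm c b a]
  ring

/-- A torsion-free metric connection is the Levi-Civita connection. -/
lemma eq_connMatrix {k : ℕ} (h : IsMetricAt k G y) {Δ : Fin m → Matrix (Fin m) (Fin m) ℝ}
    (hs : ∀ a b l, Δ a l b = Δ b l a)
    (hc : ∀ a, matDeriv a G y = (Δ a)ᵀ * G y + G y * Δ a) (a : Fin m) :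
    Δ a = connMatrix G a y := by
  set E : Fin m → Matrix (Fin m) (Fin m) ℝ := fun a => G y * Δ a with hE
  have hEs : ∀ a b c, E a c b = E b c a := by
    intro a b c
    simp only [hE, Matrix.mul_apply]
    exact Finset.sum_congr rfl fun l _ => by rw [hs]
  have hd : ∀ a b c, partialDeriv a (fun z => G z b c) y = E a c b + E a b c := by
    intro a b c
    have h1 : (Δ a)ᵀ * G y = (E a)ᵀ := by
      rw [hE, Matrix.transpose_mul, h.symm_apply]
    have := congrFun (congrFun (hc a) b) c
    rw [h1] at this
    exact this
  -- Koszul's argument: all three derivatives in `lowerConn` are written through `E` by metric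
  -- compatibility, and the torsion-free symmetry `hEs` cancels everything but `2 E a`.
  have hL : G y * Δ a = lowerConn G a y := by
    ext c b
    simp only [lowerConn, Matrix.of_apply, hd]
    change E a c b = _
    rw [hEs b a c, hEs c a b, hEs b c a]
    ring
  rw [connMatrix_eq, ← hL, Matrix.nonsing_inv_mul_cancel_left _ _ (isUnit_iff_ne_zero.2 h.det_ne)]

/-- The curvature matrices `∂_a Γ_b - ∂_b Γ_a + [Γ_a, Γ_b]`. -/
noncomputable def curvMatrix (G : (Fin m → ℝ) → Matrix (Fin m) (Fin m) ℝ) (a b : Fin m)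
    (y : Fin m → ℝ) : Matrix (Fin m) (Fin m) ℝ :=
  matDeriv a (connMatrix G b) y - matDeriv b (connMatrix G a) y
    + (connMatrix G a y * connMatrix G b y - connMatrix G b y * connMatrix G a y)

/-- Only the symmetry of `Γ` in its lower indices separates the two expressions. It is needed in a
neighbourhood, because one of the reordered symbols is differentiated. -/
lemma ricci_eq_curvMatrix {k : ℕ} (h : IsMetricAt k G y) (a b : Fin m) :
    ricci G y a b = ∑ l, curvMatrix G l a y l b := by
  simp only [ricci, curvMatrix, Matrix.of_apply, Matrix.add_apply, Matrix.sub_apply,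
    Matrix.mul_apply, matDeriv_apply, connMatrix, Finset.sum_add_distrib, Finset.sum_sub_distrib]
  have e1 : ∀ l, partialDeriv a (christoffel G l b l) y =
      partialDeriv a (fun z => christoffel G l l b z) y := fun l =>
    partialDeriv_congr (h.eventually.mono fun z hz => christoffel_symm hz l b l) a
  have e2 : ∑ l, ∑ k, christoffel G l a b y * christoffel G k l k y =
      ∑ l, ∑ k, christoffel G l l k y * christoffel G k a b y := by
    rw [Finset.sum_comm]
    refine Finset.sum_congr rfl fun l _ => Finset.sum_congr rfl fun k _ => ?_
    rw [christoffel_symm h l k l]; ring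
  have e3 : ∑ l, ∑ k, christoffel G l a k y * christoffel G k b l y =
      ∑ l, ∑ k, christoffel G l a k y * christoffel G k l b y := by
    refine Finset.sum_congr rfl fun l _ => Finset.sum_congr rfl fun k _ => ?_
    rw [christoffel_symm h k b l]
  rw [e2, e3, Finset.sum_congr rfl fun l _ => e1 l]
  ring

/-- The divergence as a contraction of the matrices `∇_a K = ∂_a K + Γ_a K + K Γ_aᵀ`, which can be
transformed as a whole before contracting. -/
lemma tensorDivergence_eq (h : (Fin m → ℝ) → Matrix (Fin m) (Fin m) ℝ) (b : Fin m) :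
    tensorDivergence G h b y =
      ∑ a, (matDeriv a (fun z => raiseBoth (G z) (h z)) y
        + connMatrix G a y * raiseBoth (G y) (h y)
        + raiseBoth (G y) (h y) * (connMatrix G a y)ᵀ) a b := by
  simp only [tensorDivergence, Matrix.add_apply, Matrix.mul_apply, Finset.sum_add_distrib,
    matDeriv_apply, connMatrix, Matrix.of_apply, Matrix.transpose_apply]
  congr 1
  exact Finset.sum_congr rfl fun a _ => Finset.sum_congr rfl fun l _ => mul_comm _ _

end Connection

/-! ### Covariance of connection, curvature and divergence under coordinate changes. -/

section CoordinateChange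

variable {m : ℕ} {G : (Fin m → ℝ) → Matrix (Fin m) (Fin m) ℝ} {φ : (Fin m → ℝ) → Fin m → ℝ}
  {x : Fin m → ℝ}

/-- The Jacobian matrix of a coordinate change. -/
noncomputable def jac (φ : (Fin m → ℝ) → Fin m → ℝ) (x : Fin m → ℝ) : Matrix (Fin m) (Fin m) ℝ :=
  Matrix.of fun p a => partialDeriv a (fun z => φ z p) x

lemma matContDiffAt_jac {k n : WithTop ℕ∞} (h : ∀ p, ContDiffAt ℝ n (fun z => φ z p) x)
    (hk : k + 1 ≤ n) : MatContDiffAt k (jac φ) x := fun p a => (h p).partialDeriv hk a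

lemma matDeriv_jac_symm (h : ∀ p, ContDiffAt ℝ 2 (fun z => φ z p) x) (a b p : Fin m) :
    matDeriv a (jac φ) x p b = matDeriv b (jac φ) x p a := partialDeriv_comm (h p) a b

/-- The pullback of a covariant 2-tensor under a coordinate change. -/
noncomputable def pullTensor (φ : (Fin m → ℝ) → Fin m → ℝ)
    (h : (Fin m → ℝ) → Matrix (Fin m) (Fin m) ℝ) (x : Fin m → ℝ) : Matrix (Fin m) (Fin m) ℝ :=
  (jac φ x)ᵀ * h (φ x) * jac φ x

lemma matDeriv_comp {ι κ : Type*} {F : (Fin m → ℝ) → Matrix ι κ ℝ} (hF : MatContDiffAt 1 F (φ x))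
    (hφ : ∀ p, DifferentiableAt ℝ (fun z => φ z p) x) (a : Fin m) :
    matDeriv a (fun z => F (φ z)) x = ∑ q, jac φ x q a • matDeriv q F (φ x) := by
  ext i j
  rw [Matrix.sum_apply]
  exact partialDeriv_comp (hF.diff i j) hφ a

lemma MatContDiffAt.comp {ι κ : Type*} {k : WithTop ℕ∞} {F : (Fin m → ℝ) → Matrix ι κ ℝ}
    (hF : MatContDiffAt k F (φ x)) (hφ : ∀ p, ContDiffAt ℝ k (fun z => φ z p) x) :
    MatContDiffAt k (fun z => F (φ z)) x := fun i j =>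
  (hF i j).comp x (contDiffAt_pi.2 hφ)

lemma IsMetricAt.pullTensor {k : ℕ} (hG : IsMetricAt k G (φ x))
    (hφ : ∀ p, ContDiffAt ℝ (k + 1 : ℕ) (fun z => φ z p) x) (hJ : (jac φ x).det ≠ 0) :
    IsMetricAt k (pullTensor φ G) x := by
  have hφ' : ∀ p, ContDiffAt ℝ k (fun z => φ z p) x := fun p =>
    (hφ p).of_le (by exact_mod_cast Nat.le_succ k)
  have hJc : MatContDiffAt k (jac φ) x := matContDiffAt_jac hφ (by push_cast; exact le_rfl)
  refine ⟨(hJc.transpose.mul (hG.smooth.comp hφ')).mul hJc, ?_, ?_⟩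
  · have hc : ContinuousAt φ x := continuousAt_pi.2 fun p => (hφ p).continuousAt
    filter_upwards [hc.eventually hG.symm] with z hz
    simp only [_root_.pullTensor, Matrix.transpose_mul, Matrix.transpose_transpose, hz,
      Matrix.mul_assoc]
  · simp only [_root_.pullTensor, Matrix.det_mul, Matrix.det_transpose]
    exact mul_ne_zero (mul_ne_zero hJ hG.det_ne) hJ

/-- The pulled back connection matrices `∑_q J^q_a Γ_q`. -/
noncomputable def pullConn (φ : (Fin m → ℝ) → Fin m → ℝ)
    (G : (Fin m → ℝ) → Matrix (Fin m) (Fin m) ℝ) (a : Fin m) (x : Fin m → ℝ) :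
    Matrix (Fin m) (Fin m) ℝ :=
  ∑ q, jac φ x q a • connMatrix G q (φ x)

/-- The transformation law of the Christoffel symbols. -/
lemma jac_mul_connMatrix_pullTensor (hG : IsMetricAt 1 G (φ x))
    (hφ : ∀ p, ContDiffAt ℝ 2 (fun z => φ z p) x) (hJ : (jac φ x).det ≠ 0) (a : Fin m) :
    jac φ x * connMatrix (pullTensor φ G) a x =
      matDeriv a (jac φ) x + pullConn φ G a x * jac φ x := by
  have hu : IsUnit (jac φ x).det := isUnit_iff_ne_zero.2 hJ
  have hJ1 : MatContDiffAt 1 (jac φ) x := matContDiffAt_jac hφ (by norm_num)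
  have hφ1 : ∀ p, ContDiffAt ℝ 1 (fun z => φ z p) x := fun p => (hφ p).of_le (by norm_num)
  have hφd : ∀ p, DifferentiableAt ℝ (fun z => φ z p) x :=
    fun p => (hφ1 p).differentiableAt (by norm_num)
  have hG' : IsMetricAt 1 (pullTensor φ G) x := hG.pullTensor (by exact_mod_cast hφ) hJ
  -- The claimed right-hand side. `J⁻¹ X` is shown to be torsion-free (second derivatives of `φ`
  -- commute) and compatible with the pulled back metric; `eq_connMatrix` then identifies it.
  set X : Fin m → Matrix (Fin m) (Fin m) ℝ :=
    fun a => matDeriv a (jac φ) x + pullConn φ G a x * jac φ x with hX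
  have hXs : ∀ a b p, X a p b = X b p a := by
    intro a b p
    simp only [hX, Matrix.add_apply, matDeriv_jac_symm hφ a b p, pullConn, Matrix.mul_apply,
      Matrix.sum_apply, Matrix.smul_apply, smul_eq_mul, Finset.sum_mul]
    congr 1
    rw [Finset.sum_comm]
    refine Finset.sum_congr rfl fun q _ => Finset.sum_congr rfl fun r _ => ?_
    simp only [connMatrix, Matrix.of_apply]
    rw [christoffel_symm hG p q r]
    ring
  have key := eq_connMatrix hG' (Δ := fun a => (jac φ x)⁻¹ * X a)
    (fun a b l => by
      simp only [Matrix.mul_apply]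
      exact Finset.sum_congr rfl fun p _ => by rw [hXs])
    (fun a => by
      have hGc := hG.smooth.comp hφ1
      have e1 : matDeriv a (pullTensor φ G) x = (matDeriv a (jac φ) x)ᵀ * G (φ x) * jac φ x
          + (jac φ x)ᵀ * (∑ q, jac φ x q a • matDeriv q G (φ x)) * jac φ x
          + (jac φ x)ᵀ * G (φ x) * matDeriv a (jac φ) x := by
        change matDeriv a (fun z => (jac φ z)ᵀ * G (φ z) * jac φ z) x = _
        rw [matDeriv_mul (hJ1.transpose.mul hGc) hJ1, matDeriv_mul hJ1.transpose hGc,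
          matDeriv_comp hG.smooth hφd, matDeriv_transpose, Matrix.add_mul]
      have e2 : ∑ q, jac φ x q a • matDeriv q G (φ x) =
          (pullConn φ G a x)ᵀ * G (φ x) + G (φ x) * pullConn φ G a x := by
        simp only [pullConn, Matrix.transpose_sum, Matrix.sum_mul, Matrix.mul_sum,
          Matrix.transpose_smul, Matrix.smul_mul, Matrix.mul_smul, ← Finset.sum_add_distrib]
        exact Finset.sum_congr rfl fun q _ => by rw [matDeriv_metric hG, smul_add]
      have e3 : ((jac φ x)⁻¹ * X a)ᵀ * pullTensor φ G x = (X a)ᵀ * G (φ x) * jac φ x := by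
        have e4 : ((jac φ x)⁻¹)ᵀ * (jac φ x)ᵀ = 1 := by
          rw [← Matrix.transpose_mul, Matrix.mul_nonsing_inv _ hu, Matrix.transpose_one]
        calc ((jac φ x)⁻¹ * X a)ᵀ * pullTensor φ G x
            = (X a)ᵀ * (((jac φ x)⁻¹)ᵀ * (jac φ x)ᵀ) * G (φ x) * jac φ x := by
              simp only [pullTensor, Matrix.transpose_mul, Matrix.mul_assoc]
          _ = _ := by rw [e4, Matrix.mul_one]
      have e5 : pullTensor φ G x * ((jac φ x)⁻¹ * X a) = (jac φ x)ᵀ * G (φ x) * X a := by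
        rw [pullTensor, Matrix.mul_assoc, Matrix.mul_nonsing_inv_cancel_left _ _ hu]
      rw [e1, e2, e3, e5, hX]
      simp only [Matrix.transpose_add, Matrix.transpose_mul]
      noncomm_ring) a
  rw [← key, Matrix.mul_nonsing_inv_cancel_left _ _ hu]

/-- The first sum carries the second derivatives of `φ`. It is symmetric in `a` and `b` and
therefore disappears from the curvature. -/
lemma matDeriv_pullConn (hG : IsMetricAt 2 G (φ x)) (hφ : ∀ p, ContDiffAt ℝ 2 (fun z => φ z p) x)
    (a b : Fin m) :
    matDeriv a (pullConn φ G b) x =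
      (∑ q, matDeriv a (jac φ) x q b • connMatrix G q (φ x)) +
      ∑ r, ∑ q, (jac φ x r a * jac φ x q b) • matDeriv r (connMatrix G q) (φ x) := by
  have hφ1 : ∀ p, ContDiffAt ℝ 1 (fun z => φ z p) x := fun p => (hφ p).of_le (by norm_num)
  have hφd : ∀ p, DifferentiableAt ℝ (fun z => φ z p) x :=
    fun p => (hφ1 p).differentiableAt (by norm_num)
  have hJ1 : MatContDiffAt 1 (jac φ) x := matContDiffAt_jac hφ (by norm_num)
  have hC : ∀ q, MatContDiffAt 1 (connMatrix G q) (φ x) := fun q =>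
    hG.smooth.connMatrix (by norm_num) hG.det_ne q
  change matDeriv a (fun z => ∑ q, jac φ z q b • connMatrix G q (φ z)) x = _
  rw [Finset.sum_comm, matDeriv_sum (E := fun q z => jac φ z q b • connMatrix G q (φ z))
    fun q _ => .smul (hJ1 q b) ((hC q).comp hφ1), ← Finset.sum_add_distrib]
  refine Finset.sum_congr rfl fun q _ => ?_
  rw [matDeriv_smul (hJ1.diff q b) ((hC q).comp hφ1), matDeriv_comp (hC q) hφd, Finset.smul_sum]
  congr 1
  exact Finset.sum_congr rfl fun r _ => by rw [smul_smul, mul_comm]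

/-- The transformation law of the curvature. -/
lemma jac_mul_curvMatrix_pullTensor (hG : IsMetricAt 2 G (φ x))
    (hφ : ∀ p, ContDiffAt ℝ 3 (fun z => φ z p) x) (hJ : (jac φ x).det ≠ 0) (a b : Fin m) :
    jac φ x * curvMatrix (pullTensor φ G) a b x =
      (∑ r, ∑ q, (jac φ x r a * jac φ x q b) • curvMatrix G r q (φ x)) * jac φ x := by
  have hφ2 : ∀ p, ContDiffAt ℝ 2 (fun z => φ z p) x := fun p => (hφ p).of_le (by norm_num)
  have hφ1 : ∀ p, ContDiffAt ℝ 1 (fun z => φ z p) x := fun p => (hφ p).of_le (by norm_num)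
  have hJ2 : MatContDiffAt 2 (jac φ) x := matContDiffAt_jac hφ (by norm_num)
  have hJ1 : MatContDiffAt 1 (jac φ) x := hJ2.of_le (by norm_num)
  have hC : ∀ q, MatContDiffAt 1 (connMatrix G q) (φ x) := fun q =>
    hG.smooth.connMatrix (by norm_num) hG.det_ne q
  have hG' : IsMetricAt 2 (pullTensor φ G) x := hG.pullTensor (by exact_mod_cast hφ) hJ
  have hC' : ∀ q, MatContDiffAt 1 (connMatrix (pullTensor φ G) q) x := fun q =>
    hG'.smooth.connMatrix (by norm_num) hG'.det_ne q
  have hP : ∀ q, MatContDiffAt 1 (pullConn φ G q) x := fun q =>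
    MatContDiffAt.sum fun r _ => .smul (hJ1 r q) ((hC r).comp hφ1)
  have law : ∀ a, ∀ᶠ z in 𝓝 x, jac φ z * connMatrix (pullTensor φ G) a z =
      matDeriv a (jac φ) z + pullConn φ G a z * jac φ z := by
    intro a
    have hc : ContinuousAt φ x := continuousAt_pi.2 fun p => (hφ p).continuousAt
    have hev : ∀ᶠ z in 𝓝 x, ∀ p, ContDiffAt ℝ 2 (fun z => φ z p) z :=
      eventually_all.2 fun p => (hφ2 p).eventually (by simp)
    filter_upwards [hc.eventually hG.eventually, hev, hJ1.det.continuousAt.eventually_ne hJ]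
      with z h1 h2 h3
    exact jac_mul_connMatrix_pullTensor (h1.of_le (by norm_num)) h2 h3 a
  -- The transformation law, differentiated. The terms `∂_a ∂_b J` are symmetric, so the third
  -- derivatives of `φ` drop out after antisymmetrization.
  have der : ∀ a b, matDeriv a (jac φ) x * connMatrix (pullTensor φ G) b x
      + jac φ x * matDeriv a (connMatrix (pullTensor φ G) b) x =
      matDeriv a (matDeriv b (jac φ)) x + (matDeriv a (pullConn φ G b) x * jac φ x
        + pullConn φ G b x * matDeriv a (jac φ) x) := by
    intro a b
    rw [← matDeriv_mul hJ1 (hC' b), ← matDeriv_mul (hP b) hJ1,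
      ← matDeriv_add (hJ2.matDeriv (by norm_num) b) ((hP b).mul hJ1)]
    exact matDeriv_congr (law b) a
  have conn : ∀ a, matDeriv a (jac φ) x =
      jac φ x * connMatrix (pullTensor φ G) a x - pullConn φ G a x * jac φ x := fun a => by
    rw [(law a).self_of_nhds, add_sub_cancel_right]
  have step : jac φ x * curvMatrix (pullTensor φ G) a b x =
      (matDeriv a (pullConn φ G b) x - matDeriv b (pullConn φ G a) x
        + (pullConn φ G a x * pullConn φ G b x - pullConn φ G b x * pullConn φ G a x))
        * jac φ x := by
    have d1 := der a b
    have d2 := der b a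
    rw [matDeriv_matDeriv_comm hJ2] at d1
    rw [conn a] at d1
    rw [conn b] at d2
    rw [curvMatrix]
    linear_combination (norm := noncomm_ring) d1 - d2
  rw [step]
  congr 1
  have s1 : ∑ q, matDeriv a (jac φ) x q b • connMatrix G q (φ x) =
      ∑ q, matDeriv b (jac φ) x q a • connMatrix G q (φ x) :=
    Finset.sum_congr rfl fun q _ => by rw [matDeriv_jac_symm hφ2 a b q]
  have s2 : ∀ a b, pullConn φ G a x * pullConn φ G b x =
      ∑ r, ∑ q, (jac φ x r a * jac φ x q b) • (connMatrix G r (φ x) * connMatrix G q (φ x)) := by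
    intro a b
    simp only [pullConn]
    rw [Finset.sum_mul_sum]
    simp only [smul_mul_smul_comm]
  have s3 : ∀ F : Fin m → Fin m → Matrix (Fin m) (Fin m) ℝ,
      ∑ r, ∑ q, (jac φ x r b * jac φ x q a) • F r q =
        ∑ r, ∑ q, (jac φ x r a * jac φ x q b) • F q r := by
    intro F
    rw [Finset.sum_comm]
    exact Finset.sum_congr rfl fun r _ => Finset.sum_congr rfl fun q _ => by rw [mul_comm]
  rw [matDeriv_pullConn hG hφ2, matDeriv_pullConn hG hφ2, s1, s2, s2, s3, s3,
    add_sub_add_left_eq_sub]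
  simp only [curvMatrix, smul_add, smul_sub, Finset.sum_add_distrib, Finset.sum_sub_distrib]

/-- Invariance of the contraction of an upper with a lower index, where `J⁻¹` and `J` cancel. It
serves both the trace defining Ricci and the divergence. -/
lemma sum_inv_mul_sum_apply {κ : Type*} {J : Matrix (Fin m) (Fin m) ℝ} (hJ : IsUnit J.det)
    (D : Fin m → Matrix (Fin m) κ ℝ) (c : κ) :
    ∑ l, (J⁻¹ * ∑ r, J r l • D r) l c = ∑ r, D r r c := by
  have h : ∀ l, (J⁻¹ * ∑ r, J r l • D r) l c = ∑ r, ∑ p, J r l * J⁻¹ l p * D r p c := by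
    intro l
    simp only [Matrix.mul_apply, Matrix.sum_apply, Matrix.smul_apply, smul_eq_mul, Finset.mul_sum]
    rw [Finset.sum_comm]
    exact Finset.sum_congr rfl fun r _ => Finset.sum_congr rfl fun p _ => by ring
  simp only [h]
  rw [Finset.sum_comm]
  refine Finset.sum_congr rfl fun r _ => ?_
  rw [Finset.sum_comm]
  have h2 : ∀ p, ∑ l, J r l * J⁻¹ l p * D r p c = (1 : Matrix (Fin m) (Fin m) ℝ) r p * D r p c := by
    intro p
    rw [← Matrix.mul_nonsing_inv J hJ, Matrix.mul_apply, Finset.sum_mul]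
  simp [h2, Matrix.one_apply]

/-- The Ricci tensor is covariant under coordinate changes. -/
theorem ricci_pullTensor (hG : IsMetricAt 2 G (φ x)) (hφ : ∀ p, ContDiffAt ℝ 3 (fun z => φ z p) x)
    (hJ : (jac φ x).det ≠ 0) :
    ricci (pullTensor φ G) x = (jac φ x)ᵀ * ricci G (φ x) * jac φ x := by
  have hu : IsUnit (jac φ x).det := isUnit_iff_ne_zero.2 hJ
  have hG' : IsMetricAt 2 (pullTensor φ G) x := hG.pullTensor (by exact_mod_cast hφ) hJ
  ext a b
  rw [ricci_eq_curvMatrix hG']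
  have h1 : ∀ l, curvMatrix (pullTensor φ G) l a x = (jac φ x)⁻¹ *
      ∑ r, jac φ x r l • ((∑ q, jac φ x q a • curvMatrix G r q (φ x)) * jac φ x) := by
    intro l
    rw [← Matrix.nonsing_inv_mul_cancel_left (jac φ x) (curvMatrix (pullTensor φ G) l a x) hu,
      jac_mul_curvMatrix_pullTensor hG hφ hJ, Matrix.sum_mul]
    simp only [mul_smul, ← Finset.smul_sum, Matrix.smul_mul]
  simp only [h1]
  rw [sum_inv_mul_sum_apply hu]
  simp only [Matrix.mul_apply, Matrix.sum_apply, Matrix.smul_apply, smul_eq_mul,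
    Matrix.transpose_apply, ricci_eq_curvMatrix hG, Finset.sum_mul, Finset.mul_sum]
  rw [Finset.sum_comm]
  refine Finset.sum_congr rfl fun s _ => ?_
  rw [Finset.sum_comm]

lemma raiseBoth_pullTensor {J : Matrix (Fin m) (Fin m) ℝ} (hJ : IsUnit J.det)
    (A h : Matrix (Fin m) (Fin m) ℝ) :
    J * raiseBoth (Jᵀ * A * J) (Jᵀ * h * J) * Jᵀ = raiseBoth A h := by
  have hJt : IsUnit Jᵀ.det := by rwa [Matrix.det_transpose]
  have e1 : (Jᵀ * A * J)⁻¹ = J⁻¹ * A⁻¹ * Jᵀ⁻¹ := by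
    rw [Matrix.mul_inv_rev, Matrix.mul_inv_rev, Matrix.mul_assoc]
  have e2 : ((Jᵀ * A * J)⁻¹)ᵀ = J⁻¹ * (A⁻¹)ᵀ * Jᵀ⁻¹ := by
    rw [e1, Matrix.transpose_mul, Matrix.transpose_mul, ← Matrix.transpose_nonsing_inv,
      Matrix.transpose_transpose, Matrix.transpose_nonsing_inv, Matrix.mul_assoc]
  calc J * raiseBoth (Jᵀ * A * J) (Jᵀ * h * J) * Jᵀ
      = (J * J⁻¹) * A⁻¹ * (Jᵀ⁻¹ * Jᵀ) * h * (J * J⁻¹) * (A⁻¹)ᵀ * (Jᵀ⁻¹ * Jᵀ) := by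
        rw [raiseBoth, e2, e1]; simp only [Matrix.mul_assoc]
    _ = raiseBoth A h := by
        rw [Matrix.mul_nonsing_inv _ hJ, Matrix.nonsing_inv_mul _ hJt]
        simp only [Matrix.one_mul, Matrix.mul_one, raiseBoth]

lemma metricTrace_eq (A h : Matrix (Fin m) (Fin m) ℝ) :
    metricTrace A h = (A⁻¹ * hᵀ).trace := by
  simp only [metricTrace, Matrix.trace, Matrix.diag, Matrix.mul_apply, Matrix.transpose_apply]

lemma traceReverse_pullTensor {J : Matrix (Fin m) (Fin m) ℝ} (hJ : IsUnit J.det)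
    (A h : Matrix (Fin m) (Fin m) ℝ) :
    traceReverse (Jᵀ * A * J) (Jᵀ * h * J) = Jᵀ * traceReverse A h * J := by
  have hJt : IsUnit Jᵀ.det := by rwa [Matrix.det_transpose]
  have h1 : metricTrace (Jᵀ * A * J) (Jᵀ * h * J) = metricTrace A h := by
    rw [metricTrace_eq, metricTrace_eq]
    have : (Jᵀ * A * J)⁻¹ * (Jᵀ * h * J)ᵀ = J⁻¹ * (A⁻¹ * hᵀ * J) := by
      simp only [Matrix.mul_inv_rev, Matrix.transpose_mul, Matrix.transpose_transpose,
        Matrix.mul_assoc]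
      rw [Matrix.nonsing_inv_mul_cancel_left _ _ hJt]
    rw [this, Matrix.trace_mul_comm, Matrix.mul_assoc, Matrix.mul_assoc,
      Matrix.mul_nonsing_inv _ hJ, Matrix.mul_one]
  rw [traceReverse, traceReverse, h1, Matrix.mul_sub, Matrix.sub_mul, Matrix.mul_smul,
    Matrix.smul_mul]

/-- The divergence of a covariant 2-tensor is covariant under coordinate changes. -/
theorem jac_mulVec_tensorDivergence_pullTensor (hG : IsMetricAt 1 G (φ x))
    {h : (Fin m → ℝ) → Matrix (Fin m) (Fin m) ℝ} (hh : MatContDiffAt 1 h (φ x))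
    (hφ : ∀ p, ContDiffAt ℝ 2 (fun z => φ z p) x) (hJ : (jac φ x).det ≠ 0) (c : Fin m) :
    ∑ b, jac φ x c b * tensorDivergence (pullTensor φ G) (pullTensor φ h) b x =
      tensorDivergence G h c (φ x) := by
  have hu : IsUnit (jac φ x).det := isUnit_iff_ne_zero.2 hJ
  have hφ1 : ∀ p, ContDiffAt ℝ 1 (fun z => φ z p) x := fun p => (hφ p).of_le (by norm_num)
  have hφd : ∀ p, DifferentiableAt ℝ (fun z => φ z p) x :=
    fun p => (hφ1 p).differentiableAt (by norm_num)
  have hJ1 : MatContDiffAt 1 (jac φ) x := matContDiffAt_jac hφ (by norm_num)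
  have hG' : IsMetricAt 1 (pullTensor φ G) x := hG.pullTensor (by exact_mod_cast hφ) hJ
  have hh' : MatContDiffAt 1 (pullTensor φ h) x := (hJ1.transpose.mul (hh.comp hφ1)).mul hJ1
  set K := fun z => raiseBoth (G z) (h z) with hK
  set K' := fun z => raiseBoth (pullTensor φ G z) (pullTensor φ h z) with hK'
  have hGi : MatContDiffAt 1 (fun z => (G z)⁻¹) (φ x) := hG.smooth.inv hG.det_ne
  have hGi' : MatContDiffAt 1 (fun z => (pullTensor φ G z)⁻¹) x := hG'.smooth.inv hG'.det_ne
  have hKc : MatContDiffAt 1 K (φ x) := (hGi.mul hh).mul hGi.transpose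
  have hKc' : MatContDiffAt 1 K' x := (hGi'.mul hh').mul hGi'.transpose
  have hev : (fun z => K (φ z)) =ᶠ[𝓝 x] fun z => jac φ z * K' z * (jac φ z)ᵀ := by
    filter_upwards [hJ1.det.continuousAt.eventually_ne hJ] with z hz
    exact (raiseBoth_pullTensor (isUnit_iff_ne_zero.2 hz) _ _).symm
  -- `∇_a K` is a tensor: the derivatives of `J` from the product rule cancel against the
  -- inhomogeneous term in the law of the Christoffel symbols.
  have hcov : ∀ a, jac φ x * (matDeriv a K' x + connMatrix (pullTensor φ G) a x * K' x
      + K' x * (connMatrix (pullTensor φ G) a x)ᵀ) * (jac φ x)ᵀ =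
      ∑ q, jac φ x q a • (matDeriv q K (φ x) + connMatrix G q (φ x) * K (φ x)
        + K (φ x) * (connMatrix G q (φ x))ᵀ) := by
    intro a
    have e1 := matDeriv_congr hev a
    rw [matDeriv_comp hKc hφd, matDeriv_mul (hJ1.mul hKc') hJ1.transpose, matDeriv_mul hJ1 hKc',
      matDeriv_transpose] at e1
    have law := jac_mul_connMatrix_pullTensor hG hφ hJ a
    have lawT := congrArg Matrix.transpose law
    rw [Matrix.transpose_mul, Matrix.transpose_add, Matrix.transpose_mul] at lawT
    have e2 : K (φ x) = jac φ x * K' x * (jac φ x)ᵀ := hev.self_of_nhds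
    have e3 : ∑ q, jac φ x q a • (matDeriv q K (φ x) + connMatrix G q (φ x) * K (φ x)
        + K (φ x) * (connMatrix G q (φ x))ᵀ) = ∑ q, jac φ x q a • matDeriv q K (φ x)
        + pullConn φ G a x * K (φ x) + K (φ x) * (pullConn φ G a x)ᵀ := by
      simp only [pullConn, Matrix.transpose_sum, Matrix.transpose_smul, Finset.sum_mul,
        Finset.mul_sum, Matrix.smul_mul, Matrix.mul_smul, smul_add, Finset.sum_add_distrib]
    rw [e3, e1, e2]
    have l1 : jac φ x * (connMatrix (pullTensor φ G) a x * K' x) * (jac φ x)ᵀ =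
        (matDeriv a (jac φ) x + pullConn φ G a x * jac φ x) * K' x * (jac φ x)ᵀ := by
      rw [← law]; noncomm_ring
    have l2 : jac φ x * (K' x * (connMatrix (pullTensor φ G) a x)ᵀ) * (jac φ x)ᵀ =
        jac φ x * K' x * ((matDeriv a (jac φ) x)ᵀ + (jac φ x)ᵀ * (pullConn φ G a x)ᵀ) := by
      rw [← lawT]; noncomm_ring
    rw [Matrix.mul_add, Matrix.mul_add, Matrix.add_mul, Matrix.add_mul, l1, l2]
    noncomm_ring
  rw [tensorDivergence_eq]
  simp only [tensorDivergence_eq]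
  rw [← sum_inv_mul_sum_apply hu]
  have h2 : ∀ a, (jac φ x)⁻¹ * ∑ q, jac φ x q a • (matDeriv q K (φ x)
      + connMatrix G q (φ x) * K (φ x) + K (φ x) * (connMatrix G q (φ x))ᵀ) =
      (matDeriv a K' x + connMatrix (pullTensor φ G) a x * K' x
      + K' x * (connMatrix (pullTensor φ G) a x)ᵀ) * (jac φ x)ᵀ := by
    intro a
    rw [← hcov, Matrix.mul_assoc, Matrix.nonsing_inv_mul_cancel_left _ _ hu]
  simp only [hK, hK'] at h2
  simp only [h2, Finset.mul_sum]
  rw [Finset.sum_comm]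
  refine Finset.sum_congr rfl fun a _ => ?_
  rw [Matrix.mul_apply]
  exact Finset.sum_congr rfl fun b _ => mul_comm _ _

end CoordinateChange

/-! ### Normal coordinates, symmetry of Ricci and the contracted Bianchi identity. -/

section Bianchi

variable {m : ℕ} {G : (Fin m → ℝ) → Matrix (Fin m) (Fin m) ℝ} {y : Fin m → ℝ}

lemma partialDeriv_apply (a q : Fin m) (y : Fin m → ℝ) :
    partialDeriv a (fun z => z q) y = if q = a then 1 else 0 := by
  have : fderiv ℝ (fun z : Fin m → ℝ => z q) y = ContinuousLinearMap.proj q :=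
    (ContinuousLinearMap.proj (R := ℝ) (φ := fun _ : Fin m => ℝ) q).fderiv
  simp [partialDeriv, this, Pi.single_apply]

/-- The map is `x ↦ y + x - (1/2) Γ(x, x)`. Only the values of `Γ` at `y` enter, so it is a
polynomial, smooth to every order however rough the metric; its second derivatives cancel the
Christoffel symbols at the origin (`pullTensor_normal`). -/
lemma exists_normal_coordinates {k : ℕ} (hG : IsMetricAt k G y) (n : WithTop ℕ∞) :
    ∃ φ : (Fin m → ℝ) → Fin m → ℝ, (∀ p x, ContDiffAt ℝ n (fun z => φ z p) x) ∧ φ 0 = y ∧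
      jac φ 0 = 1 ∧ ∀ a, matDeriv a (jac φ) 0 = -connMatrix G a y := by
  have hc : ∀ (q : Fin m) (k : WithTop ℕ∞) (x : Fin m → ℝ),
      ContDiffAt ℝ k (fun z : Fin m → ℝ => z q) x := fun q k x => (ContinuousLinearMap.proj (R := ℝ) (φ := fun _ : Fin m => ℝ) q).contDiff.contDiffAt
  have hd : ∀ (q : Fin m) (x : Fin m → ℝ), DifferentiableAt ℝ (fun z : Fin m → ℝ => z q) x :=
    fun q x => (hc q 1 x).differentiableAt (by norm_num)
  set φ : (Fin m → ℝ) → Fin m → ℝ := fun x p =>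
    y p + x p - (1 / 2) * ∑ q, ∑ r, christoffel G p q r y * (x q * x r) with hφ
  have hj : jac φ = fun x => Matrix.of fun p a =>
      (if p = a then 1 else 0) - ∑ r, christoffel G p a r y * x r := by
    ext x p a
    simp only [jac, Matrix.of_apply, hφ]
    have d1 : ∀ q r, DifferentiableAt ℝ (fun z : Fin m → ℝ => z q * z r) x :=
      fun q r => (hd q x).mul (hd r x)
    have d2 : ∀ q r, DifferentiableAt ℝ (fun z : Fin m → ℝ => christoffel G p q r y * (z q * z r)) x :=
      fun q r => (d1 q r).const_mul _
    have d3 : ∀ q, DifferentiableAt ℝ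
        (fun z : Fin m → ℝ => ∑ r, christoffel G p q r y * (z q * z r)) x :=
      fun q => DifferentiableAt.fun_sum fun r _ => d2 q r
    have d4 : DifferentiableAt ℝ
        (fun z : Fin m → ℝ => ∑ q, ∑ r, christoffel G p q r y * (z q * z r)) x :=
      DifferentiableAt.fun_sum fun q _ => d3 q
    rw [partialDeriv_sub ((differentiableAt_const _).fun_add (hd p x)) (d4.const_mul _),
      partialDeriv_add (differentiableAt_const _) (hd p x), partialDeriv_const,
      partialDeriv_const_mul d4, partialDeriv_sum fun q _ => d3 q, partialDeriv_apply, zero_add]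
    congr 1
    have e : ∀ q, partialDeriv a (fun z : Fin m → ℝ => ∑ r, christoffel G p q r y * (z q * z r)) x =
        ∑ r, (christoffel G p q r y * ((if q = a then 1 else 0) * x r)
          + christoffel G p q r y * (x q * (if r = a then 1 else 0))) := by
      intro q
      rw [partialDeriv_sum fun r _ => d2 q r]
      refine Finset.sum_congr rfl fun r _ => ?_
      rw [partialDeriv_const_mul (d1 q r), partialDeriv_mul (hd q x) (hd r x), partialDeriv_apply,
        partialDeriv_apply]
      ring
    simp only [e, Finset.sum_add_distrib, mul_ite, ite_mul, mul_one, mul_zero, one_mul, zero_mul,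
      Finset.sum_ite_eq', Finset.mem_univ, if_true]
    rw [Finset.sum_comm]
    simp only [Finset.sum_ite_eq', Finset.mem_univ, if_true, christoffel_symm hG p _ a]
    ring
  refine ⟨φ, fun p x => ?_, ?_, ?_, fun a => ?_⟩
  · refine (contDiffAt_const.add (hc p n x)).sub (contDiffAt_const.mul ?_)
    exact ContDiffAt.sum fun q _ => ContDiffAt.sum fun r _ =>
      contDiffAt_const.mul ((hc q n x).mul (hc r n x))
  · ext p; simp [hφ]
  · rw [hj]; ext p a; simp [Matrix.one_apply]
  · ext p b
    rw [matDeriv_apply, hj]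
    simp only [Matrix.of_apply, Matrix.neg_apply, connMatrix]
    rw [partialDeriv_sub (differentiableAt_const _)
      (DifferentiableAt.fun_sum fun r _ => (hd r 0).const_mul _), partialDeriv_const,
      partialDeriv_sum fun r _ => (hd r 0).const_mul _]
    simp only [partialDeriv_const_mul (hd _ 0), partialDeriv_apply, mul_ite, mul_one, mul_zero,
      Finset.sum_ite_eq', Finset.mem_univ, if_true, zero_sub, christoffel_symm hG p b a]

/-! ### Jets of the metric at a point where the connection vanishes. -/

section FlatPoint

lemma matDeriv_metric_eq_zero {k : ℕ} (h : IsMetricAt k G y) (h0 : ∀ a, connMatrix G a y = 0)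
    (a : Fin m) : matDeriv a G y = 0 := by
  simp [matDeriv_metric h, h0]

lemma lowerConn_eq_zero (hd : (G y).det ≠ 0) (h0 : ∀ a, connMatrix G a y = 0) (a : Fin m) :
    lowerConn G a y = 0 := by
  rw [← mul_connMatrix hd, h0, Matrix.mul_zero]

lemma matDeriv_inv_eq_zero {k : ℕ} (hk : 1 ≤ k) (h : IsMetricAt k G y)
    (h0 : ∀ a, connMatrix G a y = 0) (a : Fin m) : matDeriv a (fun z => (G z)⁻¹) y = 0 := by
  rw [matDeriv_inv (h.of_le hk).smooth h.det_ne, matDeriv_metric_eq_zero h h0]; simp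

lemma matDeriv_connMatrix_of_flat (h : IsMetricAt 2 G y) (h0 : ∀ a, connMatrix G a y = 0)
    (c a : Fin m) :
    matDeriv c (connMatrix G a) y = (G y)⁻¹ * matDeriv c (lowerConn G a) y := by
  have hG1 : MatContDiffAt 1 G y := (h.of_le one_le_two).smooth
  rw [show connMatrix G a = fun z => (G z)⁻¹ * lowerConn G a z from
    funext fun z => connMatrix_eq a z, matDeriv_mul (hG1.inv h.det_ne)
    (h.smooth.lowerConn (by norm_num) a), lowerConn_eq_zero h.det_ne h0]
  simp

/-- Of the four terms of the product rule for `g⁻¹` times `lowerConn`, three contain an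
undifferentiated `lowerConn` or a first derivative of `g⁻¹`, and both vanish at the point. -/
lemma matDeriv_matDeriv_connMatrix_of_flat (h : IsMetricAt 3 G y)
    (h0 : ∀ a, connMatrix G a y = 0) (c l a : Fin m) :
    matDeriv c (matDeriv l (connMatrix G a)) y =
      (G y)⁻¹ * matDeriv c (matDeriv l (lowerConn G a)) y := by
  have hG1 : IsMetricAt 1 G y := h.of_le (by norm_num)
  have hGi : MatContDiffAt 2 (fun z => (G z)⁻¹) y := (h.smooth.of_le (by norm_num)).inv h.det_ne
  have hL : MatContDiffAt 2 (lowerConn G a) y := h.smooth.lowerConn (by norm_num) a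
  have hev : matDeriv l (connMatrix G a) =ᶠ[𝓝 y] fun z =>
      matDeriv l (fun z => (G z)⁻¹) z * lowerConn G a z + (G z)⁻¹ * matDeriv l (lowerConn G a) z := by
    have hLe : ∀ᶠ z in 𝓝 y, MatContDiffAt (1 : ℕ) (lowerConn G a) z :=
      MatContDiffAt.eventually (hL.of_le (by norm_num))
    filter_upwards [hG1.eventually, hLe] with z hz hz2
    rw [show connMatrix G a = fun z => (G z)⁻¹ * lowerConn G a z from
      funext fun z => connMatrix_eq a z, matDeriv_mul (MatContDiffAt.inv (by exact_mod_cast hz.smooth) hz.det_ne)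
      (by exact_mod_cast hz2)]
  have hGi1 := hGi.of_le (k := 1) (by norm_num)
  have hL1 := hL.of_le (k := 1) (by norm_num)
  rw [matDeriv_congr hev, matDeriv_add ((hGi.matDeriv (by norm_num) l).mul hL1)
    (hGi1.mul (hL.matDeriv (by norm_num) l)), matDeriv_mul (hGi.matDeriv (by norm_num) l) hL1,
    matDeriv_mul hGi1 (hL.matDeriv (by norm_num) l), lowerConn_eq_zero h.det_ne h0,
    matDeriv_inv_eq_zero (by norm_num) h h0, matDeriv_inv_eq_zero (by norm_num) h h0]
  simp

lemma MatContDiffAt.curvMatrix {k n : WithTop ℕ∞} (h : MatContDiffAt n G y) (hk : k + 2 ≤ n)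
    (hd : (G y).det ≠ 0) (a b : Fin m) : MatContDiffAt k (curvMatrix G a b) y := by
  have hk1 : k + 1 + 1 ≤ n := by rwa [add_assoc, one_add_one_eq_two]
  have hc := fun a => h.connMatrix hk1 hd a
  have hc' := fun a => (hc a).of_le (le_self_add : k ≤ k + 1)
  exact (((hc b).matDeriv le_rfl a).sub ((hc a).matDeriv le_rfl b)).add
    (((hc' a).mul (hc' b)).sub ((hc' b).mul (hc' a)))

lemma IsMetricAt.ricci {k : WithTop ℕ∞} {j : ℕ} (h : IsMetricAt j G y) (hk : k + 2 ≤ j) :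
    MatContDiffAt k (ricci G) y := fun a b => by
  have : (fun z => _root_.ricci G z a b) =ᶠ[𝓝 y] fun z => ∑ l, _root_.curvMatrix G l a z l b := by
    filter_upwards [h.eventually] with z hz using ricci_eq_curvMatrix hz a b
  exact (ContDiffAt.sum fun l _ => h.smooth.curvMatrix hk h.det_ne l a l b).congr_of_eventuallyEq
    this

/-- The second derivatives `∂_c ∂_d g_{ab}` at a point. -/
noncomputable def metricJet₂ (G : (Fin m → ℝ) → Matrix (Fin m) (Fin m) ℝ) (y : Fin m → ℝ)
    (c d a b : Fin m) : ℝ :=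
  partialDeriv c (partialDeriv d (fun z => G z a b)) y

/-- The third derivatives `∂_c ∂_d ∂_e g_{ab}` at a point. -/
noncomputable def metricJet₃ (G : (Fin m → ℝ) → Matrix (Fin m) (Fin m) ℝ) (y : Fin m → ℝ)
    (c d e a b : Fin m) : ℝ :=
  partialDeriv c (partialDeriv d (partialDeriv e (fun z => G z a b))) y

lemma metricJet₂_swap (h : IsMetricAt 2 G y) (c d a b : Fin m) :
    metricJet₂ G y c d a b = metricJet₂ G y d c a b := partialDeriv_comm (h.smooth a b) c d

lemma metricJet₂_symm {k : ℕ} (h : IsMetricAt k G y) (c d a b : Fin m) :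
    metricJet₂ G y c d a b = metricJet₂ G y c d b a :=
  partialDeriv_congr (h.eventually.mono fun _ hz => hz.partialDeriv_symm d a b) c

lemma metricJet₃_swap₁ (h : IsMetricAt 3 G y) (c d e a b : Fin m) :
    metricJet₃ G y c d e a b = metricJet₃ G y d c e a b :=
  partialDeriv_comm ((h.smooth a b).partialDeriv (by norm_num) e) c d

lemma metricJet₃_swap₂ (h : IsMetricAt 3 G y) (c d e a b : Fin m) :
    metricJet₃ G y c d e a b = metricJet₃ G y c e d a b :=
  partialDeriv_congr (h.eventually.mono fun z hz =>
    partialDeriv_comm ((hz.smooth a b).of_le (by norm_num)) d e) c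

lemma metricJet₃_symm {k : ℕ} (h : IsMetricAt k G y) (c d e a b : Fin m) :
    metricJet₃ G y c d e a b = metricJet₃ G y c d e b a :=
  partialDeriv_congr (h.eventually.mono fun _ hz => metricJet₂_symm hz d e a b) c

lemma matDeriv_lowerConn {k : ℕ} (hk : 2 ≤ k) (h : IsMetricAt k G y) (l a c b : Fin m) :
    matDeriv l (lowerConn G a) y c b = (1 / 2) *
      (metricJet₂ G y l a b c + metricJet₂ G y l b a c - metricJet₂ G y l c a b) := by
  have hd : ∀ a b c, DifferentiableAt ℝ (partialDeriv a (fun z => G z b c)) y := fun a b c =>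
    (((h.of_le hk).smooth b c).partialDeriv (k := 1) (by norm_num) a).differentiableAt (by norm_num)
  rw [matDeriv_apply]
  simp only [lowerConn, Matrix.of_apply]
  rw [partialDeriv_const_mul (((hd _ _ _).fun_add (hd _ _ _)).fun_sub (hd _ _ _)),
    partialDeriv_sub ((hd _ _ _).fun_add (hd _ _ _)) (hd _ _ _),
    partialDeriv_add (hd _ _ _) (hd _ _ _)]
  rfl

lemma matDeriv_matDeriv_lowerConn (h : IsMetricAt 3 G y) (d l a c b : Fin m) :
    matDeriv d (matDeriv l (lowerConn G a)) y c b = (1 / 2) *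
      (metricJet₃ G y d l a b c + metricJet₃ G y d l b a c - metricJet₃ G y d l c a b) := by
  have hd : ∀ l a b c, DifferentiableAt ℝ (fun z => metricJet₂ G z l a b c) y := fun l a b c =>
    (((h.smooth b c).partialDeriv (k := 2) (by norm_num) a).partialDeriv (k := 1) (by norm_num)
      l).differentiableAt (by norm_num)
  have hev : (fun z => matDeriv l (lowerConn G a) z c b) =ᶠ[𝓝 y] fun z => (1 / 2) *
      (metricJet₂ G z l a b c + metricJet₂ G z l b a c - metricJet₂ G z l c a b) :=
    h.eventually.mono fun z hz => matDeriv_lowerConn (by norm_num) hz l a c b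
  rw [matDeriv_apply, partialDeriv_congr hev,
    partialDeriv_const_mul (((hd _ _ _ _).fun_add (hd _ _ _ _)).fun_sub (hd _ _ _ _)),
    partialDeriv_sub ((hd _ _ _ _).fun_add (hd _ _ _ _)) (hd _ _ _ _),
    partialDeriv_add (hd _ _ _ _) (hd _ _ _ _)]
  rfl

lemma ricci_of_flat (h : IsMetricAt 2 G y) (h0 : ∀ a, connMatrix G a y = 0) (a b : Fin m) :
    ricci G y a b = ∑ l, ∑ μ, (G y)⁻¹ l μ * ((1 / 2) * (metricJet₂ G y l b a μ
      - metricJet₂ G y l μ a b - metricJet₂ G y a b l μ + metricJet₂ G y a μ l b)) := by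
  rw [ricci_eq_curvMatrix h]
  refine Finset.sum_congr rfl fun l _ => ?_
  rw [curvMatrix, h0, h0, matDeriv_connMatrix_of_flat h h0, matDeriv_connMatrix_of_flat h h0,
    Matrix.mul_zero, sub_zero, add_zero, ← Matrix.mul_sub, Matrix.mul_apply]
  refine Finset.sum_congr rfl fun μ _ => ?_
  rw [Matrix.sub_apply, matDeriv_lowerConn le_rfl h, matDeriv_lowerConn le_rfl h,
    metricJet₂_swap h l a b μ]
  ring

/-- The products `Γ Γ` do not contribute even after one differentiation, since a factor `Γ` survives
in every term. What remains is linear in the third derivatives of the metric. -/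
lemma partialDeriv_ricci_of_flat (h : IsMetricAt 3 G y) (h0 : ∀ a, connMatrix G a y = 0)
    (c a b : Fin m) :
    partialDeriv c (fun z => ricci G z a b) y = ∑ l, ∑ μ, (G y)⁻¹ l μ * ((1 / 2) *
      (metricJet₃ G y c l b a μ - metricJet₃ G y c l μ a b - metricJet₃ G y c a b l μ
        + metricJet₃ G y c a μ l b)) := by
  have hev : (fun z => ricci G z a b) =ᶠ[𝓝 y] fun z => ∑ l, curvMatrix G l a z l b :=
    h.eventually.mono fun z hz => ricci_eq_curvMatrix hz a b
  have hcv : ∀ l, MatContDiffAt 1 (curvMatrix G l a) y := fun l =>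
    h.smooth.curvMatrix (by norm_num) h.det_ne l a
  rw [partialDeriv_congr hev, partialDeriv_sum fun l _ => (hcv l).diff l b]
  refine Finset.sum_congr rfl fun l _ => ?_
  have hC : ∀ a, MatContDiffAt 2 (connMatrix G a) y := fun a =>
    h.smooth.connMatrix (by norm_num) h.det_ne a
  have hC1 : ∀ a, MatContDiffAt 1 (connMatrix G a) y := fun a => (hC a).of_le (by norm_num)
  have hCd : ∀ l a, MatContDiffAt 1 (matDeriv l (connMatrix G a)) y := fun l a =>
    (hC a).matDeriv (by norm_num) l
  have e : matDeriv c (curvMatrix G l a) y = (G y)⁻¹ *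
      (matDeriv c (matDeriv l (lowerConn G a)) y - matDeriv c (matDeriv a (lowerConn G l)) y) := by
    change matDeriv c (fun z => matDeriv l (connMatrix G a) z - matDeriv a (connMatrix G l) z
      + (connMatrix G l z * connMatrix G a z - connMatrix G a z * connMatrix G l z)) y = _
    rw [matDeriv_add ((hCd l a).sub (hCd a l)) (((hC1 l).mul (hC1 a)).sub ((hC1 a).mul (hC1 l))),
      matDeriv_sub (hCd l a) (hCd a l), matDeriv_sub ((hC1 l).mul (hC1 a)) ((hC1 a).mul (hC1 l)),
      matDeriv_mul (hC1 l) (hC1 a), matDeriv_mul (hC1 a) (hC1 l), h0, h0,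
      matDeriv_matDeriv_connMatrix_of_flat h h0, matDeriv_matDeriv_connMatrix_of_flat h h0,
      Matrix.mul_sub]
    simp
  rw [← matDeriv_apply c (curvMatrix G l a) y l b, e, Matrix.mul_apply]
  refine Finset.sum_congr rfl fun μ _ => ?_
  rw [Matrix.sub_apply, matDeriv_matDeriv_lowerConn h, matDeriv_matDeriv_lowerConn h,
    metricJet₃_swap₂ h c l a b μ]
  ring

lemma IsMetricAt.inv_symm {k : ℕ} (h : IsMetricAt k G y) (a b : Fin m) :
    (G y)⁻¹ a b = (G y)⁻¹ b a := by
  have := congrFun (congrFun (Matrix.transpose_nonsing_inv (G y)) b) a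
  rwa [h.symm_apply] at this

/-- In `ricci_of_flat` the first and fourth terms are exchanged by `a ↔ b` after relabelling the
contracted indices; the other two are symmetric by themselves. -/
lemma ricci_symm_of_flat (h : IsMetricAt 2 G y) (h0 : ∀ a, connMatrix G a y = 0) (a b : Fin m) :
    ricci G y a b = ricci G y b a := by
  have e : ∀ a b, ricci G y a b = (1 / 2) * ((∑ l, ∑ μ, (G y)⁻¹ l μ * metricJet₂ G y l b a μ)
      + (∑ l, ∑ μ, (G y)⁻¹ l μ * metricJet₂ G y l a b μ)
      - ∑ l, ∑ μ, (G y)⁻¹ l μ * (metricJet₂ G y l μ a b + metricJet₂ G y a b l μ)) := by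
    intro a b
    have e1 : ∑ l, ∑ μ, (G y)⁻¹ l μ * metricJet₂ G y l a b μ =
        ∑ l, ∑ μ, (G y)⁻¹ l μ * metricJet₂ G y a μ l b := by
      rw [Finset.sum_comm]
      refine Finset.sum_congr rfl fun l _ => Finset.sum_congr rfl fun μ _ => ?_
      rw [h.inv_symm, metricJet₂_swap h, metricJet₂_symm h]
    rw [ricci_of_flat h h0, e1]
    simp only [← Finset.sum_add_distrib, ← Finset.sum_sub_distrib, Finset.mul_sum]
    exact Finset.sum_congr rfl fun l _ => Finset.sum_congr rfl fun μ _ => by ring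
  rw [e, e b a]
  have e2 : ∀ l μ, metricJet₂ G y l μ a b + metricJet₂ G y a b l μ =
      metricJet₂ G y l μ b a + metricJet₂ G y b a l μ := fun l μ => by
    rw [metricJet₂_symm h l μ, metricJet₂_swap h a b]
  simp only [e2]
  ring

/-- The identity `∇^a R_{ad} = (1/2) ∂_d R` at such a point. Both sides are contractions of third
derivatives of the metric with two copies of `g⁻¹`. On the left two of the four terms cancel; on the
right the four collapse in pairs to the same two expressions. -/
lemma sum_partialDeriv_ricci_of_flat (h : IsMetricAt 3 G y) (h0 : ∀ a, connMatrix G a y = 0)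
    (d : Fin m) :
    ∑ a, ∑ c, (G y)⁻¹ a c * partialDeriv a (fun z => ricci G z c d) y =
      (1 / 2) * ∑ a, ∑ c, (G y)⁻¹ a c * partialDeriv d (fun z => ricci G z a c) y := by
  set T := metricJet₃ G y with hT
  set g := (G y)⁻¹ with hg
  have t1 : ∀ a b c p q, T a b c p q = T b a c p q := metricJet₃_swap₁ h
  have t2 : ∀ a b c p q, T a b c p q = T a c b p q := metricJet₃_swap₂ h
  have t3 : ∀ a b c p q, T a b c p q = T a b c q p := metricJet₃_symm h
  have gs : ∀ a b, g a b = g b a := h.inv_symm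
  -- Contraction with `g^{ac} g^{lμ}`; `q1`, `q2`, `q3` are its symmetries, within each pair of
  -- indices and between the pairs.
  set Q : (Fin m → Fin m → Fin m → Fin m → ℝ) → ℝ := fun F =>
    ∑ a, ∑ c, ∑ l, ∑ μ, g a c * (g l μ * F a c l μ) with hQ
  have q1 : ∀ F, Q F = Q fun a c l μ => F c a l μ := by
    intro F
    simp only [hQ]
    rw [Finset.sum_comm]
    refine Finset.sum_congr rfl fun a _ => Finset.sum_congr rfl fun c _ => ?_
    rw [gs]
  have q2 : ∀ F, Q F = Q fun a c l μ => F a c μ l := by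
    intro F
    simp only [hQ]
    refine Finset.sum_congr rfl fun a _ => Finset.sum_congr rfl fun c _ => ?_
    rw [Finset.sum_comm]
    refine Finset.sum_congr rfl fun l _ => Finset.sum_congr rfl fun μ _ => ?_
    rw [gs l μ]
  have q3 : ∀ F, Q F = Q fun a c l μ => F l μ a c := by
    intro F
    simp only [hQ]
    calc ∑ a, ∑ c, ∑ l, ∑ μ, g a c * (g l μ * F a c l μ)
        = ∑ a, ∑ l, ∑ c, ∑ μ, g a c * (g l μ * F a c l μ) :=
          Finset.sum_congr rfl fun a _ => Finset.sum_comm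
      _ = ∑ l, ∑ a, ∑ μ, ∑ c, g a c * (g l μ * F a c l μ) := by
          rw [Finset.sum_comm]
          exact Finset.sum_congr rfl fun l _ => Finset.sum_congr rfl fun a _ => Finset.sum_comm
      _ = ∑ l, ∑ μ, ∑ a, ∑ c, g l μ * (g a c * F a c l μ) :=
          Finset.sum_congr rfl fun l _ => by
            rw [Finset.sum_comm]
            refine Finset.sum_congr rfl fun μ _ => Finset.sum_congr rfl fun a _ =>
              Finset.sum_congr rfl fun c _ => by ring
  have qe : ∀ F₁ F₂ F₃ F₄ : Fin m → Fin m → Fin m → Fin m → ℝ,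
      ∑ a, ∑ c, g a c * ∑ l, ∑ μ, g l μ * ((1 / 2) *
        (F₁ a c l μ - F₂ a c l μ - F₃ a c l μ + F₄ a c l μ)) =
      (1 / 2) * (Q F₁ - Q F₂ - Q F₃ + Q F₄) := by
    intro F₁ F₂ F₃ F₄
    simp only [hQ, ← Finset.sum_add_distrib, ← Finset.sum_sub_distrib, Finset.mul_sum]
    refine Finset.sum_congr rfl fun a _ => Finset.sum_congr rfl fun c _ =>
      Finset.sum_congr rfl fun l _ => Finset.sum_congr rfl fun μ _ => by ring
  simp only [partialDeriv_ricci_of_flat h h0]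
  rw [qe (fun a c l μ => T a l d c μ) (fun a c l μ => T a l μ c d) (fun a c l μ => T a c d l μ)
    (fun a c l μ => T a c μ l d), qe (fun a c l μ => T d l c a μ) (fun a c l μ => T d l μ a c)
    (fun a c l μ => T d a c l μ) (fun a c l μ => T d a μ l c)]
  have r1 : Q (fun a c l μ => T a l d c μ) = Q (fun a c l μ => T d l c a μ) := by
    rw [q1]; congr! 5 with a c l μ
    rw [t2, t1, t2]
  have r2 : Q (fun a c l μ => T a l μ c d) = Q (fun a c l μ => T a c μ l d) := by
    rw [q3 fun a c l μ => T a l μ c d, q2]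
    congr! 5 with a c l μ
    rw [t1, t2]
  have r3 : Q (fun a c l μ => T a c d l μ) = Q (fun a c l μ => T d a c l μ) := by
    congr! 5 with a c l μ
    rw [t2, t1]
  have r4 : Q (fun a c l μ => T d l μ a c) = Q (fun a c l μ => T d a c l μ) := by
    rw [q3]
  have r5 : Q (fun a c l μ => T d a μ l c) = Q (fun a c l μ => T d l c a μ) := by
    rw [q3]
  rw [r1, r2, r3, r4, r5]
  ring

lemma tensorDivergence_einstein_of_flat (h : IsMetricAt 3 G y) (h0 : ∀ a, connMatrix G a y = 0)
    (b : Fin m) : tensorDivergence G (einstein G) b y = 0 := by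
  have hR : MatContDiffAt 1 (ricci G) y := h.ricci (by norm_num)
  have hG1 : MatContDiffAt 1 G y := h.smooth.of_le (by norm_num)
  have hGi : MatContDiffAt 1 (fun z => (G z)⁻¹) y := hG1.inv h.det_ne
  have htd : ContDiffAt ℝ 1 (fun z => metricTrace (G z) (ricci G z)) y :=
    ContDiffAt.sum fun μ _ => ContDiffAt.sum fun ν _ => (hGi μ ν).mul (hR μ ν)
  have ht1 : ContDiffAt ℝ 1 (fun z => (1 / 2) * metricTrace (G z) (ricci G z)) y :=
    contDiffAt_const.mul htd
  have hS : MatContDiffAt 1 (einstein G) y := hR.sub (MatContDiffAt.smul ht1 hG1)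
  set g := (G y)⁻¹ with hg
  set t : Fin m → ℝ := fun a => ∑ μ, ∑ ν, g μ ν * partialDeriv a (fun z => ricci G z μ ν) y with ht
  have hgi0 : ∀ a μ ν, partialDeriv a (fun z => (G z)⁻¹ μ ν) y = 0 := fun a μ ν =>
    congrFun (congrFun (matDeriv_inv_eq_zero (by norm_num) h h0 a) μ) ν
  have htt : ∀ a, partialDeriv a (fun z => metricTrace (G z) (ricci G z)) y = t a := by
    intro a
    simp only [metricTrace, ht]
    have hd : ∀ μ ν, DifferentiableAt ℝ (fun z => (G z)⁻¹ μ ν * ricci G z μ ν) y := fun μ ν =>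
      (hGi.diff μ ν).mul (hR.diff μ ν)
    rw [partialDeriv_sum fun μ _ => DifferentiableAt.fun_sum fun ν _ => hd μ ν]
    refine Finset.sum_congr rfl fun μ _ => ?_
    rw [partialDeriv_sum fun ν _ => hd μ ν]
    refine Finset.sum_congr rfl fun ν _ => ?_
    rw [partialDeriv_mul (hGi.diff μ ν) (hR.diff μ ν), hgi0, zero_mul, zero_add]
  have hSd : ∀ a, matDeriv a (einstein G) y = matDeriv a (ricci G) y - ((1 / 2) * t a) • G y := by
    intro a
    change matDeriv a (fun z => ricci G z - ((1 / 2) * metricTrace (G z) (ricci G z)) • G z) y = _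
    rw [matDeriv_sub hR (MatContDiffAt.smul ht1 hG1),
      matDeriv_smul (ht1.differentiableAt (by norm_num)) hG1, matDeriv_metric_eq_zero h h0,
      partialDeriv_const_mul (htd.differentiableAt (by norm_num)), htt, smul_zero, add_zero]
  have hgt : gᵀ = g := by rw [hg, Matrix.transpose_nonsing_inv, h.symm_apply]
  have hK : ∀ a, matDeriv a (fun z => raiseBoth (G z) (einstein G z)) y =
      g * matDeriv a (ricci G) y * g - ((1 / 2) * t a) • g := by
    intro a
    change matDeriv a (fun z => (G z)⁻¹ * einstein G z * ((G z)⁻¹)ᵀ) y = _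
    rw [matDeriv_mul (hGi.mul hS) hGi.transpose, matDeriv_mul hGi hS, matDeriv_transpose,
      matDeriv_inv_eq_zero (by norm_num) h h0, hSd, ← hg, hgt, Matrix.zero_mul, zero_add,
      Matrix.transpose_zero, Matrix.mul_zero, add_zero, Matrix.mul_sub, Matrix.sub_mul,
      Matrix.mul_smul, Matrix.smul_mul, hg, Matrix.nonsing_inv_mul _ (isUnit_iff_ne_zero.2 h.det_ne),
      Matrix.one_mul]
  rw [tensorDivergence_eq]
  simp only [h0, hK, Matrix.zero_mul, Matrix.transpose_zero, Matrix.mul_zero, add_zero,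
    Matrix.sub_apply, Matrix.smul_apply, smul_eq_mul, Finset.sum_sub_distrib]
  have key := sum_partialDeriv_ricci_of_flat h h0
  rw [sub_eq_zero]
  calc ∑ a, (g * matDeriv a (ricci G) y * g) a b
      = ∑ d, (∑ a, ∑ c, g a c * partialDeriv a (fun z => ricci G z c d) y) * g d b := by
        simp only [Matrix.mul_apply, matDeriv_apply, Finset.sum_mul]
        rw [Finset.sum_comm]
    _ = ∑ a, 1 / 2 * t a * g a b := Finset.sum_congr rfl fun d _ => by rw [key]

end FlatPoint

lemma pullTensor_normal {φ : (Fin m → ℝ) → Fin m → ℝ} (hG : IsMetricAt 1 G (φ 0))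
    (hφ : ∀ p, ContDiffAt ℝ 2 (fun z => φ z p) 0) (hJ : jac φ 0 = 1)
    (hd : ∀ a, matDeriv a (jac φ) 0 = -connMatrix G a (φ 0)) (a : Fin m) :
    connMatrix (pullTensor φ G) a 0 = 0 := by
  have h := jac_mul_connMatrix_pullTensor hG hφ (by simp [hJ]) a
  simpa [hJ, hd, pullConn, Matrix.one_apply] using h

/-- Not visible from the definition, because of the term `∂_a Γ^l_{bl}`. Being a tensor identity, it
may be checked in normal coordinates. -/
theorem ricci_symm (h : IsMetricAt 2 G y) : (ricci G y)ᵀ = ricci G y := by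
  obtain ⟨φ, hφ, rfl, hJ, hd⟩ := exists_normal_coordinates h 3
  have hG' : IsMetricAt 2 (pullTensor φ G) 0 :=
    h.pullTensor (fun p => by exact_mod_cast hφ p 0) (by simp [hJ])
  have h0 := pullTensor_normal (h.of_le (by norm_num)) (fun p => (hφ p 0).of_le (by norm_num)) hJ hd
  have hs := ricci_symm_of_flat hG' h0
  have hp := ricci_pullTensor h (fun p => hφ p 0) (by simp [hJ])
  rw [hJ, Matrix.transpose_one, Matrix.one_mul, Matrix.mul_one] at hp
  ext a b
  rw [Matrix.transpose_apply, ← hp, hs]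

/-- The contracted Bianchi identity. -/
theorem tensorDivergence_einstein (h : IsMetricAt 3 G y) (b : Fin m) :
    tensorDivergence G (einstein G) b y = 0 := by
  obtain ⟨φ, hφ, rfl, hJ, hd⟩ := exists_normal_coordinates h 4
  have hJ0 : (jac φ 0).det ≠ 0 := by simp [hJ]
  have hG' : IsMetricAt 3 (pullTensor φ G) 0 :=
    h.pullTensor (fun p => by exact_mod_cast hφ p 0) hJ0
  have h1 : IsMetricAt 1 G (φ 0) := h.of_le (by norm_num)
  have hφ2 : ∀ p, ContDiffAt ℝ 2 (fun z => φ z p) 0 := fun p => (hφ p 0).of_le (by norm_num)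
  have h0 := pullTensor_normal h1 hφ2 hJ hd
  have hR : MatContDiffAt 1 (ricci G) (φ 0) := h.ricci (by norm_num)
  have hG1 : MatContDiffAt 1 G (φ 0) := h1.smooth
  have hGi : MatContDiffAt 1 (fun z => (G z)⁻¹) (φ 0) := hG1.inv h.det_ne
  have htd : ContDiffAt ℝ 1 (fun z => (1 / 2) * metricTrace (G z) (ricci G z)) (φ 0) :=
    contDiffAt_const.mul
      (ContDiffAt.sum fun μ _ => ContDiffAt.sum fun ν _ => (hGi μ ν).mul (hR μ ν))
  have hS : MatContDiffAt 1 (einstein G) (φ 0) := hR.sub (MatContDiffAt.smul htd hG1)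
  -- Needed near the origin and not only at it, since the divergence differentiates.
  have hev : pullTensor φ (einstein G) =ᶠ[𝓝 0] einstein (pullTensor φ G) := by
    have hc : ContinuousAt φ 0 := continuousAt_pi.2 fun p => (hφ p 0).continuousAt
    have hJ1 : MatContDiffAt 1 (jac φ) 0 := matContDiffAt_jac hφ2 (by norm_num)
    filter_upwards [hc.eventually h.eventually, hJ1.det.continuousAt.eventually_ne hJ0]
      with z hz hz2
    rw [einstein, ricci_pullTensor (hz.of_le (by norm_num)) (fun p => (hφ p z).of_le (by norm_num))
      hz2]
    exact (traceReverse_pullTensor (isUnit_iff_ne_zero.2 hz2) _ _).symm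
  have hdiv := jac_mulVec_tensorDivergence_pullTensor h1 hS hφ2 hJ0 b
  rw [← hdiv]
  refine Finset.sum_eq_zero fun c _ => ?_
  have : tensorDivergence (pullTensor φ G) (pullTensor φ (einstein G)) c 0 =
      tensorDivergence (pullTensor φ G) (einstein (pullTensor φ G)) c 0 := by
    have e2 : (fun z => raiseBoth (pullTensor φ G z) (pullTensor φ (einstein G) z)) =ᶠ[𝓝 0]
        fun z => raiseBoth (pullTensor φ G z) (einstein (pullTensor φ G) z) := by
      filter_upwards [hev] with z hz
      rw [hz]
    rw [tensorDivergence_eq, tensorDivergence_eq, hev.self_of_nhds]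
    simp only [matDeriv_congr e2]
  rw [this, tensorDivergence_einstein_of_flat hG' h0, mul_zero]

end Bianchi

/-! ### Block matrices adapted to the splitting into time and space. -/

section Bordered

variable {n : ℕ}

/-- The matrix with upper left entry `a`, first row `b`, first column `c` and lower block `A`. -/
def bordered (a : ℝ) (b c : Fin n → ℝ) (A : Matrix (Fin n) (Fin n) ℝ) :
    Matrix (Fin (n + 1)) (Fin (n + 1)) ℝ :=
  Matrix.of (Fin.cons (Fin.cons a b) fun i => Fin.cons (c i) (A i))

@[simp] lemma bordered_zero_zero (a : ℝ) (b c : Fin n → ℝ) (A : Matrix (Fin n) (Fin n) ℝ) :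
    bordered a b c A 0 0 = a := rfl
@[simp] lemma bordered_zero_succ (a : ℝ) (b c : Fin n → ℝ) (A : Matrix (Fin n) (Fin n) ℝ)
    (j : Fin n) : bordered a b c A 0 j.succ = b j := rfl
@[simp] lemma bordered_succ_zero (a : ℝ) (b c : Fin n → ℝ) (A : Matrix (Fin n) (Fin n) ℝ)
    (i : Fin n) : bordered a b c A i.succ 0 = c i := rfl
@[simp] lemma bordered_succ_succ (a : ℝ) (b c : Fin n → ℝ) (A : Matrix (Fin n) (Fin n) ℝ)
    (i j : Fin n) : bordered a b c A i.succ j.succ = A i j := rfl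

lemma eq_bordered (X : Matrix (Fin (n + 1)) (Fin (n + 1)) ℝ) :
    X = bordered (X 0 0) (fun j => X 0 j.succ) (fun i => X i.succ 0)
      (Matrix.of fun i j => X i.succ j.succ) := by
  ext i j
  refine Fin.cases ?_ (fun i => ?_) i <;> refine Fin.cases ?_ (fun j => ?_) j <;> simp

lemma bordered_mul (a a' : ℝ) (b c b' c' : Fin n → ℝ) (A A' : Matrix (Fin n) (Fin n) ℝ) :
    bordered a b c A * bordered a' b' c' A' =
      bordered (a * a' + b ⬝ᵥ c') (a • b' + b ᵥ* A') (a' • c + A *ᵥ c')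
        (Matrix.vecMulVec c b' + A * A') := by
  ext i j
  refine Fin.cases ?_ (fun i => ?_) i <;> refine Fin.cases ?_ (fun j => ?_) j <;>
    simp [Matrix.mul_apply, Fin.sum_univ_succ, dotProduct, Matrix.vecMul, Matrix.mulVec,
      Matrix.vecMulVec_apply, mul_comm]

lemma bordered_transpose (a : ℝ) (b c : Fin n → ℝ) (A : Matrix (Fin n) (Fin n) ℝ) :
    (bordered a b c A)ᵀ = bordered a c b Aᵀ := by
  ext i j
  refine Fin.cases ?_ (fun i => ?_) i <;> refine Fin.cases ?_ (fun j => ?_) j <;> simp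

lemma bordered_one : bordered 1 0 0 (1 : Matrix (Fin n) (Fin n) ℝ) = 1 := by
  ext i j
  refine Fin.cases ?_ (fun i => ?_) i <;> refine Fin.cases ?_ (fun j => ?_) j <;>
    simp [Matrix.one_apply, Fin.succ_ne_zero, (Fin.succ_ne_zero _).symm]

lemma bordered_diag_mul_inv {a : ℝ} (ha : a ≠ 0) {A : Matrix (Fin n) (Fin n) ℝ}
    (hA : IsUnit A.det) : bordered a 0 0 A * bordered a⁻¹ 0 0 A⁻¹ = 1 := by
  rw [bordered_mul, ← bordered_one, Matrix.mul_nonsing_inv _ hA]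
  simp [mul_inv_cancel₀ ha]

lemma bordered_diag_inv {a : ℝ} (ha : a ≠ 0) {A : Matrix (Fin n) (Fin n) ℝ}
    (hA : IsUnit A.det) : (bordered a 0 0 A)⁻¹ = bordered a⁻¹ 0 0 A⁻¹ :=
  Matrix.inv_eq_right_inv (bordered_diag_mul_inv ha hA)

end Bordered

/-! ### Frame, coframe and metric components in a chart. -/

section ChartGeometry

set_option linter.unusedSectionVars false

variable {n : ℕ} {M : Type*} [TopologicalSpace M] [ChartedSpace (EuclideanSpace ℝ (Fin n)) M]

lemma mdifferentiable_of_mem_maximalAtlas [IsManifold (𝓡 n) ∞ M]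
    {e : OpenPartialHomeomorph M (EuclideanSpace ℝ (Fin n))}
    (he : e ∈ IsManifold.maximalAtlas (𝓡 n) ∞ M) : e.MDifferentiable (𝓡 n) (𝓡 n) :=
  ⟨(contMDiffOn_of_mem_maximalAtlas he).mdifferentiableOn (by simp),
    (contMDiffOn_symm_of_mem_maximalAtlas he).mdifferentiableOn (by simp)⟩

lemma continuous_spacePart : Continuous (spacePart : (Fin (n + 1) → ℝ) → _) :=
  (PiLp.continuous_toLp 2 _).comp (continuous_pi fun i => continuous_apply i.succ)

lemma isOpen_coordDomain (e : OpenPartialHomeomorph M (EuclideanSpace ℝ (Fin n))) {I : Set ℝ}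
    (hI : IsOpen I) : IsOpen (coordDomain e I) :=
  (hI.preimage (continuous_apply 0)).inter (e.open_target.preimage continuous_spacePart)

variable [IsManifold (𝓡 n) ∞ M] {e : OpenPartialHomeomorph M (EuclideanSpace ℝ (Fin n))}

lemma euclidean_eq_sum_single (v : EuclideanSpace ℝ (Fin n)) :
    v = ∑ i, v i • EuclideanSpace.single i (1 : ℝ) := by
  ext j
  simp [Finset.sum_apply, Pi.single_apply]

lemma mfderiv_spaceCoordVector (he : e ∈ IsManifold.maximalAtlas (𝓡 n) ∞ M)
    {y : Fin (n + 1) → ℝ} (hy : spacePart y ∈ e.target) (i : Fin n) :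
    mfderiv (𝓡 n) (𝓡 n) e (e.symm (spacePart y)) (spaceCoordVector e y i) =
      EuclideanSpace.single i (1 : ℝ) := by
  have h := (mdifferentiable_of_mem_maximalAtlas he).comp_symm_deriv hy
  exact congrArg (fun L => L (EuclideanSpace.single i (1 : ℝ))) h

/-- A tangent vector is the combination of the coordinate vectors with its components. -/
lemma eq_sum_spaceCoordVector (he : e ∈ IsManifold.maximalAtlas (𝓡 n) ∞ M)
    {y : Fin (n + 1) → ℝ} (hy : spacePart y ∈ e.target)
    (v : TangentSpace (𝓡 n) (e.symm (spacePart y))) :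
    v = ∑ i, (show EuclideanSpace ℝ (Fin n) from
      mfderiv (𝓡 n) (𝓡 n) e (e.symm (spacePart y)) v) i • spaceCoordVector e y i := by
  apply (mdifferentiable_of_mem_maximalAtlas he).mfderiv_injective (e.map_target hy)
  rw [map_sum]
  simp only [map_smul, mfderiv_spaceCoordVector he hy]
  exact euclidean_eq_sum_single _

namespace SplitData

variable (D : SplitData n M)

lemma shift_eq_sum (he : e ∈ IsManifold.maximalAtlas (𝓡 n) ∞ M) {y : Fin (n + 1) → ℝ}
    (hy : spacePart y ∈ e.target) :
    D.shift (e.symm (spacePart y)) (y 0) = ∑ i, D.shiftComp e y i • spaceCoordVector e y i :=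
  eq_sum_spaceCoordVector he hy _

lemma coframe_eq (e : OpenPartialHomeomorph M (EuclideanSpace ℝ (Fin n))) (y : Fin (n + 1) → ℝ) :
    D.coframe e y = bordered 1 0 (D.shiftComp e y) 1 := by
  ext i j
  refine Fin.cases ?_ (fun i => ?_) i <;> refine Fin.cases ?_ (fun j => ?_) j
  · rfl
  · simp [coframe, bordered]
  · rfl
  · simp [coframe, bordered, Matrix.one_apply, Pi.single_apply, eq_comm]

/-- The matrix whose columns are the components of the Cauchy adapted frame. -/
noncomputable def frameCol (D : SplitData n M) (e : OpenPartialHomeomorph M (EuclideanSpace ℝ (Fin n)))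
    (y : Fin (n + 1) → ℝ) : Matrix (Fin (n + 1)) (Fin (n + 1)) ℝ :=
  bordered 1 0 (-D.shiftComp e y) 1

lemma frameCol_eq (e : OpenPartialHomeomorph M (EuclideanSpace ℝ (Fin n))) (y : Fin (n + 1) → ℝ) :
    D.frameCol e y = (D.frame e y)ᵀ := by
  rw [eq_comm, ← Matrix.transpose_transpose (D.frameCol e y), frameCol, bordered_transpose]
  congr 1
  ext i j
  refine Fin.cases ?_ (fun i => ?_) i <;> refine Fin.cases ?_ (fun j => ?_) j
  · rfl
  · simp [frame, bordered]
  · simp [frame, bordered]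
  · simp [frame, bordered, Matrix.one_apply, Pi.single_apply, eq_comm]

lemma coframe_mul_frameCol (e : OpenPartialHomeomorph M (EuclideanSpace ℝ (Fin n)))
    (y : Fin (n + 1) → ℝ) : D.coframe e y * D.frameCol e y = 1 := by
  rw [coframe_eq, frameCol, bordered_mul, ← bordered_one]
  simp

lemma frameCol_mul_coframe (e : OpenPartialHomeomorph M (EuclideanSpace ℝ (Fin n)))
    (y : Fin (n + 1) → ℝ) : D.frameCol e y * D.coframe e y = 1 := by
  rw [coframe_eq, frameCol, bordered_mul, ← bordered_one]
  simp

lemma isUnit_det_coframe (e : OpenPartialHomeomorph M (EuclideanSpace ℝ (Fin n)))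
    (y : Fin (n + 1) → ℝ) : IsUnit (D.coframe e y).det :=
  Matrix.isUnit_det_of_right_inverse (D.coframe_mul_frameCol e y)

lemma coframe_inv (e : OpenPartialHomeomorph M (EuclideanSpace ℝ (Fin n)))
    (y : Fin (n + 1) → ℝ) : (D.coframe e y)⁻¹ = D.frameCol e y :=
  Matrix.inv_eq_right_inv (D.coframe_mul_frameCol e y)

/-- The metric in the Cauchy adapted frame. -/
noncomputable def frameMetric (D : SplitData n M) (e : OpenPartialHomeomorph M (EuclideanSpace ℝ (Fin n)))
    (y : Fin (n + 1) → ℝ) : Matrix (Fin (n + 1)) (Fin (n + 1)) ℝ :=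
  bordered (-(D.lapseComp e y) ^ 2) 0 0 (D.spatialComp e y)

lemma spaceForm_coordVector (he : e ∈ IsManifold.maximalAtlas (𝓡 n) ∞ M) {y : Fin (n + 1) → ℝ}
    (hy : spacePart y ∈ e.target) (μ : Fin (n + 1)) :
    D.spaceForm (e.symm (spacePart y)) (y 0) (coordVector e y μ) =
      ∑ i : Fin n, D.coframe e y i.succ μ • spaceCoordVector e y i := by
  rw [coframe_eq]
  refine Fin.cases ?_ (fun j => ?_) μ
  · simp only [spaceForm, coordVector, Fin.cons_zero, LinearMap.add_apply, LinearMap.fst_apply,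
      LinearMap.smulRight_apply, LinearMap.snd_apply, zero_add, one_smul, bordered_succ_zero]
    exact D.shift_eq_sum he hy
  · simp [spaceForm, coordVector, Matrix.one_apply]

lemma coordVector_snd (y : Fin (n + 1) → ℝ) (μ : Fin (n + 1)) :
    (coordVector e y μ).2 = D.coframe e y 0 μ := by
  rw [coframe_eq]
  refine Fin.cases ?_ (fun j => ?_) μ <;> simp [coordVector]

/-- In the Cauchy adapted frame the metric is block diagonal. Every later computation with the
metric goes through this congruence. -/
lemma metric_comp_eq (he : e ∈ IsManifold.maximalAtlas (𝓡 n) ∞ M) {y : Fin (n + 1) → ℝ}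
    (hy : spacePart y ∈ e.target) :
    D.metric.comp e y = (D.coframe e y)ᵀ * D.frameMetric e y * D.coframe e y := by
  ext μ ν
  have h1 : D.metric.comp e y μ ν =
      (∑ i : Fin n, ∑ j : Fin n, D.coframe e y i.succ μ * (D.coframe e y j.succ ν
        * D.spatialComp e y i j)) - (D.lapseComp e y) ^ 2 *
        (D.coframe e y 0 μ * D.coframe e y 0 ν) := by
    simp only [SpacetimeTwoTensor.comp, metric, Matrix.of_apply, LinearMap.sub_apply,
      LinearMap.smul_apply, LinearMap.compl₁₂_apply, LinearMap.mul_apply', LinearMap.snd_apply,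
      D.coordVector_snd, D.spaceForm_coordVector he hy, map_sum, LinearMap.sum_apply, map_smul,
      smul_eq_mul, spatialComp, lapseComp, Finset.mul_sum]
    rw [Finset.sum_comm]
    congr 1
    refine Finset.sum_congr rfl fun i _ => Finset.sum_congr rfl fun j _ => ?_
    ring
  rw [h1]
  simp only [Matrix.mul_apply, Matrix.transpose_apply, Fin.sum_univ_succ, frameMetric,
    bordered_zero_zero, bordered_zero_succ, bordered_succ_zero, bordered_succ_succ, Pi.zero_apply,
    mul_zero, Finset.sum_const_zero, add_zero, zero_add, Finset.sum_mul]
  rw [Finset.sum_comm]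
  have : ∀ i j : Fin n, D.coframe e y i.succ μ * (D.coframe e y j.succ ν * D.spatialComp e y i j) =
      D.coframe e y i.succ μ * D.spatialComp e y i j * D.coframe e y j.succ ν := fun i j => by ring
  simp only [this]
  ring

variable {D} {I : Set ℝ}

lemma spatialComp_posDef (hD : D.IsRegular I) (he : e ∈ IsManifold.maximalAtlas (𝓡 n) ∞ M)
    {y : Fin (n + 1) → ℝ} (hy : y ∈ coordDomain e I) : (D.spatialComp e y).PosDef := by
  have hsum : ∀ x : Fin n → ℝ, x ⬝ᵥ (D.spatialComp e y *ᵥ x) =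
      D.spatial (e.symm (spacePart y)) (y 0) (∑ i, x i • spaceCoordVector e y i)
        (∑ i, x i • spaceCoordVector e y i) := by
    intro x
    simp only [map_sum, LinearMap.sum_apply, map_smul, LinearMap.smul_apply, smul_eq_mul,
      dotProduct, Matrix.mulVec, spatialComp, Matrix.of_apply, Finset.mul_sum]
    rw [Finset.sum_comm]
    refine Finset.sum_congr rfl fun i _ => Finset.sum_congr rfl fun j _ => ?_
    ring
  refine Matrix.PosDef.of_dotProduct_mulVec_pos ?_ fun x hx => ?_
  · ext i j
    simp only [spatialComp, Matrix.conjTranspose_apply, Matrix.of_apply, star_trivial]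
    exact hD.spatial_symm _ _ hy.1 _ _
  · rw [star_trivial, hsum]
    refine hD.spatial_pos _ _ hy.1 _ fun h0 => hx ?_
    have := congrArg (mfderiv (𝓡 n) (𝓡 n) e (e.symm (spacePart y))) h0
    rw [map_sum, map_zero] at this
    simp only [map_smul, mfderiv_spaceCoordVector he hy.2] at this
    have h2 : (WithLp.toLp 2 x : EuclideanSpace ℝ (Fin n)) = 0 :=
      (euclidean_eq_sum_single _).trans this
    ext i
    exact congrFun (congrArg WithLp.ofLp h2) i

end SplitData

end ChartGeometry

/-! ### The algebra of the constraint quantities; regularity of the coefficients. -/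

section ConstraintSystem

set_option linter.unusedSectionVars false

variable {n : ℕ} {M : Type*} [TopologicalSpace M] [ChartedSpace (EuclideanSpace ℝ (Fin n)) M]
  [IsManifold (𝓡 n) ∞ M] {e : OpenPartialHomeomorph M (EuclideanSpace ℝ (Fin n))}

lemma MatContDiffAt.bordered {k : WithTop ℕ∞} {m : ℕ} {y : Fin m → ℝ} {a : (Fin m → ℝ) → ℝ}
    {b c : (Fin m → ℝ) → Fin n → ℝ} {A : (Fin m → ℝ) → Matrix (Fin n) (Fin n) ℝ}
    (ha : ContDiffAt ℝ k a y) (hb : ∀ i, ContDiffAt ℝ k (fun z => b z i) y)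
    (hc : ∀ i, ContDiffAt ℝ k (fun z => c z i) y) (hA : MatContDiffAt k A y) :
    MatContDiffAt k (fun z => bordered (a z) (b z) (c z) (A z)) y := fun i j => by
  refine Fin.cases ?_ (fun i => ?_) i <;> refine Fin.cases ?_ (fun j => ?_) j
  exacts [ha, hb j, hc i, hA i j]

lemma matContDiffAt_const {k : WithTop ℕ∞} {m : ℕ} {ι κ : Type*} {y : Fin m → ℝ}
    (C : Matrix ι κ ℝ) : MatContDiffAt k (fun _ : Fin m → ℝ => C) y := fun _ _ => contDiffAt_const

lemma continuousOn_matrix {m : ℕ} {ι κ : Type*} {F : (Fin m → ℝ) → Matrix ι κ ℝ}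
    {Ω : Set (Fin m → ℝ)} (h : ∀ y ∈ Ω, MatContDiffAt 0 F y) : ContinuousOn F Ω :=
  continuousOn_pi.2 fun i => continuousOn_pi.2 fun j => fun y hy =>
    ((h y hy i j).continuousAt).continuousWithinAt

/-- The components `h^{αβ}`, in the Cauchy adapted frame, of the symmetric tensor `Σ` whose spatial
trace reversal vanishes, in terms of `u^α = Σ^α_0`. -/
noncomputable def constraintStress (N : ℝ) (γ : Matrix (Fin n) (Fin n) ℝ) (u : Fin (n + 1) → ℝ) :
    Matrix (Fin (n + 1)) (Fin (n + 1)) ℝ :=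
  bordered (-((N ^ 2)⁻¹ * u 0)) (fun i => -((N ^ 2)⁻¹ * u i.succ))
    (fun i => -((N ^ 2)⁻¹ * u i.succ)) (-u 0 • γ⁻¹)

lemma constraintStress_eq_sum (N : ℝ) (γ : Matrix (Fin n) (Fin n) ℝ) (u : Fin (n + 1) → ℝ) :
    constraintStress N γ u = ∑ k, u k • constraintStress N γ (Pi.single k 1) := by
  ext i j
  simp only [Matrix.sum_apply, Matrix.smul_apply, smul_eq_mul, Fin.sum_univ_succ]
  refine Fin.cases ?_ (fun i => ?_) i <;> refine Fin.cases ?_ (fun j => ?_) j <;>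
    simp [constraintStress, Pi.single_apply, Fin.succ_ne_zero, (Fin.succ_ne_zero _).symm] <;> ring

/-- The algebraic heart of the first part. A tensor without space-space components has trace `-N⁻²
x₀`, so its trace reversal has time-time component `x₀/2` and space block `(N⁻² x₀/2) γ`. Raising an
index gives `u^0 = -N⁻² x₀/2`: the space block is `-u^0 γ`, and all components are functions of `u`.
-/
lemma raiseBoth_traceReverse_bordered {N : ℝ} (hN : N ≠ 0) {γ : Matrix (Fin n) (Fin n) ℝ}
    (hγ : IsUnit γ.det) (hs : γᵀ = γ) (x₀ : ℝ) (x : Fin n → ℝ) :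
    raiseBoth (bordered (-N ^ 2) 0 0 γ) (traceReverse (bordered (-N ^ 2) 0 0 γ) (bordered x₀ x x 0))
      = constraintStress N γ (((bordered (-N ^ 2) 0 0 γ)⁻¹ *
        traceReverse (bordered (-N ^ 2) 0 0 γ) (bordered x₀ x x 0)) *ᵥ Pi.single 0 1) := by
  have hN2 : N ^ 2 ≠ 0 := pow_ne_zero 2 hN
  have hinv := bordered_diag_inv (neg_ne_zero.2 hN2) hγ
  have hγs : (γ⁻¹)ᵀ = γ⁻¹ := by rw [Matrix.transpose_nonsing_inv, hs]
  have htr : metricTrace (bordered (-N ^ 2) 0 0 γ) (bordered x₀ x x 0) = -((N ^ 2)⁻¹ * x₀) := by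
    rw [metricTrace, hinv]
    simp [Fin.sum_univ_succ, inv_neg]
  have htrev : traceReverse (bordered (-N ^ 2) 0 0 γ) (bordered x₀ x x 0) =
      bordered ((1 / 2) * x₀) x x (((1 / 2) * ((N ^ 2)⁻¹ * x₀)) • γ) := by
    rw [traceReverse, htr]
    ext i j
    refine Fin.cases ?_ (fun i => ?_) i <;> refine Fin.cases ?_ (fun j => ?_) j <;> simp
    · field_simp; ring
  have hmul : (bordered (-N ^ 2) 0 0 γ)⁻¹ * bordered ((1 / 2) * x₀) x x
      (((1 / 2) * ((N ^ 2)⁻¹ * x₀)) • γ) = bordered (-((N ^ 2)⁻¹ * ((1 / 2) * x₀)))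
        (-(N ^ 2)⁻¹ • x) (γ⁻¹ *ᵥ x) (((1 / 2) * ((N ^ 2)⁻¹ * x₀)) • 1) := by
    rw [hinv, bordered_mul, Matrix.mul_smul, Matrix.nonsing_inv_mul _ hγ]
    simp [inv_neg]
  rw [htrev, raiseBoth, hmul, hinv, bordered_transpose, hγs, bordered_mul]
  have hu : ∀ (a : ℝ) (b c : Fin n → ℝ) (A : Matrix (Fin n) (Fin n) ℝ) (i : Fin (n + 1)),
      (bordered a b c A *ᵥ Pi.single 0 1) i = bordered a b c A i 0 := fun a b c A i => by simp
  rw [constraintStress]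
  simp only [hu, bordered_zero_zero, bordered_succ_zero]
  congr 1
  · simp [inv_neg]; ring
  · ext i
    simp only [Matrix.smul_vecMul, Pi.add_apply, Pi.smul_apply, smul_eq_mul, Pi.zero_apply,
      mul_zero, zero_add]
    rw [← Matrix.mulVec_transpose, hγs]
    ring
  · ext i
    simp [inv_neg]
  · ext i j
    simp
    left; ring

namespace SplitData

variable {D : SplitData n M} {I : Set ℝ} {y : Fin (n + 1) → ℝ}

lemma lapseComp_pos (hD : D.IsRegular I) (hy : y ∈ coordDomain e I) : 0 < D.lapseComp e y :=
  hD.lapse_pos _ _ hy.1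

lemma contDiffAt_lapseComp (hI : IsOpen I) (hD : D.IsRegular I)
    (he : e ∈ IsManifold.maximalAtlas (𝓡 n) ∞ M) (hy : y ∈ coordDomain e I) :
    ContDiffAt ℝ 3 (D.lapseComp e) y :=
  (hD.lapse_contDiff e he).contDiffAt ((isOpen_coordDomain e hI).mem_nhds hy)

lemma contDiffAt_shiftComp (hI : IsOpen I) (hD : D.IsRegular I)
    (he : e ∈ IsManifold.maximalAtlas (𝓡 n) ∞ M) (hy : y ∈ coordDomain e I) (i : Fin n) :
    ContDiffAt ℝ 3 (fun z => D.shiftComp e z i) y :=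
  (hD.shift_contDiff e he i).contDiffAt ((isOpen_coordDomain e hI).mem_nhds hy)

lemma matContDiffAt_spatialComp (hI : IsOpen I) (hD : D.IsRegular I)
    (he : e ∈ IsManifold.maximalAtlas (𝓡 n) ∞ M) (hy : y ∈ coordDomain e I) :
    MatContDiffAt 3 (D.spatialComp e) y := fun i j =>
  (hD.spatial_contDiff e he i j).contDiffAt ((isOpen_coordDomain e hI).mem_nhds hy)

lemma isUnit_det_spatialComp (hD : D.IsRegular I) (he : e ∈ IsManifold.maximalAtlas (𝓡 n) ∞ M)
    (hy : y ∈ coordDomain e I) : IsUnit (D.spatialComp e y).det :=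
  (Matrix.isUnit_iff_isUnit_det _).1 (spatialComp_posDef hD he hy).isUnit

lemma spatialComp_transpose (hD : D.IsRegular I) (he : e ∈ IsManifold.maximalAtlas (𝓡 n) ∞ M)
    (hy : y ∈ coordDomain e I) : (D.spatialComp e y)ᵀ = D.spatialComp e y :=
  (spatialComp_posDef hD he hy).isHermitian

lemma matContDiffAt_coframe (hI : IsOpen I) (hD : D.IsRegular I)
    (he : e ∈ IsManifold.maximalAtlas (𝓡 n) ∞ M) (hy : y ∈ coordDomain e I) :
    MatContDiffAt 3 (D.coframe e) y := by
  rw [show D.coframe e = fun z => bordered 1 0 (D.shiftComp e z) 1 from funext (D.coframe_eq e)]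
  exact MatContDiffAt.bordered contDiffAt_const (fun _ => contDiffAt_const)
    (fun i => contDiffAt_shiftComp hI hD he hy i) (matContDiffAt_const 1)

lemma matContDiffAt_frameCol (hI : IsOpen I) (hD : D.IsRegular I)
    (he : e ∈ IsManifold.maximalAtlas (𝓡 n) ∞ M) (hy : y ∈ coordDomain e I) :
    MatContDiffAt 3 (D.frameCol e) y :=
  MatContDiffAt.bordered contDiffAt_const (fun _ => contDiffAt_const)
    (fun i => (contDiffAt_shiftComp hI hD he hy i).neg) (matContDiffAt_const 1)

lemma frameMetric_inv (hD : D.IsRegular I) (he : e ∈ IsManifold.maximalAtlas (𝓡 n) ∞ M)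
    (hy : y ∈ coordDomain e I) :
    (D.frameMetric e y)⁻¹ = bordered (-((D.lapseComp e y) ^ 2)⁻¹) 0 0 (D.spatialComp e y)⁻¹ := by
  rw [frameMetric, bordered_diag_inv (neg_ne_zero.2 (pow_ne_zero 2 (lapseComp_pos hD hy).ne'))
    (isUnit_det_spatialComp hD he hy), inv_neg]

lemma det_frameMetric_ne_zero (hD : D.IsRegular I) (he : e ∈ IsManifold.maximalAtlas (𝓡 n) ∞ M)
    (hy : y ∈ coordDomain e I) : (D.frameMetric e y).det ≠ 0 :=
  (Matrix.isUnit_det_of_right_inverse (bordered_diag_mul_inv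
    (neg_ne_zero.2 (pow_ne_zero 2 (lapseComp_pos hD hy).ne'))
    (isUnit_det_spatialComp hD he hy))).ne_zero

/-- The inverse metric in terms of the Cauchy adapted frame. -/
lemma metric_comp_inv (he : e ∈ IsManifold.maximalAtlas (𝓡 n) ∞ M)
    (hy : y ∈ coordDomain e I) :
    (D.metric.comp e y)⁻¹ = D.frameCol e y * (D.frameMetric e y)⁻¹ * (D.frameCol e y)ᵀ := by
  rw [D.metric_comp_eq he hy.2, Matrix.mul_inv_rev, Matrix.mul_inv_rev, D.coframe_inv,
    ← Matrix.transpose_nonsing_inv, D.coframe_inv, Matrix.mul_assoc]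

lemma isMetricAt_metric_comp (hI : IsOpen I) (hD : D.IsRegular I)
    (he : e ∈ IsManifold.maximalAtlas (𝓡 n) ∞ M) (hy : y ∈ coordDomain e I) :
    IsMetricAt 3 (D.metric.comp e) y := by
  have hev : ∀ᶠ z in 𝓝 y, z ∈ coordDomain e I := (isOpen_coordDomain e hI).mem_nhds hy
  have hθ := matContDiffAt_coframe hI hD he hy
  have hF : MatContDiffAt 3 (D.frameMetric e) y := MatContDiffAt.bordered
    ((contDiffAt_lapseComp hI hD he hy).pow 2).neg (fun _ => contDiffAt_const)
    (fun _ => contDiffAt_const) (matContDiffAt_spatialComp hI hD he hy)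
  refine ⟨((hθ.transpose.mul hF).mul hθ).congr (hev.mono fun z hz => D.metric_comp_eq he hz.2),
    hev.mono fun z hz => ?_, ?_⟩
  · rw [D.metric_comp_eq he hz.2, frameMetric]
    simp only [Matrix.transpose_mul, Matrix.transpose_transpose, bordered_transpose,
      spatialComp_transpose hD he hz, Matrix.mul_assoc]
  · rw [D.metric_comp_eq he hy.2, Matrix.det_mul, Matrix.det_mul, Matrix.det_transpose]
    exact mul_ne_zero (mul_ne_zero (D.isUnit_det_coframe e y).ne_zero
      (det_frameMetric_ne_zero hD he hy)) (D.isUnit_det_coframe e y).ne_zero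

end SplitData

end ConstraintSystem

/-! ### Derivation and hyperbolicity of the constraint system. -/

section ConstraintEvolution

set_option linter.unusedSectionVars false

variable {n : ℕ} {M : Type*} [TopologicalSpace M] [ChartedSpace (EuclideanSpace ℝ (Fin n)) M]
  [IsManifold (𝓡 n) ∞ M] {e : OpenPartialHomeomorph M (EuclideanSpace ℝ (Fin n))}

lemma metricTrace_sub {m : ℕ} (A h k : Matrix (Fin m) (Fin m) ℝ) :
    metricTrace A (h - k) = metricTrace A h - metricTrace A k := by
  simp only [metricTrace, Matrix.sub_apply, mul_sub, Finset.sum_sub_distrib]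

lemma traceReverse_sub {m : ℕ} (A h k : Matrix (Fin m) (Fin m) ℝ) :
    traceReverse A (h - k) = traceReverse A h - traceReverse A k := by
  simp only [traceReverse, metricTrace_sub, mul_sub, sub_smul]
  abel

lemma raiseBoth_sub {m : ℕ} (A h k : Matrix (Fin m) (Fin m) ℝ) :
    raiseBoth A (h - k) = raiseBoth A h - raiseBoth A k := by
  simp only [raiseBoth, Matrix.mul_sub, Matrix.sub_mul]

lemma MatContDiffAt.metricTrace {m k : ℕ} {A h : (Fin m → ℝ) → Matrix (Fin k) (Fin k) ℝ}
    {y : Fin m → ℝ} {r : WithTop ℕ∞} (hA : MatContDiffAt r A y) (hh : MatContDiffAt r h y)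
    (hd : (A y).det ≠ 0) : ContDiffAt ℝ r (fun z => metricTrace (A z) (h z)) y :=
  ContDiffAt.sum fun μ _ => ContDiffAt.sum fun ν _ => (hA.inv hd μ ν).mul (hh μ ν)

lemma MatContDiffAt.traceReverse {m k : ℕ} {A h : (Fin m → ℝ) → Matrix (Fin k) (Fin k) ℝ}
    {y : Fin m → ℝ} {r : WithTop ℕ∞} (hA : MatContDiffAt r A y) (hh : MatContDiffAt r h y)
    (hd : (A y).det ≠ 0) : MatContDiffAt r (fun z => traceReverse (A z) (h z)) y :=
  hh.sub (.smul (contDiffAt_const.mul (hA.metricTrace hh hd)) hA)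

lemma MatContDiffAt.raiseBoth {m k : ℕ} {A h : (Fin m → ℝ) → Matrix (Fin k) (Fin k) ℝ}
    {y : Fin m → ℝ} {r : WithTop ℕ∞} (hA : MatContDiffAt r A y) (hh : MatContDiffAt r h y)
    (hd : (A y).det ≠ 0) : MatContDiffAt r (fun z => raiseBoth (A z) (h z)) y :=
  ((hA.inv hd).mul hh).mul (hA.inv hd).transpose

lemma tensorDivergence_sub {m : ℕ} {G h k : (Fin m → ℝ) → Matrix (Fin m) (Fin m) ℝ}
    {y : Fin m → ℝ} (hG : IsMetricAt 1 G y) (hh : MatContDiffAt 1 h y) (hk : MatContDiffAt 1 k y)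
    (b : Fin m) : tensorDivergence G (fun z => h z - k z) b y =
      tensorDivergence G h b y - tensorDivergence G k b y := by
  simp only [tensorDivergence_eq, raiseBoth_sub, ← Finset.sum_sub_distrib]
  refine Finset.sum_congr rfl fun a _ => ?_
  rw [matDeriv_sub (hG.smooth.raiseBoth hh hG.det_ne) (hG.smooth.raiseBoth hk hG.det_ne),
    Matrix.mul_sub, Matrix.sub_mul]
  simp only [Matrix.add_apply, Matrix.sub_apply]
  ring

namespace SplitData

variable {D : SplitData n M} {I : Set ℝ} {y : Fin (n + 1) → ℝ} {ρ : SpacetimeTwoTensor n M}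

/-- The difference `S_{μν} - T_{μν}` in local coordinates. -/
noncomputable def residual (D : SplitData n M) (ρ : SpacetimeTwoTensor n M)
    (e : OpenPartialHomeomorph M (EuclideanSpace ℝ (Fin n))) (y : Fin (n + 1) → ℝ) :
    Matrix (Fin (n + 1)) (Fin (n + 1)) ℝ :=
  einstein (D.metric.comp e) y - D.stressEnergy ρ e y

lemma residual_eq (D : SplitData n M) (ρ : SpacetimeTwoTensor n M)
    (e : OpenPartialHomeomorph M (EuclideanSpace ℝ (Fin n))) (y : Fin (n + 1) → ℝ) :
    D.residual ρ e y =
      traceReverse (D.metric.comp e y) (ricci (D.metric.comp e) y - ρ.comp e y) :=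
  (traceReverse_sub _ _ _).symm

lemma frame_zero_eq (D : SplitData n M) (e : OpenPartialHomeomorph M (EuclideanSpace ℝ (Fin n)))
    (y : Fin (n + 1) → ℝ) : D.frame e y 0 = D.frameCol e y *ᵥ Pi.single 0 1 := by
  rw [frameCol_eq]; ext i; simp

lemma matContDiffAt_source (hI : IsOpen I) (hρ : D.SolvesEvolution ρ I)
    (he : e ∈ IsManifold.maximalAtlas (𝓡 n) ∞ M) (hy : y ∈ coordDomain e I) :
    MatContDiffAt 1 (ρ.comp e) y := fun i j =>
  (hρ.source_contDiff e he i j).contDiffAt ((isOpen_coordDomain e hI).mem_nhds hy)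

lemma matContDiffAt_einstein (hI : IsOpen I) (hD : D.IsRegular I)
    (he : e ∈ IsManifold.maximalAtlas (𝓡 n) ∞ M) (hy : y ∈ coordDomain e I) :
    MatContDiffAt 1 (einstein (D.metric.comp e)) y := by
  have hg := isMetricAt_metric_comp hI hD he hy
  exact (hg.smooth.of_le (by norm_num)).traceReverse (hg.ricci (by norm_num)) hg.det_ne

lemma matContDiffAt_stressEnergy (hI : IsOpen I) (hD : D.IsRegular I)
    (hρ : D.SolvesEvolution ρ I) (he : e ∈ IsManifold.maximalAtlas (𝓡 n) ∞ M)
    (hy : y ∈ coordDomain e I) : MatContDiffAt 1 (D.stressEnergy ρ e) y := by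
  have hg := isMetricAt_metric_comp hI hD he hy
  exact (hg.smooth.of_le (by norm_num)).traceReverse (matContDiffAt_source hI hρ he hy) hg.det_ne

lemma matContDiffAt_residual (hI : IsOpen I) (hD : D.IsRegular I)
    (hρ : D.SolvesEvolution ρ I) (he : e ∈ IsManifold.maximalAtlas (𝓡 n) ∞ M)
    (hy : y ∈ coordDomain e I) : MatContDiffAt 1 (D.residual ρ e) y :=
  (matContDiffAt_einstein hI hD he hy).sub (matContDiffAt_stressEnergy hI hD hρ he hy)

lemma constraint_eq (D : SplitData n M) (ρ : SpacetimeTwoTensor n M)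
    (e : OpenPartialHomeomorph M (EuclideanSpace ℝ (Fin n))) (y : Fin (n + 1) → ℝ) :
    D.constraint ρ e y = (D.coframe e y * (D.metric.comp e y)⁻¹ * D.residual ρ e y *
      D.frameCol e y) *ᵥ Pi.single 0 1 := by
  rw [constraint, frame_zero_eq]
  simp only [Matrix.mulVec_mulVec, Matrix.mul_assoc, residual]

lemma contDiffAt_constraint (hI : IsOpen I) (hD : D.IsRegular I) (hρ : D.SolvesEvolution ρ I)
    (he : e ∈ IsManifold.maximalAtlas (𝓡 n) ∞ M) (hy : y ∈ coordDomain e I) (k : Fin (n + 1)) :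
    ContDiffAt ℝ 1 (fun z => D.constraint ρ e z k) y := by
  have hg := isMetricAt_metric_comp hI hD he hy
  have h := ((((matContDiffAt_coframe hI hD he hy).of_le (by norm_num)).mul
    ((hg.smooth.inv hg.det_ne).of_le (by norm_num))).mul
    (matContDiffAt_residual hI hD hρ he hy)).mul
    ((matContDiffAt_frameCol hI hD he hy).of_le (by norm_num)) k 0
  have e1 : (fun z => D.constraint ρ e z k) = fun z => (D.coframe e z * (D.metric.comp e z)⁻¹ *
      D.residual ρ e z * D.frameCol e z) k 0 := by
    ext z; rw [constraint_eq]; simp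
  rw [e1]; exact h

/-- The difference of the Ricci tensor and the source has only time components. -/
lemma exists_ricci_sub_source_eq (hI : IsOpen I) (hD : D.IsRegular I) (hρ : D.SolvesEvolution ρ I)
    (he : e ∈ IsManifold.maximalAtlas (𝓡 n) ∞ M) (hy : y ∈ coordDomain e I) :
    ∃ (x₀ : ℝ) (x : Fin n → ℝ), ricci (D.metric.comp e) y - ρ.comp e y =
      (D.coframe e y)ᵀ * bordered x₀ x x 0 * D.coframe e y := by
  have hg := isMetricAt_metric_comp hI hD he hy
  set X := ricci (D.metric.comp e) y - ρ.comp e y with hX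
  have hXs : Xᵀ = X := by
    rw [hX, Matrix.transpose_sub, ricci_symm (hg.of_le (by norm_num))]
    congr 1
    ext i j
    exact hρ.source_symm _ _ hy.1 _ _
  have hX0 : (Matrix.of fun i j : Fin n => X i.succ j.succ) = 0 := by
    ext i j
    simp only [hX, Matrix.of_apply, Matrix.sub_apply, hρ.evolution e he y hy i j, sub_self,
      Matrix.zero_apply]
  set Y := (D.frameCol e y)ᵀ * X * D.frameCol e y with hY
  have hYs : Yᵀ = Y := by
    simp only [hY, Matrix.transpose_mul, Matrix.transpose_transpose, hXs, Matrix.mul_assoc]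
  -- The frame vectors `e_i` are the coordinate vectors `∂_i`, so the space-space frame components
  -- agree with the coordinate ones.
  have hY0 : (Matrix.of fun i j : Fin n => Y i.succ j.succ) = 0 := by
    rw [hY, eq_bordered X, hX0, frameCol, bordered_transpose, bordered_mul, bordered_mul]
    ext i j
    simp
  refine ⟨Y 0 0, fun j => Y 0 j.succ, ?_⟩
  have hYb : Y = bordered (Y 0 0) (fun j => Y 0 j.succ) (fun j => Y 0 j.succ) 0 := by
    conv_lhs => rw [eq_bordered Y, hY0]
    congr 1
    ext i
    exact congrFun (congrFun hYs 0) i.succ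
  rw [← hYb, hY]
  have h1 := D.frameCol_mul_coframe e y
  have h2 : (D.coframe e y)ᵀ * (D.frameCol e y)ᵀ = 1 := by
    rw [← Matrix.transpose_mul, h1, Matrix.transpose_one]
  calc X = ((D.coframe e y)ᵀ * (D.frameCol e y)ᵀ) * X * (D.frameCol e y * D.coframe e y) := by
        rw [h1, h2, Matrix.one_mul, Matrix.mul_one]
    _ = _ := by simp only [Matrix.mul_assoc]

/-- The tensor `Σ^{αβ}` in terms of the constraint quantities. -/
lemma raiseBoth_residual (hI : IsOpen I) (hD : D.IsRegular I) (hρ : D.SolvesEvolution ρ I)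
    (he : e ∈ IsManifold.maximalAtlas (𝓡 n) ∞ M) (hy : y ∈ coordDomain e I) :
    raiseBoth (D.metric.comp e y) (D.residual ρ e y) =
      D.frameCol e y * constraintStress (D.lapseComp e y) (D.spatialComp e y)
        (D.constraint ρ e y) * (D.frameCol e y)ᵀ := by
  obtain ⟨x₀, x, hX⟩ := exists_ricci_sub_source_eq hI hD hρ he hy
  have hu := D.isUnit_det_coframe e y
  have h1 := D.frameCol_mul_coframe e y
  have h2 : (D.coframe e y)ᵀ * (D.frameCol e y)ᵀ = 1 := by
    rw [← Matrix.transpose_mul, h1, Matrix.transpose_one]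
  have h3 : (D.frameCol e y)ᵀ * (D.coframe e y)ᵀ = 1 := by
    rw [← Matrix.transpose_mul, D.coframe_mul_frameCol, Matrix.transpose_one]
  have hR : D.residual ρ e y = (D.coframe e y)ᵀ *
      traceReverse (D.frameMetric e y) (bordered x₀ x x 0) * D.coframe e y := by
    rw [residual_eq, hX, D.metric_comp_eq he hy.2, traceReverse_pullTensor hu]
  have hc : D.constraint ρ e y = ((D.frameMetric e y)⁻¹ *
      traceReverse (D.frameMetric e y) (bordered x₀ x x 0)) *ᵥ Pi.single 0 1 := by
    rw [constraint_eq, hR, metric_comp_inv he hy]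
    congr 1
    calc _ = (D.coframe e y * D.frameCol e y) * (D.frameMetric e y)⁻¹ *
          ((D.frameCol e y)ᵀ * (D.coframe e y)ᵀ) *
          traceReverse (D.frameMetric e y) (bordered x₀ x x 0) *
          (D.coframe e y * D.frameCol e y) := by simp only [Matrix.mul_assoc]
      _ = _ := by rw [D.coframe_mul_frameCol, h3]; simp only [Matrix.one_mul, Matrix.mul_one]
  rw [hc, frameMetric, ← raiseBoth_traceReverse_bordered (lapseComp_pos hD hy).ne'
    (isUnit_det_spatialComp hD he hy) (spatialComp_transpose hD he hy), ← frameMetric,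
    ← raiseBoth_pullTensor hu (D.frameMetric e y), ← hR, ← D.metric_comp_eq he hy.2]
  calc _ = (D.frameCol e y * D.coframe e y) *
        raiseBoth (D.metric.comp e y) (D.residual ρ e y) *
        ((D.coframe e y)ᵀ * (D.frameCol e y)ᵀ) := by rw [h1, h2, Matrix.one_mul, Matrix.mul_one]
    _ = _ := by simp only [Matrix.mul_assoc]

/-- The coefficients of `Σ^{αβ}` as a linear function of the constraint quantities. -/
noncomputable def stressCoeff (D : SplitData n M)
    (e : OpenPartialHomeomorph M (EuclideanSpace ℝ (Fin n))) (k : Fin (n + 1))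
    (y : Fin (n + 1) → ℝ) : Matrix (Fin (n + 1)) (Fin (n + 1)) ℝ :=
  D.frameCol e y * constraintStress (D.lapseComp e y) (D.spatialComp e y) (Pi.single k 1) *
    (D.frameCol e y)ᵀ

lemma sum_smul_stressCoeff (D : SplitData n M)
    (e : OpenPartialHomeomorph M (EuclideanSpace ℝ (Fin n))) (y : Fin (n + 1) → ℝ)
    (v : Fin (n + 1) → ℝ) : ∑ k, v k • D.stressCoeff e k y =
      D.frameCol e y * constraintStress (D.lapseComp e y) (D.spatialComp e y) v *
        (D.frameCol e y)ᵀ := by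
  rw [constraintStress_eq_sum _ _ v, Matrix.mul_sum, Matrix.sum_mul]
  simp only [stressCoeff, Matrix.mul_smul, Matrix.smul_mul]

lemma matContDiffAt_stressCoeff (hI : IsOpen I) (hD : D.IsRegular I)
    (he : e ∈ IsManifold.maximalAtlas (𝓡 n) ∞ M) (hy : y ∈ coordDomain e I) (k : Fin (n + 1)) :
    MatContDiffAt 3 (D.stressCoeff e k) y := by
  have hP := matContDiffAt_frameCol hI hD he hy
  have hN : ContDiffAt ℝ 3 (fun z => ((D.lapseComp e z) ^ 2)⁻¹) y :=
    ((contDiffAt_lapseComp hI hD he hy).pow 2).inv (pow_ne_zero 2 (lapseComp_pos hD hy).ne')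
  have hγ := (matContDiffAt_spatialComp hI hD he hy).inv (isUnit_det_spatialComp hD he hy).ne_zero
  refine (hP.mul (MatContDiffAt.bordered ?_ (fun i => ?_) (fun i => ?_) ?_)).mul hP.transpose
  · exact (hN.mul contDiffAt_const).neg
  · exact (hN.mul contDiffAt_const).neg
  · exact (hN.mul contDiffAt_const).neg
  · exact MatContDiffAt.smul contDiffAt_const hγ

/-- The covariant divergences of the fields `stressCoeff`. -/
noncomputable def stressCoeffDiv (D : SplitData n M)
    (e : OpenPartialHomeomorph M (EuclideanSpace ℝ (Fin n))) (y : Fin (n + 1) → ℝ) :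
    Matrix (Fin (n + 1)) (Fin (n + 1)) ℝ :=
  Matrix.of fun b k => ∑ a, (matDeriv a (D.stressCoeff e k) y
    + connMatrix (D.metric.comp e) a y * D.stressCoeff e k y
    + D.stressCoeff e k y * (connMatrix (D.metric.comp e) a y)ᵀ) a b

/-- The factors normalizing the two kinds of equations of the constraint system. -/
noncomputable def rowFactor (D : SplitData n M)
    (e : OpenPartialHomeomorph M (EuclideanSpace ℝ (Fin n))) (y : Fin (n + 1) → ℝ) :
    Fin (n + 1) → ℝ :=
  Fin.cons (-(D.lapseComp e y) ^ 2) fun _ => -1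

/-- The zeroth order coefficients of the constraint system. -/
noncomputable def constraintCoeff (D : SplitData n M)
    (e : OpenPartialHomeomorph M (EuclideanSpace ℝ (Fin n))) (y : Fin (n + 1) → ℝ) :
    Matrix (Fin (n + 1)) (Fin (n + 1)) ℝ :=
  Matrix.diagonal (D.rowFactor e y) * (D.coframe e y * D.stressCoeffDiv e y)

/-- Recognizes the prescribed principal part in `Σ^{μβ}`, with `μ` a coordinate index and `β` a
frame index. The row factors `-N²` and `-1` turn the common factor `-N⁻²` of the time components
into the coefficients `1` and `N⁻²` of `∂_0`. -/
lemma constraintSystem_A_mulVec (hD : D.IsRegular I) (he : e ∈ IsManifold.maximalAtlas (𝓡 n) ∞ M)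
    (hy : y ∈ coordDomain e I) (B : (Fin (n + 1) → ℝ) → Matrix (Fin (n + 1)) (Fin (n + 1)) ℝ)
    (μ β : Fin (n + 1)) (v : Fin (n + 1) → ℝ) :
    ((D.constraintSystem e B).A μ y *ᵥ v) β = D.rowFactor e y β *
      (D.frameCol e y * constraintStress (D.lapseComp e y) (D.spatialComp e y) v) μ β := by
  have hN : D.lapseComp e y ≠ 0 := (lapseComp_pos hD hy).ne'
  have hs : ∀ i j, (D.spatialComp e y)⁻¹ i j = (D.spatialComp e y)⁻¹ j i := by
    intro i j
    have h := Matrix.transpose_nonsing_inv (D.spatialComp e y)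
    rw [spatialComp_transpose hD he hy] at h
    exact congrFun (congrFun h j) i
  rw [frameCol, constraintStress, bordered_mul]
  refine Fin.cases ?_ (fun j => ?_) μ <;> refine Fin.cases ?_ (fun i => ?_) β <;>
    simp [constraintSystem, rowFactor, principalTime, principalSpace, Matrix.sub_mulVec,
      Matrix.smul_mulVec, Matrix.mulVec_diagonal, Matrix.vecMulVec_apply]
  · field_simp
  · have h1 : (Matrix.of (Fin.cons (Pi.single j.succ 1) fun i =>
        Fin.cons ((D.spatialComp e y)⁻¹ i j) fun _ => 0) *ᵥ v) 0 = v j.succ :=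
      single_one_dotProduct _ _
    rw [h1]
    field_simp
    ring
  · have h1 : (Matrix.of (Fin.cons (Pi.single j.succ 1) fun i =>
        Fin.cons ((D.spatialComp e y)⁻¹ i j) fun _ => 0) *ᵥ v) i.succ =
        (D.spatialComp e y)⁻¹ i j * v 0 := by
      change (Fin.cons ((D.spatialComp e y)⁻¹ i j) fun _ => 0 : Fin (n + 1) → ℝ) ⬝ᵥ v = _
      simp [dotProduct, Fin.sum_univ_succ]
    rw [h1, hs i j]
    ring

/-- `Σ^{αβ}` is a combination of the fields `stressCoeff` with coefficients `u^k`, and it is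
divergence-free. Where the derivative falls on `u` one reads off the principal part; the divergences
of the fields `stressCoeff` form `B`, in which `ρ` does not occur. -/
theorem isSolutionOn_constraint (hI : IsOpen I) (hD : D.IsRegular I) (hρ : D.SolvesEvolution ρ I)
    (he : e ∈ IsManifold.maximalAtlas (𝓡 n) ∞ M) :
    (D.constraintSystem e (D.constraintCoeff e)).IsSolutionOn (D.constraint ρ e)
      (coordDomain e I) := by
  refine ⟨fun y hy => ContDiffAt.contDiffWithinAt
    (contDiffAt_pi.2 fun k => contDiffAt_constraint hI hD hρ he hy k), fun y hy => ?_⟩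
  have hg := isMetricAt_metric_comp hI hD he hy
  set u := D.constraint ρ e with hu
  have hu1 := fun k => contDiffAt_constraint hI hD hρ he hy k
  have hud := fun k => (hu1 k).differentiableAt (n := 1) (by norm_num)
  have hC : ∀ k, MatContDiffAt 1 (D.stressCoeff e k) y := fun k =>
    (matContDiffAt_stressCoeff hI hD he hy k).of_le (by norm_num)
  have hK : (fun z => raiseBoth (D.metric.comp e z) (D.residual ρ e z)) =ᶠ[𝓝 y]
      fun z => ∑ k, u z k • D.stressCoeff e k z := by
    filter_upwards [(isOpen_coordDomain e hI).mem_nhds hy] with z hz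
    rw [raiseBoth_residual hI hD hρ he hz, sum_smul_stressCoeff]
  -- The contracted Bianchi identity minus the conservation laws.
  have hdiv : ∀ b, tensorDivergence (D.metric.comp e) (D.residual ρ e) b y = 0 := fun b => by
    have := tensorDivergence_sub (hg.of_le (by norm_num)) (matContDiffAt_einstein hI hD he hy)
      (matContDiffAt_stressEnergy hI hD hρ he hy) b
    rw [tensorDivergence_einstein hg, hρ.conservation e he y hy, sub_zero] at this
    exact this
  set S : (Fin (n + 1) → ℝ) → Matrix (Fin (n + 1)) (Fin (n + 1)) ℝ :=
    constraintStress (D.lapseComp e y) (D.spatialComp e y) with hS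
  set du : Fin (n + 1) → Fin (n + 1) → ℝ := fun a k => partialDeriv a (fun z => u z k) y with hdu
  have hdiv2 : ∀ b, ∑ a, (D.frameCol e y * S (du a) * (D.frameCol e y)ᵀ) a b
      + (D.stressCoeffDiv e y *ᵥ u y) b = 0 := by
    intro b
    have hKy : raiseBoth (D.metric.comp e y) (D.residual ρ e y) =
      ∑ k, u y k • D.stressCoeff e k y := hK.self_of_nhds
    rw [← hdiv b, tensorDivergence_eq, hKy]
    have e1 : ∀ a, matDeriv a (fun z => raiseBoth (D.metric.comp e z) (D.residual ρ e z)) y =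
        D.frameCol e y * S (du a) * (D.frameCol e y)ᵀ
          + ∑ k, u y k • matDeriv a (D.stressCoeff e k) y := by
      intro a
      rw [matDeriv_congr hK, matDeriv_sum (E := fun k z => u z k • D.stressCoeff e k z)
        fun k _ => .smul (hu1 k) (hC k), ← sum_smul_stressCoeff, ← Finset.sum_add_distrib]
      exact Finset.sum_congr rfl fun k _ => matDeriv_smul (hud k) (hC k) a
    simp only [e1, Matrix.mulVec, dotProduct, stressCoeffDiv, Matrix.of_apply, Matrix.add_apply,
      Matrix.mul_sum, Matrix.mul_smul, Matrix.smul_mul, Matrix.sum_apply,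
      Matrix.smul_apply, smul_eq_mul, Finset.sum_add_distrib, Finset.sum_mul, add_mul, add_assoc]
    congr 1
    rw [Finset.sum_comm]
    congr 1
    · exact Finset.sum_congr rfl fun a _ => Finset.sum_congr rfl fun k _ => mul_comm _ _
    congr 1
    · rw [Finset.sum_comm]
      exact Finset.sum_congr rfl fun a _ => Finset.sum_congr rfl fun k _ => mul_comm _ _
    · rw [Finset.sum_comm]
      exact Finset.sum_congr rfl fun a _ => Finset.sum_congr rfl fun k _ => mul_comm _ _
  have h3 : (D.frameCol e y)ᵀ * (D.coframe e y)ᵀ = 1 := by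
    rw [← Matrix.transpose_mul, D.coframe_mul_frameCol, Matrix.transpose_one]
  ext β
  rw [Pi.add_apply, Finset.sum_apply]
  simp only [constraintSystem_A_mulVec hD he hy]
  change _ + (D.constraintCoeff e y *ᵥ u y) β = 0
  rw [constraintCoeff, ← Matrix.mulVec_mulVec, Matrix.mulVec_diagonal, ← Finset.mul_sum, ← mul_add,
    ← Matrix.mulVec_mulVec]
  refine mul_eq_zero_of_right _ ?_
  -- The equations refer to frame components: the coframe, applied to the second index, undoes the
  -- frame matrix there.
  have e2 : ∀ a, (D.frameCol e y * S (du a)) a β =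
      ∑ b, D.coframe e y β b * (D.frameCol e y * S (du a) * (D.frameCol e y)ᵀ) a b := by
    intro a
    have : D.frameCol e y * S (du a) =
        D.frameCol e y * S (du a) * (D.frameCol e y)ᵀ * (D.coframe e y)ᵀ := by
      rw [Matrix.mul_assoc _ (D.frameCol e y)ᵀ, h3, Matrix.mul_one]
    conv_lhs => rw [this, Matrix.mul_apply]
    exact Finset.sum_congr rfl fun b _ => mul_comm _ _
  calc _ = ∑ b, D.coframe e y β b * (∑ a, (D.frameCol e y * S (du a) * (D.frameCol e y)ᵀ) a b
        + (D.stressCoeffDiv e y *ᵥ u y) b) := by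
        simp only [mul_add, Finset.sum_add_distrib, Finset.mul_sum]
        congr 1
        rw [Finset.sum_comm]
        exact Finset.sum_congr rfl fun a _ => e2 a
    _ = 0 := by simp [hdiv2]

lemma principalTime_eq (D : SplitData n M)
    (e : OpenPartialHomeomorph M (EuclideanSpace ℝ (Fin n))) (y : Fin (n + 1) → ℝ) :
    D.principalTime e y = bordered 1 0 0 (((D.lapseComp e y) ^ 2)⁻¹ • 1) := by
  ext i j
  refine Fin.cases ?_ (fun i => ?_) i <;> refine Fin.cases ?_ (fun j => ?_) j <;>
    simp [principalTime, Matrix.diagonal_apply, Matrix.one_apply, Fin.succ_ne_zero,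
      (Fin.succ_ne_zero _).symm]

lemma principalSpace_eq (D : SplitData n M)
    (e : OpenPartialHomeomorph M (EuclideanSpace ℝ (Fin n))) (j : Fin n)
    (y : Fin (n + 1) → ℝ) : D.principalSpace e j y =
      bordered 0 (Pi.single j 1) ((D.spatialComp e y)⁻¹ *ᵥ Pi.single j 1) 0 := by
  ext a b
  refine Fin.cases ?_ (fun a => ?_) a <;> refine Fin.cases ?_ (fun b => ?_) b <;>
    simp [principalSpace, Pi.single_apply]

lemma posDef_bordered {a : ℝ} (ha : 0 < a) {A : Matrix (Fin n) (Fin n) ℝ} (hA : A.PosDef) :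
    (bordered a 0 0 A).PosDef := by
  refine Matrix.PosDef.of_dotProduct_mulVec_pos ?_ fun x hx => ?_
  · have : Aᵀ = A := hA.isHermitian
    change (bordered a 0 0 A)ᵀ = _
    rw [bordered_transpose, this]
  · have h1 : star x ⬝ᵥ (bordered a 0 0 A *ᵥ x) =
        a * x 0 ^ 2 + (fun i : Fin n => x i.succ) ⬝ᵥ (A *ᵥ fun i : Fin n => x i.succ) := by
      simp [dotProduct, Matrix.mulVec, Fin.sum_univ_succ]
      ring
    rw [h1]
    by_cases hs : (fun i : Fin n => x i.succ) = 0
    · have h0 : x 0 ≠ 0 := fun h0 => hx (by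
        ext i
        refine Fin.cases h0 (fun i => ?_) i
        exact congrFun hs i)
      rw [hs]
      simp only [Matrix.mulVec_zero, dotProduct_zero, add_zero]
      positivity
    · have h2 := hA.dotProduct_mulVec_pos hs
      rw [star_trivial] at h2
      positivity

/-- The symmetrizer of the constraint system. -/
noncomputable def symmetrizer (D : SplitData n M)
    (e : OpenPartialHomeomorph M (EuclideanSpace ℝ (Fin n))) (y : Fin (n + 1) → ℝ) :
    Matrix (Fin (n + 1)) (Fin (n + 1)) ℝ :=
  bordered 1 0 0 (D.spatialComp e y)

lemma symmetrizer_mul_principalTime (D : SplitData n M)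
    (e : OpenPartialHomeomorph M (EuclideanSpace ℝ (Fin n))) (y : Fin (n + 1) → ℝ) :
    D.symmetrizer e y * D.principalTime e y =
      bordered 1 0 0 (((D.lapseComp e y) ^ 2)⁻¹ • D.spatialComp e y) := by
  rw [symmetrizer, principalTime_eq, bordered_mul]
  simp

/-- Lowering the free index turns `g^{ij} ∂_j u^0` into `∂_i u^0`, the mirror image of the
divergence `∂_i u^i` in the equation of index `0`. -/
lemma symmetrizer_mul_principalSpace (hD : D.IsRegular I)
    (he : e ∈ IsManifold.maximalAtlas (𝓡 n) ∞ M) (hy : y ∈ coordDomain e I) (j : Fin n) :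
    D.symmetrizer e y * D.principalSpace e j y =
      bordered 0 (Pi.single j 1) (Pi.single j 1) 0 := by
  rw [symmetrizer, principalSpace_eq, bordered_mul, Matrix.mulVec_mulVec,
    Matrix.mul_nonsing_inv _ (isUnit_det_spatialComp hD he hy), Matrix.one_mulVec]
  simp

lemma matContDiffAt_principalTime (hI : IsOpen I) (hD : D.IsRegular I)
    (he : e ∈ IsManifold.maximalAtlas (𝓡 n) ∞ M) (hy : y ∈ coordDomain e I) :
    MatContDiffAt 3 (D.principalTime e) y := by
  rw [show D.principalTime e = _ from funext (D.principalTime_eq e)]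
  exact MatContDiffAt.bordered contDiffAt_const (fun _ => contDiffAt_const)
    (fun _ => contDiffAt_const) (.smul (((contDiffAt_lapseComp hI hD he hy).pow 2).inv
      (pow_ne_zero 2 (lapseComp_pos hD hy).ne')) (matContDiffAt_const 1))

lemma matContDiffAt_principalSpace (hI : IsOpen I) (hD : D.IsRegular I)
    (he : e ∈ IsManifold.maximalAtlas (𝓡 n) ∞ M) (hy : y ∈ coordDomain e I) (j : Fin n) :
    MatContDiffAt 3 (D.principalSpace e j) y := by
  rw [show D.principalSpace e j = _ from funext (D.principalSpace_eq e j)]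
  refine MatContDiffAt.bordered contDiffAt_const (fun _ => contDiffAt_const)
    (fun i => ?_) (matContDiffAt_const 0)
  simp only [Matrix.mulVec_single_one]
  exact (matContDiffAt_spatialComp hI hD he hy).inv (isUnit_det_spatialComp hD he hy).ne_zero i j

lemma matContDiffAt_symmetrizer (hI : IsOpen I) (hD : D.IsRegular I)
    (he : e ∈ IsManifold.maximalAtlas (𝓡 n) ∞ M) (hy : y ∈ coordDomain e I) :
    MatContDiffAt 3 (D.symmetrizer e) y :=
  MatContDiffAt.bordered contDiffAt_const (fun _ => contDiffAt_const)
    (fun _ => contDiffAt_const) (matContDiffAt_spatialComp hI hD he hy)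

lemma matContDiffAt_constraintSystem_A (hI : IsOpen I) (hD : D.IsRegular I)
    (he : e ∈ IsManifold.maximalAtlas (𝓡 n) ∞ M) (hy : y ∈ coordDomain e I)
    (B : (Fin (n + 1) → ℝ) → Matrix (Fin (n + 1)) (Fin (n + 1)) ℝ) (μ : Fin (n + 1)) :
    MatContDiffAt 3 ((D.constraintSystem e B).A μ) y := by
  refine Fin.cases ?_ (fun j => ?_) μ
  · exact matContDiffAt_principalTime hI hD he hy
  · exact (matContDiffAt_principalSpace hI hD he hy j).sub
      (.smul (contDiffAt_shiftComp hI hD he hy j) (matContDiffAt_principalTime hI hD he hy))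

lemma matContDiffAt_constraintCoeff (hI : IsOpen I) (hD : D.IsRegular I)
    (he : e ∈ IsManifold.maximalAtlas (𝓡 n) ∞ M) (hy : y ∈ coordDomain e I) :
    MatContDiffAt 0 (D.constraintCoeff e) y := by
  have hg := isMetricAt_metric_comp hI hD he hy
  have hΓ : ∀ a, MatContDiffAt 0 (connMatrix (D.metric.comp e) a) y := fun a =>
    hg.smooth.connMatrix (by norm_num) hg.det_ne a
  have hC : ∀ k, MatContDiffAt 1 (D.stressCoeff e k) y := fun k =>
    (matContDiffAt_stressCoeff hI hD he hy k).of_le (by norm_num)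
  have hC0 : ∀ k, MatContDiffAt 0 (D.stressCoeff e k) y := fun k => (hC k).of_le (by norm_num)
  have hZ : MatContDiffAt 0 (D.stressCoeffDiv e) y := fun b k => by
    change ContDiffAt ℝ 0 (fun z => ∑ a, (matDeriv a (D.stressCoeff e k) z
      + connMatrix (D.metric.comp e) a z * D.stressCoeff e k z
      + D.stressCoeff e k z * (connMatrix (D.metric.comp e) a z)ᵀ) a b) y
    exact ContDiffAt.sum fun a _ => ((((hC k).matDeriv (by norm_num) a).add ((hΓ a).mul (hC0 k))).add
      ((hC0 k).mul (hΓ a).transpose)) a b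
  have hF : MatContDiffAt 0 (fun z => Matrix.diagonal (D.rowFactor e z)) y := by
    intro i j
    by_cases hij : i = j
    · subst hij
      simp only [Matrix.diagonal_apply_eq]
      refine Fin.cases ?_ (fun i => contDiffAt_const) i
      exact (((contDiffAt_lapseComp hI hD he hy).pow 2).neg).of_le (by norm_num)
    · simp only [Matrix.diagonal_apply_ne _ hij]
      exact contDiffAt_const
  exact hF.mul (((matContDiffAt_coframe hI hD he hy).of_le (by norm_num)).mul hZ)

lemma symmetrizer_mul_A_zero_posDef (hD : D.IsRegular I)
    (he : e ∈ IsManifold.maximalAtlas (𝓡 n) ∞ M) (hy : y ∈ coordDomain e I)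
    (B : (Fin (n + 1) → ℝ) → Matrix (Fin (n + 1)) (Fin (n + 1)) ℝ) :
    (D.symmetrizer e y * (D.constraintSystem e B).A 0 y).PosDef := by
  change (D.symmetrizer e y * D.principalTime e y).PosDef
  rw [symmetrizer_mul_principalTime]
  exact posDef_bordered one_pos ((spatialComp_posDef hD he hy).smul
    (inv_pos.2 (pow_pos (lapseComp_pos hD hy) 2)))

lemma symmetrizer_mul_A_symm (hD : D.IsRegular I)
    (he : e ∈ IsManifold.maximalAtlas (𝓡 n) ∞ M) (hy : y ∈ coordDomain e I)
    (B : (Fin (n + 1) → ℝ) → Matrix (Fin (n + 1)) (Fin (n + 1)) ℝ) (μ : Fin (n + 1)) :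
    (D.symmetrizer e y * (D.constraintSystem e B).A μ y).IsSymm := by
  have h0 : (D.symmetrizer e y * D.principalTime e y).IsSymm := by
    rw [symmetrizer_mul_principalTime, Matrix.IsSymm, bordered_transpose, Matrix.transpose_smul,
      spatialComp_transpose hD he hy]
  refine Fin.cases h0 (fun j => ?_) μ
  change (D.symmetrizer e y *
    (D.principalSpace e j y - D.shiftComp e y j • D.principalTime e y)).IsSymm
  rw [Matrix.mul_sub, Matrix.mul_smul, symmetrizer_mul_principalSpace hD he hy]
  refine Matrix.IsSymm.sub ?_ (h0.smul _)
  rw [Matrix.IsSymm, bordered_transpose, Matrix.transpose_zero]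

theorem isSymmetrizableHyperbolicOn_constraintSystem (hI : IsOpen I) (hD : D.IsRegular I)
    (he : e ∈ IsManifold.maximalAtlas (𝓡 n) ∞ M) :
    (D.constraintSystem e (D.constraintCoeff e)).IsSymmetrizableHyperbolicOn (coordDomain e I) :=
  ⟨fun μ => continuousOn_matrix fun _ hy =>
      (matContDiffAt_constraintSystem_A hI hD he hy _ μ).of_le (by norm_num),
    continuousOn_matrix fun _ hy => matContDiffAt_constraintCoeff hI hD he hy,
    D.symmetrizer e, continuousOn_matrix fun _ hy =>
      (matContDiffAt_symmetrizer hI hD he hy).of_le (by norm_num),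
    fun _ hy => ⟨symmetrizer_mul_A_zero_posDef hD he hy _,
      symmetrizer_mul_A_symm hD he hy _⟩⟩

/-- For `d ≠ 0` a column operation clears the first column below the corner and leaves a triangular
matrix. The formula extends to `d = 0` because both sides are continuous in `d`. -/
lemma det_bordered_smul_one (hn : 1 ≤ n) (a d : ℝ) (b c : Fin n → ℝ) :
    (bordered a b c (d • 1)).det = d ^ (n - 1) * (a * d - b ⬝ᵥ c) := by
  obtain ⟨k, rfl⟩ : ∃ k, n = k + 1 := ⟨n - 1, by omega⟩
  have hne : ∀ d : ℝ, d ≠ 0 →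
      (bordered a b c (d • 1)).det = d ^ (k + 1 - 1) * (a * d - b ⬝ᵥ c) := by
    intro d hd
    have h1 : bordered a b c (d • 1) * bordered 1 0 (-(d⁻¹ • c)) 1 =
        bordered (a - d⁻¹ * (b ⬝ᵥ c)) b 0 (d • 1) := by
      rw [bordered_mul]
      congr 1
      · simp; ring
      · simp
      · ext i; simp [Matrix.smul_mulVec]; field_simp; ring
      · ext i j; simp
    have h2 : (bordered 1 0 (-(d⁻¹ • c)) (1 : Matrix (Fin (k + 1)) (Fin (k + 1)) ℝ)).det = 1 := by
      rw [Matrix.det_of_isLowerTriangular _ (fun i j hij => ?_)]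
      · simp [Fin.prod_univ_succ]
      · have hij' : i < j := hij
        revert hij'
        refine Fin.cases ?_ (fun i => ?_) i <;> refine Fin.cases ?_ (fun j => ?_) j
        · simp
        · simp
        · simp
        · intro h; simpa [Matrix.one_apply] using (Fin.succ_lt_succ_iff.1 h).ne
    have h3 : (bordered (a - d⁻¹ * (b ⬝ᵥ c)) b 0
        (d • (1 : Matrix (Fin (k + 1)) (Fin (k + 1)) ℝ))).det =
        (a - d⁻¹ * (b ⬝ᵥ c)) * d ^ (k + 1) := by
      rw [Matrix.det_of_isUpperTriangular (fun i j hij => ?_)]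
      · rw [Fin.prod_univ_succ]; simp
      · have hij' : j < i := hij
        revert hij'
        refine Fin.cases ?_ (fun i => ?_) i <;> refine Fin.cases ?_ (fun j => ?_) j
        · simp
        · simp
        · simp
        · intro h
          have : i ≠ j := (Fin.succ_lt_succ_iff.1 h).ne'
          simp [this]
    have h4 := congrArg Matrix.det h1
    rw [Matrix.det_mul, h2, mul_one, h3] at h4
    rw [h4, Nat.add_sub_cancel, pow_succ]
    field_simp
  refine congrFun (Continuous.ext_on (dense_compl_singleton (0 : ℝ)) ?_ ?_ fun d hd => hne d hd) d
  · refine Continuous.matrix_det (continuous_pi fun i => continuous_pi fun j => ?_)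
    refine Fin.cases ?_ (fun i => ?_) i <;> refine Fin.cases ?_ (fun j => ?_) j
    · exact continuous_const
    · exact continuous_const
    · exact continuous_const
    · exact continuous_id.mul continuous_const
  · fun_prop

/-- With `a = η(e_0)` the symbol has corner `a`, border `η_j` and `g^{ij} η_j`, and lower block `N⁻²
a` times the identity. The bordered determinant gives `(N⁻² a)^{n-1} (N⁻² a² - g^{ij} η_i η_j)`,
whose last factor is minus the inverse spacetime metric on `η`. -/
theorem det_symbol_constraintSystem (hn : 1 ≤ n) (hD : D.IsRegular I)
    (he : e ∈ IsManifold.maximalAtlas (𝓡 n) ∞ M) (hy : y ∈ coordDomain e I)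
    (B : (Fin (n + 1) → ℝ) → Matrix (Fin (n + 1)) (Fin (n + 1)) ℝ) (η : Fin (n + 1) → ℝ) :
    ((D.constraintSystem e B).symbol y η).det =
      (((D.lapseComp e y) ^ 2)⁻¹ * (D.frame e y 0 ⬝ᵥ η)) ^ (n - 1) *
        (-(η ⬝ᵥ ((D.metric.comp e y)⁻¹ *ᵥ η))) := by
  set ηs : Fin n → ℝ := fun i => η i.succ with hηs
  set a := D.frame e y 0 ⬝ᵥ η with ha
  have ha' : a = η 0 - ∑ j : Fin n, D.shiftComp e y j * η j.succ := by
    rw [ha, frame]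
    simp [dotProduct, Fin.sum_univ_succ, sub_eq_add_neg]
  have hsym : (D.constraintSystem e B).symbol y η =
      bordered a ηs ((D.spatialComp e y)⁻¹ *ᵥ ηs) ((((D.lapseComp e y) ^ 2)⁻¹ * a) • 1) := by
    have e1 : (D.constraintSystem e B).symbol y η = η 0 • D.principalTime e y +
        ∑ j : Fin n, η j.succ • (D.principalSpace e j y - D.shiftComp e y j • D.principalTime e y) := by
      rw [LinearFirstOrderSystem.symbol, Fin.sum_univ_succ]
      rfl
    have e2 : (D.constraintSystem e B).symbol y η = a • D.principalTime e y +
        ∑ j : Fin n, η j.succ • D.principalSpace e j y := by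
      rw [e1, ha']
      simp only [smul_sub, Finset.sum_sub_distrib, smul_smul, sub_smul, Finset.sum_smul,
        mul_comm (η _)]
      abel
    rw [e2]
    ext i j
    simp only [principalTime_eq, principalSpace_eq, Matrix.add_apply, Matrix.sum_apply,
      Matrix.smul_apply]
    refine Fin.cases ?_ (fun i => ?_) i <;> refine Fin.cases ?_ (fun j => ?_) j
    · simp
    · simp [Pi.single_apply, hηs]
    · simp [Matrix.mulVec, dotProduct, hηs, mul_comm]
    · simp; ring
  have hP : (D.frameCol e y)ᵀ *ᵥ η = Fin.cons a ηs := by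
    rw [frameCol_eq, Matrix.transpose_transpose]
    ext i
    refine Fin.cases rfl (fun i => ?_) i
    simp [frame, Matrix.mulVec, hηs]
  have hq : η ⬝ᵥ ((D.metric.comp e y)⁻¹ *ᵥ η) =
      -(((D.lapseComp e y) ^ 2)⁻¹ * a ^ 2) + ηs ⬝ᵥ ((D.spatialComp e y)⁻¹ *ᵥ ηs) := by
    rw [metric_comp_inv he hy, Matrix.mul_assoc, ← Matrix.mulVec_mulVec,
      Matrix.dotProduct_mulVec, ← Matrix.mulVec_transpose, hP, ← Matrix.mulVec_mulVec, hP,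
      frameMetric_inv hD he hy]
    simp [dotProduct, Matrix.mulVec, Fin.sum_univ_succ]
    ring
  rw [hsym, det_bordered_smul_one hn, hq]
  ring

end SplitData

end ConstraintEvolution

/-! ### Independence of the constraints from the chart. -/

section ChartChange

set_option linter.unusedSectionVars false

variable {n : ℕ} {M : Type*} [TopologicalSpace M] [ChartedSpace (EuclideanSpace ℝ (Fin n)) M]
  [IsManifold (𝓡 n) ∞ M] {e e' : OpenPartialHomeomorph M (EuclideanSpace ℝ (Fin n))}

lemma christoffel_congr {m : ℕ} {G G' : (Fin m → ℝ) → Matrix (Fin m) (Fin m) ℝ} {y : Fin m → ℝ}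
    (h : G =ᶠ[𝓝 y] G') (l a b : Fin m) : christoffel G l a b y = christoffel G' l a b y := by
  have h1 : ∀ a b c, partialDeriv a (fun z => G z b c) y = partialDeriv a (fun z => G' z b c) y :=
    fun a b c => partialDeriv_congr (h.mono fun z hz => by simp only [hz]) a
  simp only [christoffel, h1, h.self_of_nhds]

lemma ricci_congr {m : ℕ} {G G' : (Fin m → ℝ) → Matrix (Fin m) (Fin m) ℝ} {y : Fin m → ℝ}
    (h : G =ᶠ[𝓝 y] G') : ricci G y = ricci G' y := by
  have h1 : ∀ l a b, christoffel G l a b =ᶠ[𝓝 y] christoffel G' l a b := fun l a b => by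
    filter_upwards [h.eventuallyEq_nhds] with z hz using christoffel_congr hz l a b
  ext a b
  simp only [ricci, Matrix.of_apply, fun l a b c => partialDeriv_congr (h1 l a b) c,
    fun l a b => (h1 l a b).self_of_nhds]

/-- The derivative of a chart, as a linear map of the model space. -/
noncomputable def chartDeriv (e : OpenPartialHomeomorph M (EuclideanSpace ℝ (Fin n))) (x : M) :
    EuclideanSpace ℝ (Fin n) →L[ℝ] EuclideanSpace ℝ (Fin n) :=
  mfderiv (𝓡 n) (𝓡 n) e x

/-- The derivative of an inverse chart, as a linear map of the model space. -/
noncomputable def chartSymmDeriv (e : OpenPartialHomeomorph M (EuclideanSpace ℝ (Fin n)))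
    (s : EuclideanSpace ℝ (Fin n)) :
    EuclideanSpace ℝ (Fin n) →L[ℝ] EuclideanSpace ℝ (Fin n) :=
  mfderiv (𝓡 n) (𝓡 n) e.symm s

/-- The coordinate vectors, as elements of the model space. -/
noncomputable def modelVector (e : OpenPartialHomeomorph M (EuclideanSpace ℝ (Fin n)))
    (y : Fin (n + 1) → ℝ) : Fin (n + 1) → EuclideanSpace ℝ (Fin n) × ℝ :=
  Fin.cons (0, 1) fun i => (chartSymmDeriv e (spacePart y) (EuclideanSpace.single i 1), 0)

/-- Handles base points that are equal only propositionally: the coordinate vectors are read in the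
fixed model space, so the tensor can be evaluated at `q`. -/
lemma SpacetimeTwoTensor.comp_apply (h : SpacetimeTwoTensor n M) {y : Fin (n + 1) → ℝ} {q : M}
    (hq : e.symm (spacePart y) = q) (μ ν : Fin (n + 1)) :
    h.comp e y μ ν = h q (y 0) (show TangentSpace (𝓡 n) q × ℝ from modelVector e y μ)
      (show TangentSpace (𝓡 n) q × ℝ from modelVector e y ν) := by
  subst hq
  rfl

/-- The change of spacetime coordinates induced by a change of charts. -/
noncomputable def chartChange (e' e : OpenPartialHomeomorph M (EuclideanSpace ℝ (Fin n)))
    (y : Fin (n + 1) → ℝ) : Fin (n + 1) → ℝ :=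
  eventCoords e (e'.symm (spacePart y)) (y 0)

lemma spacePart_eventCoords (x : M) (t : ℝ) : spacePart (eventCoords e x t) = e x := by
  ext i
  simp [spacePart, eventCoords]

lemma eventCoords_mem_coordDomain {I : Set ℝ} {x : M} {t : ℝ} (hx : x ∈ e.source) (ht : t ∈ I) :
    eventCoords e x t ∈ coordDomain e I :=
  ⟨ht, by rw [spacePart_eventCoords]; exact e.map_source hx⟩

lemma eventCoords_symm {y : Fin (n + 1) → ℝ} (hy : spacePart y ∈ e.target) :
    eventCoords e (e.symm (spacePart y)) (y 0) = y := by
  ext i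
  refine Fin.cases rfl (fun i => ?_) i
  show e (e.symm (spacePart y)) i = y i.succ
  rw [e.right_inv hy]
  rfl

variable {y : Fin (n + 1) → ℝ}

lemma symm_spacePart_chartChange (hy' : e'.symm (spacePart y) ∈ e.source) :
    e.symm (spacePart (chartChange e' e y)) = e'.symm (spacePart y) := by
  rw [chartChange, spacePart_eventCoords, e.left_inv hy']

lemma contDiffAt_transition (he : e ∈ IsManifold.maximalAtlas (𝓡 n) ∞ M)
    (he' : e' ∈ IsManifold.maximalAtlas (𝓡 n) ∞ M) {s : EuclideanSpace ℝ (Fin n)}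
    (hs : s ∈ e'.target) (hs' : e'.symm s ∈ e.source) :
    ContDiffAt ℝ ∞ (fun z => e (e'.symm z)) s :=
  contMDiffAt_iff_contDiffAt.1
    ((contMDiffAt_of_mem_maximalAtlas he hs').comp s (contMDiffAt_symm_of_mem_maximalAtlas he' hs))

lemma fderiv_transition (he : e ∈ IsManifold.maximalAtlas (𝓡 n) ∞ M)
    (he' : e' ∈ IsManifold.maximalAtlas (𝓡 n) ∞ M) {s : EuclideanSpace ℝ (Fin n)}
    (hs : s ∈ e'.target) (hs' : e'.symm s ∈ e.source) (v : EuclideanSpace ℝ (Fin n)) :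
    fderiv ℝ (fun z => e (e'.symm z)) s v = chartDeriv e (e'.symm s) (chartSymmDeriv e' s v) := by
  have h := mfderiv_comp s ((mdifferentiable_of_mem_maximalAtlas he).mdifferentiableAt hs')
    ((mdifferentiable_of_mem_maximalAtlas he').mdifferentiableAt_symm hs)
  rw [mfderiv_eq_fderiv] at h
  exact congrArg (fun L => L v) h

/-- `spacePart` as a continuous linear map. -/
noncomputable def spacePartL (n : ℕ) : (Fin (n + 1) → ℝ) →L[ℝ] EuclideanSpace ℝ (Fin n) :=
  (PiLp.continuousLinearEquiv 2 ℝ (fun _ : Fin n => ℝ)).symm.toContinuousLinearMap.comp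
    (ContinuousLinearMap.pi fun i : Fin n =>
      ContinuousLinearMap.proj (R := ℝ) (φ := fun _ : Fin (n + 1) => ℝ) i.succ)

lemma hasFDerivAt_spacePart (y : Fin (n + 1) → ℝ) :
    HasFDerivAt (spacePart : (Fin (n + 1) → ℝ) → EuclideanSpace ℝ (Fin n)) (spacePartL n) y :=
  (spacePartL n).hasFDerivAt

lemma contDiff_spacePart {k : WithTop ℕ∞} :
    ContDiff ℝ k (spacePart : (Fin (n + 1) → ℝ) → EuclideanSpace ℝ (Fin n)) :=
  (spacePartL n).contDiff

lemma contDiffAt_chartChange (he : e ∈ IsManifold.maximalAtlas (𝓡 n) ∞ M)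
    (he' : e' ∈ IsManifold.maximalAtlas (𝓡 n) ∞ M) (hy : spacePart y ∈ e'.target)
    (hy' : e'.symm (spacePart y) ∈ e.source) (p : Fin (n + 1)) :
    ContDiffAt ℝ 3 (fun z => chartChange e' e z p) y := by
  refine Fin.cases ?_ (fun i => ?_) p
  · exact (ContinuousLinearMap.proj (R := ℝ) (φ := fun _ : Fin (n + 1) => ℝ) 0).contDiff.contDiffAt
  · have h := ((contDiffAt_transition he he' hy hy').of_le (m := 3)
      (show ((3 : ℕ∞) : WithTop ℕ∞) ≤ ∞ from WithTop.coe_le_coe.2 le_top)).comp y contDiff_spacePart.contDiffAt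
    exact ((EuclideanSpace.proj i : EuclideanSpace ℝ (Fin n) →L[ℝ] ℝ).contDiff.contDiffAt).comp y h

/-- The Jacobian matrix of a change of charts. -/
noncomputable def transitionMatrix (e' e : OpenPartialHomeomorph M (EuclideanSpace ℝ (Fin n)))
    (y : Fin (n + 1) → ℝ) : Matrix (Fin n) (Fin n) ℝ :=
  Matrix.of fun i j =>
    chartDeriv e (e'.symm (spacePart y))
      (chartSymmDeriv e' (spacePart y) (EuclideanSpace.single j 1)) i

lemma jac_chartChange (he : e ∈ IsManifold.maximalAtlas (𝓡 n) ∞ M)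
    (he' : e' ∈ IsManifold.maximalAtlas (𝓡 n) ∞ M) (hy : spacePart y ∈ e'.target)
    (hy' : e'.symm (spacePart y) ∈ e.source) :
    jac (chartChange e' e) y = bordered 1 0 0 (transitionMatrix e' e y) := by
  have h0 : ∀ a, partialDeriv a (fun z => chartChange e' e z 0) y = if (0 : Fin (n + 1)) = a then 1 else 0 :=
    fun a => partialDeriv_apply a 0 y
  have hd : DifferentiableAt ℝ (fun z => e (e'.symm z)) (spacePart y) :=
    (contDiffAt_transition he he' hy hy').differentiableAt (by simp)
  have hs : ∀ (i : Fin n) a, partialDeriv a (fun z => chartChange e' e z i.succ) y =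
      fderiv ℝ (fun z => e (e'.symm z)) (spacePart y) (spacePart (Pi.single a 1)) i := by
    intro i a
    have h1 := ((EuclideanSpace.proj i : EuclideanSpace ℝ (Fin n) →L[ℝ] ℝ).hasFDerivAt).comp y
      (hd.hasFDerivAt.comp y (hasFDerivAt_spacePart y))
    have h2 : (fun z => chartChange e' e z i.succ) =
        (EuclideanSpace.proj i : EuclideanSpace ℝ (Fin n) →L[ℝ] ℝ) ∘
          ((fun z => e (e'.symm z)) ∘ spacePart) := rfl
    rw [partialDeriv, h2, h1.fderiv]
    rfl
  ext p a
  refine Fin.cases ?_ (fun i => ?_) p <;> refine Fin.cases ?_ (fun j => ?_) a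
  · simp [jac, h0]
  · simp [jac, h0, (Fin.succ_ne_zero _).symm]
  · have : (spacePart (Pi.single 0 1 : Fin (n + 1) → ℝ)) = 0 := by
      ext i; simp [spacePart]
    simp [jac, hs, this]
  · have : (spacePart (Pi.single j.succ 1 : Fin (n + 1) → ℝ)) = EuclideanSpace.single j 1 := by
      ext i; simp [spacePart, Pi.single_apply]
    simp only [jac, Matrix.of_apply, hs, this, fderiv_transition he he' hy hy', bordered_succ_succ,
      transitionMatrix]

lemma chartSymmDeriv_single (he : e ∈ IsManifold.maximalAtlas (𝓡 n) ∞ M)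
    (hy' : e'.symm (spacePart y) ∈ e.source) (j : Fin n) :
    chartSymmDeriv e' (spacePart y) (EuclideanSpace.single j 1) =
      ∑ i, transitionMatrix e' e y i j •
        chartSymmDeriv e (spacePart (chartChange e' e y)) (EuclideanSpace.single i 1) := by
  have hq := symm_spacePart_chartChange hy'
  have ht : spacePart (chartChange e' e y) ∈ e.target := by
    rw [chartChange, spacePart_eventCoords]; exact e.map_source hy'
  have h := eq_sum_spaceCoordVector he ht
    (show EuclideanSpace ℝ (Fin n) from
      chartSymmDeriv e' (spacePart y) (EuclideanSpace.single j 1))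
  have hc : chartDeriv e (e.symm (spacePart (chartChange e' e y))) =
      chartDeriv e (e'.symm (spacePart y)) := by rw [hq]
  refine h.trans (Finset.sum_congr rfl fun i _ => ?_)
  rw [transitionMatrix, Matrix.of_apply, ← hc]
  rfl

/-- Tensor components transform by the Jacobian matrix. -/
lemma SpacetimeTwoTensor.comp_chartChange (h : SpacetimeTwoTensor n M)
    (he : e ∈ IsManifold.maximalAtlas (𝓡 n) ∞ M)
    (he' : e' ∈ IsManifold.maximalAtlas (𝓡 n) ∞ M) (hy : spacePart y ∈ e'.target)
    (hy' : e'.symm (spacePart y) ∈ e.source) :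
    h.comp e' y = pullTensor (chartChange e' e) (h.comp e) y := by
  have hv : ∀ ν, modelVector e' y ν =
      ∑ p, jac (chartChange e' e) y p ν • modelVector e (chartChange e' e y) p := by
    intro ν
    rw [jac_chartChange he he' hy hy', Fin.sum_univ_succ]
    refine Fin.cases ?_ (fun j => ?_) ν
    · simp [modelVector]
    · simp only [modelVector, bordered_zero_succ, Pi.zero_apply, zero_smul, zero_add,
        bordered_succ_succ, Fin.cons_succ, Prod.smul_mk, smul_zero]
      rw [chartSymmDeriv_single he hy' j]
      ext1
      · simp [Prod.fst_sum]
      · simp [Prod.snd_sum]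
  ext μ ν
  rw [h.comp_apply rfl, hv, hv, pullTensor]
  simp only [Matrix.mul_apply, Matrix.transpose_apply, Finset.sum_mul]
  have hcomp : ∀ p r, h.comp e (chartChange e' e y) p r = _ := fun p r =>
    h.comp_apply (symm_spacePart_chartChange hy') p r
  simp only [hcomp]
  set L : LinearMap.BilinForm ℝ (EuclideanSpace ℝ (Fin n) × ℝ) :=
    h (e'.symm (spacePart y)) (y 0) with hL
  change L (∑ p, jac (chartChange e' e) y p μ • modelVector e (chartChange e' e y) p)
    (∑ p, jac (chartChange e' e) y p ν • modelVector e (chartChange e' e y) p) =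
    ∑ r, ∑ p, jac (chartChange e' e) y p μ * L (modelVector e (chartChange e' e y) p)
      (modelVector e (chartChange e' e y) r) * jac (chartChange e' e) y r ν
  simp only [map_sum, LinearMap.sum_apply, map_smul, LinearMap.smul_apply, smul_eq_mul,
    Finset.mul_sum]
  refine Finset.sum_congr rfl fun r _ => Finset.sum_congr rfl fun p _ => by ring

namespace SplitData

variable {D : SplitData n M} {I : Set ℝ} {ρ : SpacetimeTwoTensor n M}

lemma shiftComp_chartChange
    (he' : e' ∈ IsManifold.maximalAtlas (𝓡 n) ∞ M) (hy : spacePart y ∈ e'.target)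
    (hy' : e'.symm (spacePart y) ∈ e.source) :
    D.shiftComp e (chartChange e' e y) = transitionMatrix e' e y *ᵥ D.shiftComp e' y := by
  have hq := symm_spacePart_chartChange hy'
  have h0 : ∀ q, e.symm (spacePart (chartChange e' e y)) = q →
      ∀ i, D.shiftComp e (chartChange e' e y) i =
        chartDeriv e q (show EuclideanSpace ℝ (Fin n) from D.shift q (y 0)) i := by
    rintro q rfl i
    rfl
  ext i
  rw [h0 _ hq]
  have h1 : (show EuclideanSpace ℝ (Fin n) from D.shift (e'.symm (spacePart y)) (y 0)) =
      ∑ j, D.shiftComp e' y j • chartSymmDeriv e' (spacePart y) (EuclideanSpace.single j 1) :=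
    D.shift_eq_sum he' hy
  rw [h1, map_sum]
  simp [Matrix.mulVec, dotProduct, transitionMatrix, mul_comm]

lemma det_jac_chartChange_ne_zero (he : e ∈ IsManifold.maximalAtlas (𝓡 n) ∞ M)
    (he' : e' ∈ IsManifold.maximalAtlas (𝓡 n) ∞ M) (hy : spacePart y ∈ e'.target)
    (hy' : e'.symm (spacePart y) ∈ e.source) :
    (jac (chartChange e' e) y).det ≠ 0 := by
  rw [Ne, ← Matrix.exists_mulVec_eq_zero_iff]
  rintro ⟨v, hv, h0⟩
  rw [jac_chartChange he he' hy hy'] at h0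
  refine hv ?_
  have hv0 : v 0 = 0 := by
    have := congrFun h0 0
    simpa [Matrix.mulVec, dotProduct, Fin.sum_univ_succ] using this
  have hT : ∀ i, ∑ j, transitionMatrix e' e y i j * v j.succ = 0 := fun i => by
    have := congrFun h0 i.succ
    simpa [Matrix.mulVec, dotProduct, Fin.sum_univ_succ] using this
  have h1 : chartDeriv e (e'.symm (spacePart y)) (chartSymmDeriv e' (spacePart y)
      (∑ j, v j.succ • EuclideanSpace.single j 1)) = 0 := by
    ext i
    rw [map_sum, map_sum]
    simpa [transitionMatrix, mul_comm] using hT i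
  have h2 : chartSymmDeriv e' (spacePart y) (∑ j : Fin n, v j.succ • EuclideanSpace.single j 1) = 0 :=
    (mdifferentiable_of_mem_maximalAtlas he).mfderiv_injective hy' (h1.trans (map_zero _).symm)
  have h3 : (∑ j : Fin n, v j.succ • EuclideanSpace.single j (1 : ℝ)) = 0 :=
    (mdifferentiable_of_mem_maximalAtlas he').symm.mfderiv_injective hy (h2.trans (map_zero _).symm)
  ext i
  refine Fin.cases hv0 (fun i => ?_) i
  have := congrArg (fun w : EuclideanSpace ℝ (Fin n) => w i) h3
  simpa [Pi.single_apply] using this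

lemma residual_chartChange (hI : IsOpen I) (hD : D.IsRegular I)
    (he : e ∈ IsManifold.maximalAtlas (𝓡 n) ∞ M)
    (he' : e' ∈ IsManifold.maximalAtlas (𝓡 n) ∞ M) (hy : y ∈ coordDomain e' I)
    (hy' : e'.symm (spacePart y) ∈ e.source) :
    D.residual ρ e' y = pullTensor (chartChange e' e) (D.residual ρ e) y := by
  have hJ := det_jac_chartChange_ne_zero he he' hy.2 hy'
  have hym : chartChange e' e y ∈ coordDomain e I := eventCoords_mem_coordDomain hy' hy.1
  have hg := isMetricAt_metric_comp hI hD he hym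
  have hev : D.metric.comp e' =ᶠ[𝓝 y] pullTensor (chartChange e' e) (D.metric.comp e) := by
    have hc : ContinuousAt (fun z : Fin (n + 1) → ℝ => e'.symm (spacePart z)) y :=
      (e'.continuousAt_symm hy.2).comp continuous_spacePart.continuousAt
    filter_upwards [hc (e.open_source.mem_nhds hy'), (isOpen_coordDomain e' hI).mem_nhds hy]
      with z hz hz2
    exact SpacetimeTwoTensor.comp_chartChange _ he he' hz2.2 hz
  rw [residual_eq, ricci_congr hev, hev.self_of_nhds,
    ricci_pullTensor (hg.of_le (by norm_num)) (contDiffAt_chartChange he he' hy.2 hy') hJ,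
    SpacetimeTwoTensor.comp_chartChange ρ he he' hy.2 hy']
  simp only [pullTensor]
  rw [← Matrix.sub_mul, ← Matrix.mul_sub, traceReverse_pullTensor (isUnit_iff_ne_zero.2 hJ),
    residual_eq]

/-- Coframe and inverse metric are invertible, so only the covector `Σ(·, e_0)` matters, and this
transforms simply. -/
lemma constraint_eq_zero_iff (hI : IsOpen I) (hD : D.IsRegular I)
    (he : e ∈ IsManifold.maximalAtlas (𝓡 n) ∞ M) (hy : y ∈ coordDomain e I) :
    D.constraint ρ e y = 0 ↔ D.residual ρ e y *ᵥ (D.frameCol e y *ᵥ Pi.single 0 1) = 0 := by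
  have hg := isMetricAt_metric_comp hI hD he hy
  have h : D.constraint ρ e y = (D.coframe e y * (D.metric.comp e y)⁻¹) *ᵥ
      (D.residual ρ e y *ᵥ (D.frameCol e y *ᵥ Pi.single 0 1)) := by
    rw [constraint_eq]
    simp only [Matrix.mulVec_mulVec, Matrix.mul_assoc]
  rw [h]
  have hdet : (D.coframe e y * (D.metric.comp e y)⁻¹).det ≠ 0 := by
    rw [Matrix.det_mul]
    exact mul_ne_zero (D.isUnit_det_coframe e y).ne_zero
      (Matrix.isUnit_nonsing_inv_det _ (isUnit_iff_ne_zero.2 hg.det_ne)).ne_zero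
  exact ⟨Matrix.eq_zero_of_mulVec_eq_zero hdet, fun h => by rw [h, Matrix.mulVec_zero]⟩

lemma constraint_eq_zero_of_chartChange (hI : IsOpen I) (hD : D.IsRegular I)
    (he : e ∈ IsManifold.maximalAtlas (𝓡 n) ∞ M)
    (he' : e' ∈ IsManifold.maximalAtlas (𝓡 n) ∞ M) (hy : y ∈ coordDomain e' I)
    (hy' : e'.symm (spacePart y) ∈ e.source)
    (h : D.constraint ρ e (chartChange e' e y) = 0) : D.constraint ρ e' y = 0 := by
  have hym : chartChange e' e y ∈ coordDomain e I := eventCoords_mem_coordDomain hy' hy.1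
  rw [constraint_eq_zero_iff hI hD he hym] at h
  rw [constraint_eq_zero_iff hI hD he' hy, residual_chartChange hI hD he he' hy hy', pullTensor,
    ← Matrix.mulVec_mulVec, ← Matrix.mulVec_mulVec]
  -- The vector `e_0 = ∂_t - β` does not depend on the chart, since the coordinate change leaves `t`
  -- alone and the shift transforms as a vector.
  have hf : jac (chartChange e' e) y *ᵥ (D.frameCol e' y *ᵥ Pi.single 0 1) =
      D.frameCol e (chartChange e' e y) *ᵥ Pi.single 0 1 := by
    rw [Matrix.mulVec_mulVec, jac_chartChange he he' hy.2 hy', frameCol, frameCol, bordered_mul,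
      shiftComp_chartChange he' hy.2 hy']
    ext i
    refine Fin.cases ?_ (fun i => ?_) i <;> simp [Matrix.mulVec_neg]
  rw [hf, h, Matrix.mulVec_zero]

/-- The validity of the constraints at an event can be tested in any chart. -/
theorem constraintsAt_iff (hI : IsOpen I) (hD : D.IsRegular I)
    (he : e ∈ IsManifold.maximalAtlas (𝓡 n) ∞ M) {x : M} (hx : x ∈ e.source) {t : ℝ} (ht : t ∈ I) :
    D.ConstraintsAt ρ x t ↔ D.constraint ρ e (eventCoords e x t) = 0 := by
  refine ⟨fun h => h e he hx, fun h e' he' hx' => ?_⟩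
  have hs : e'.symm (spacePart (eventCoords e' x t)) = x := by
    rw [spacePart_eventCoords, e'.left_inv hx']
  refine constraint_eq_zero_of_chartChange hI hD he he' (eventCoords_mem_coordDomain hx' ht)
    (by rwa [hs]) ?_
  have : chartChange e' e (eventCoords e' x t) = eventCoords e x t := by
    rw [chartChange, hs]
    rfl
  rwa [this]

end SplitData

end ChartChange

/-! ### The weighted energy inequality on a box. -/

section Energy

/-- Squaring the positive part makes the cone cut-off `C^1`, which the divergence theorem with
continuous divergence requires. -/
lemma hasDerivAt_sq_posPart (x : ℝ) :
    HasDerivAt (fun x : ℝ => (max x 0) ^ 2) (2 * max x 0) x := by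
  rcases lt_trichotomy x 0 with h | rfl | h
  · rw [max_eq_right h.le, mul_zero]
    refine (hasDerivAt_const x (0 : ℝ)).congr_of_eventuallyEq ?_
    filter_upwards [Iio_mem_nhds h] with z hz
    simp [max_eq_right (le_of_lt (mem_Iio.1 hz))]
  · rw [hasDerivAt_iff_tendsto_slope]
    have h : Tendsto (fun z : ℝ => max z 0) (𝓝[≠] 0) (𝓝 (2 * max 0 0)) := by
      have : Continuous fun z : ℝ => max z 0 := by fun_prop
      simpa using (this.tendsto 0).mono_left nhdsWithin_le_nhds
    refine h.congr' ?_
    filter_upwards [self_mem_nhdsWithin] with z hz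
    have hz : z ≠ 0 := hz
    rcases le_total z 0 with h | h
    · simp [slope, max_eq_right h]
    · simp [slope, max_eq_left h, pow_two, hz]
  · rw [max_eq_left h.le]
    have := hasDerivAt_pow 2 x
    refine (this.congr_deriv (by simp)).congr_of_eventuallyEq ?_
    filter_upwards [Ioi_mem_nhds h] with z hz
    simp [max_eq_left (le_of_lt (mem_Ioi.1 hz))]

lemma contDiff_sq_posPart : ContDiff ℝ 1 (fun x : ℝ => (max x 0) ^ 2) := by
  rw [contDiff_one_iff_deriv]
  refine ⟨fun x => (hasDerivAt_sq_posPart x).differentiableAt, ?_⟩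
  rw [show deriv (fun x : ℝ => (max x 0) ^ 2) = fun x => 2 * max x 0 from
    funext fun x => (hasDerivAt_sq_posPart x).deriv]
  fun_prop

/-- A weighted current vanishing on the boundary of a box, whose divergence is controlled by its
energy density, vanishes. -/
theorem mul_energy_eq_zero_of_box {m : ℕ} {a b : Fin (m + 1) → ℝ} (hab : ∀ i, a i < b i)
    {J : Fin (m + 1) → (Fin (m + 1) → ℝ) → ℝ} {Θ E : (Fin (m + 1) → ℝ) → ℝ} {σ c C : ℝ}
    (hJ : ∀ y ∈ Icc a b, ∀ μ, ContDiffAt ℝ 1 (J μ) y) (hΘ : ∀ y ∈ Icc a b, ContDiffAt ℝ 1 Θ y)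
    (hE0 : ∀ y ∈ Icc a b, 0 ≤ E y)
    (hΘ0 : ∀ y ∈ Icc a b, 0 ≤ Θ y) (hc : 0 < c)
    (hJE : ∀ y ∈ Icc a b, c * E y ≤ σ * J 0 y)
    (hdiv : ∀ y ∈ Icc a b, ∑ μ, partialDeriv μ (J μ) y ≤ C * E y)
    (hgrad : ∀ y ∈ Icc a b, ∑ μ, partialDeriv μ Θ y * J μ y ≤ 0)
    (hface : ∀ y ∈ Icc a b, ∀ i, y i = a i ∨ y i = b i → ∀ μ, Θ y * J μ y = 0) :
    ∀ y ∈ Icc a b, Θ y * E y = 0 := by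
  have hle : a ≤ b := fun i => (hab i).le
  -- This rate makes the exponential weight contribute `-(|C| + 1) Θ E`, which absorbs the
  -- divergence term and leaves `-Θ E`.
  set l : ℝ := (|C| + 1) / c with hl
  have hlc : l * c = |C| + 1 := div_mul_cancel₀ _ hc.ne'
  have hl0 : 0 ≤ l := by positivity
  set w : (Fin (m + 1) → ℝ) → ℝ := fun y => Real.exp (-(l * σ) * y 0) with hw
  have hwd : ∀ y, ContDiffAt ℝ 1 w y := fun y =>
    (contDiffAt_const.mul (ContinuousLinearMap.proj (R := ℝ)
      (φ := fun _ : Fin (m + 1) => ℝ) 0).contDiff.contDiffAt).exp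
  set f : Fin (m + 1) → (Fin (m + 1) → ℝ) → ℝ := fun μ y => (Θ y * J μ y) * w y with hf
  have hfd : ∀ y ∈ Icc a b, ∀ μ, ContDiffAt ℝ 1 (f μ) y := fun y hy μ =>
    ((hΘ y hy).mul (hJ y hy μ)).mul (hwd y)
  have hwp : ∀ μ y, partialDeriv μ w y = if μ = 0 then -(l * σ) * w y else 0 := by
    intro μ y
    have h0 : HasFDerivAt (fun y : Fin (m + 1) → ℝ => y 0)
      (ContinuousLinearMap.proj (R := ℝ) (φ := fun _ : Fin (m + 1) => ℝ) 0) y :=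
      (ContinuousLinearMap.proj (R := ℝ) (φ := fun _ : Fin (m + 1) => ℝ) 0).hasFDerivAt
    have h := (h0.const_mul (-(l * σ))).exp
    rw [partialDeriv, hw, h.fderiv]
    rcases eq_or_ne μ 0 with rfl | h
    · simp; ring
    · simp [h]
  have hfp : ∀ y ∈ Icc a b, ∑ μ, partialDeriv μ (f μ) y ≤ -(w y * (Θ y * E y)) := by
    intro y hy
    have h1 : ∀ μ, partialDeriv μ (f μ) y = w y * (partialDeriv μ Θ y * J μ y)
        + w y * Θ y * partialDeriv μ (J μ) y
        + Θ y * J μ y * (if μ = 0 then -(l * σ) * w y else 0) := by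
      intro μ
      have d1 := (hΘ y hy).differentiableAt one_ne_zero
      have d2 := (hJ y hy μ).differentiableAt one_ne_zero
      have d3 := (hwd y).differentiableAt one_ne_zero
      have e1 : partialDeriv μ (f μ) y = _ := partialDeriv_mul (d1.mul d2) d3 μ
      have e2 : partialDeriv μ (Θ * J μ) y = _ := partialDeriv_mul d1 d2 μ
      rw [e1, e2, hwp, Pi.mul_apply]
      ring
    simp only [h1, Finset.sum_add_distrib, ← Finset.mul_sum, mul_ite, mul_zero,
      Finset.sum_ite_eq', Finset.mem_univ, if_true]
    have hw0 : 0 < w y := Real.exp_pos _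
    have e1 := mul_le_mul_of_nonneg_left (hgrad y hy) hw0.le
    have e2 := mul_le_mul_of_nonneg_left (hdiv y hy) (mul_nonneg hw0.le (hΘ0 y hy))
    have e3 := mul_le_mul_of_nonneg_left (hJE y hy) (mul_nonneg (mul_nonneg hw0.le (hΘ0 y hy)) hl0)
    have e4 : w y * Θ y * (C * E y) ≤ w y * Θ y * (|C| * E y) :=
      mul_le_mul_of_nonneg_left (mul_le_mul_of_nonneg_right (le_abs_self C) (hE0 y hy))
        (mul_nonneg hw0.le (hΘ0 y hy))
    have e5 : w y * Θ y * l * (c * E y) = w y * Θ y * E y * (|C| + 1) := by rw [← hlc]; ring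
    rw [e5] at e3
    linarith
  have hcont : ∀ {F : (Fin (m + 1) → ℝ) → ℝ}, (∀ y ∈ Icc a b, ContinuousAt F y) →
      ContinuousOn F (Icc a b) := fun h y hy => (h y hy).continuousWithinAt
  have hdc : ContinuousOn (fun y => ∑ μ, partialDeriv μ (f μ) y) (Icc a b) :=
    hcont fun y hy => tendsto_finsetSum _ fun μ _ =>
      ((hfd y hy μ).partialDeriv (k := 0) (by norm_num) μ).continuousAt
  have hint := integral_divergence_of_hasFDerivAt_off_countable' a b hle f
    (fun μ y => fderiv ℝ (f μ) y) ∅ countable_empty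
    (fun μ => hcont fun y hy => (hfd y hy μ).continuousAt)
    (fun y hy μ => ((hfd y ⟨fun i => (hy.1 i trivial).1.le, fun i => (hy.1 i trivial).2.le⟩
      μ).differentiableAt one_ne_zero).hasFDerivAt) hdc.integrableOn_Icc
  -- All boundary integrals vanish, so the integral of a divergence that is at most `-w Θ E ≤ 0` is
  -- zero.
  have hz : ∀ i : Fin (m + 1), ∀ v : ℝ, v = a i ∨ v = b i →
      ∫ x in Icc (a ∘ i.succAbove) (b ∘ i.succAbove), f i (i.insertNth v x) = 0 := by
    intro i v hv
    have h0 : ∀ x ∈ Icc (a ∘ i.succAbove) (b ∘ i.succAbove), f i (i.insertNth v x) = 0 := by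
      intro x hx
      have hvi : v ∈ Icc (a i) (b i) := by
        rcases hv with rfl | rfl
        exacts [left_mem_Icc.2 (hle i), right_mem_Icc.2 (hle i)]
      have hmem : (i.insertNth v x : Fin (m + 1) → ℝ) ∈ Icc a b :=
        Fin.insertNth_mem_Icc.2 ⟨hvi, hx⟩
      simp only [hf, hface _ hmem i (by simpa using hv), zero_mul]
    rw [setIntegral_congr_fun measurableSet_Icc h0]
    exact integral_zero _ _
  rw [Finset.sum_eq_zero fun i _ => by rw [hz i _ (Or.inr rfl), hz i _ (Or.inl rfl), sub_zero]]
    at hint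
  have hint' : ∫ y in Icc a b, -∑ μ, partialDeriv μ (f μ) y = 0 := by
    rw [integral_neg]
    exact neg_eq_zero.2 hint
  have hn : ∀ y ∈ Icc a b, 0 ≤ w y * (Θ y * E y) := fun y hy =>
    mul_nonneg (Real.exp_pos _).le (mul_nonneg (hΘ0 y hy) (hE0 y hy))
  have hae := (setIntegral_eq_zero_iff_of_nonneg_ae
    ((ae_restrict_iff' measurableSet_Icc).2 (ae_of_all _ fun y hy => by
      have := hfp y hy; have := hn y hy; simp only [Pi.zero_apply, Pi.neg_apply]; linarith))
    hdc.neg.integrableOn_Icc).1 hint'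
  -- The box is the closure of its interior, so a continuous function vanishing almost everywhere on
  -- it vanishes at all its points, including the boundary.
  have hcl : Icc a b ⊆ closure (interior (Icc a b)) := by
    have h1 : interior (Icc a b) = pi univ fun i => Ioo (a i) (b i) := by
      rw [← pi_univ_Icc, interior_pi_set finite_univ]
      simp only [interior_Icc]
    rw [h1, closure_pi_set, ← pi_univ_Icc]
    simp only [fun i => closure_Ioo (hab i).ne, le_refl]
  intro y hy
  have h1 : -∑ μ, partialDeriv μ (f μ) y = 0 :=
    Measure.eqOn_of_ae_eq hae hdc.neg continuousOn_const hcl hy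
  have h2 := hfp y hy
  have h3 : w y * (Θ y * E y) = 0 := le_antisymm (by linarith) (hn y hy)
  exact (mul_eq_zero.1 h3).resolve_left (Real.exp_pos _).ne'

lemma dotProduct_smul_mulVec_smul {k : ℕ} (A : Matrix (Fin k) (Fin k) ℝ) (t : ℝ) (v : Fin k → ℝ) :
    (t • v) ⬝ᵥ A *ᵥ (t • v) = t ^ 2 * (v ⬝ᵥ A *ᵥ v) := by
  rw [Matrix.mulVec_smul, smul_dotProduct, dotProduct_smul, smul_eq_mul, smul_eq_mul]
  ring

lemma exists_smul_sphere {k : ℕ} (v : Fin k → ℝ) (hv : v ≠ 0) :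
    ∃ w ∈ Metric.sphere (0 : Fin k → ℝ) 1, v = ‖v‖ • w := by
  refine ⟨‖v‖⁻¹ • v, ?_, ?_⟩
  · simp [norm_smul, hv]
  · rw [smul_smul, mul_inv_cancel₀ (norm_ne_zero_iff.2 hv), one_smul]

lemma le_dotProduct_mulVec_of_sphere {k : ℕ} {A : Matrix (Fin k) (Fin k) ℝ} {c : ℝ}
    (h : ∀ w ∈ Metric.sphere (0 : Fin k → ℝ) 1, c ≤ w ⬝ᵥ A *ᵥ w) (v : Fin k → ℝ) :
    c * ‖v‖ ^ 2 ≤ v ⬝ᵥ A *ᵥ v := by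
  rcases eq_or_ne v 0 with rfl | hv
  · simp
  obtain ⟨w, hw, hvw⟩ := exists_smul_sphere v hv
  have := mul_le_mul_of_nonneg_left (h w hw) (sq_nonneg ‖v‖)
  calc c * ‖v‖ ^ 2 ≤ ‖v‖ ^ 2 * (w ⬝ᵥ A *ᵥ w) := by linarith
    _ = (‖v‖ • w) ⬝ᵥ A *ᵥ (‖v‖ • w) := (dotProduct_smul_mulVec_smul _ _ _).symm
    _ = v ⬝ᵥ A *ᵥ v := by rw [← hvw]

lemma continuousOn_dotProduct_mulVec {X : Type*} [TopologicalSpace X] {k : ℕ} {K : Set X}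
    {F : X → Matrix (Fin k) (Fin k) ℝ} (hF : ContinuousOn F K) (T : Set (Fin k → ℝ)) :
    ContinuousOn (fun p : X × (Fin k → ℝ) => p.2 ⬝ᵥ F p.1 *ᵥ p.2) (K ×ˢ T) := by
  have h : ∀ i j, ContinuousOn (fun p : X × (Fin k → ℝ) => F p.1 i j) (K ×ˢ T) := fun i j =>
    (continuous_apply_apply i j).comp_continuousOn
      (hF.comp continuousOn_fst fun p hp => hp.1)
  have hc : ∀ i, ContinuousOn (fun p : X × (Fin k → ℝ) => p.2 i) (K ×ˢ T) := fun i =>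
    ((continuous_apply i).comp continuous_snd).continuousOn
  simp only [dotProduct, Matrix.mulVec]
  refine continuousOn_finsetSum _ fun i _ => ContinuousOn.mul (hc i) ?_
  exact continuousOn_finsetSum _ fun j _ => ContinuousOn.mul (h i j) (hc j)

/-- Compactness of `K` times the unit sphere gives a positive bound for unit vectors; homogeneity of
degree two extends it to all vectors. -/
lemma exists_lower_quadratic_bound {X : Type*} [TopologicalSpace X] {k : ℕ} {K : Set X}
    (hK : IsCompact K) {F : X → Matrix (Fin k) (Fin k) ℝ} (hF : ContinuousOn F K)
    (hpos : ∀ y ∈ K, (F y).PosDef) : ∃ c, 0 < c ∧ ∀ y ∈ K, ∀ v, c * ‖v‖ ^ 2 ≤ v ⬝ᵥ F y *ᵥ v := by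
  obtain ⟨c, hc, h⟩ := (hK.prod (isCompact_sphere (0 : Fin k → ℝ) 1)).exists_forall_le'
    (continuousOn_dotProduct_mulVec hF _) (a := 0) (by
      rintro ⟨y, w⟩ ⟨hy, hw⟩
      have hw0 : w ≠ 0 := fun h => by simp [h] at hw
      simpa using (hpos y hy).dotProduct_mulVec_pos hw0)
  exact ⟨c, hc, fun y hy => le_dotProduct_mulVec_of_sphere fun w hw => h (y, w) ⟨hy, hw⟩⟩

lemma exists_upper_quadratic_bound {X : Type*} [TopologicalSpace X] {k : ℕ} {K : Set X}
    (hK : IsCompact K) {F : X → Matrix (Fin k) (Fin k) ℝ} (hF : ContinuousOn F K) :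
    ∃ C, ∀ y ∈ K, ∀ v, |v ⬝ᵥ F y *ᵥ v| ≤ C * ‖v‖ ^ 2 := by
  obtain ⟨C, h⟩ := (hK.prod (isCompact_sphere (0 : Fin k → ℝ) 1)).exists_bound_of_continuousOn
    (continuousOn_dotProduct_mulVec hF _)
  refine ⟨C, fun y hy v => ?_⟩
  rcases eq_or_ne v 0 with rfl | hv
  · simp
  obtain ⟨w, hw, hvw⟩ := exists_smul_sphere v hv
  have h1 : |w ⬝ᵥ F y *ᵥ w| ≤ C := h (y, w) ⟨hy, hw⟩
  have h2 : v ⬝ᵥ F y *ᵥ v = ‖v‖ ^ 2 * (w ⬝ᵥ F y *ᵥ w) := by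
    rw [← dotProduct_smul_mulVec_smul, ← hvw]
  rw [h2, abs_mul, abs_of_nonneg (sq_nonneg _), mul_comm]
  exact mul_le_mul_of_nonneg_right h1 (sq_nonneg _)

variable {m k : ℕ} {S : Fin (m + 1) → (Fin (m + 1) → ℝ) → Matrix (Fin k) (Fin k) ℝ}
  {u : (Fin (m + 1) → ℝ) → Fin k → ℝ} {y : Fin (m + 1) → ℝ}

lemma contDiffAt_current (hS : ∀ μ, MatContDiffAt 1 (S μ) y)
    (hu : ∀ i, ContDiffAt ℝ 1 (fun z => u z i) y) (μ : Fin (m + 1)) :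
    ContDiffAt ℝ 1 (fun z => u z ⬝ᵥ S μ z *ᵥ u z) y := by
  simp only [dotProduct, Matrix.mulVec]
  exact ContDiffAt.sum fun i _ => (hu i).mul (ContDiffAt.sum fun j _ => (hS μ i j).mul (hu j))

/-- The divergence of the energy current of a solution of a symmetric system. -/
lemma sum_partialDeriv_current {K : Matrix (Fin k) (Fin k) ℝ} (hS : ∀ μ, MatContDiffAt 1 (S μ) y)
    (hsymm : ∀ μ, (S μ y).IsSymm) (hu : ∀ i, ContDiffAt ℝ 1 (fun z => u z i) y)
    (heq : (∑ μ, S μ y *ᵥ fun i => partialDeriv μ (fun z => u z i) y) + K *ᵥ u y = 0) :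
    ∑ μ, partialDeriv μ (fun z => u z ⬝ᵥ S μ z *ᵥ u z) y =
      u y ⬝ᵥ ((∑ μ, matDeriv μ (S μ) y) - (2 : ℝ) • K) *ᵥ u y := by
  have h1 : ∀ μ, partialDeriv μ (fun z => u z ⬝ᵥ S μ z *ᵥ u z) y =
      u y ⬝ᵥ matDeriv μ (S μ) y *ᵥ u y
        + 2 * (u y ⬝ᵥ S μ y *ᵥ fun i => partialDeriv μ (fun z => u z i) y) := by
    intro μ
    have hud := fun i => (hu i).differentiableAt one_ne_zero
    have e1 : partialDeriv μ (fun z => u z ⬝ᵥ S μ z *ᵥ u z) y = ∑ i, ∑ j,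
        (partialDeriv μ (fun z => u z i) y * (S μ y i j * u y j)
          + u y i * (matDeriv μ (S μ) y i j * u y j
            + S μ y i j * partialDeriv μ (fun z => u z j) y)) := by
      have e2 : (fun z => u z ⬝ᵥ S μ z *ᵥ u z) =
          fun z => ∑ i, ∑ j, u z i * (S μ z i j * u z j) := by
        funext z
        simp only [dotProduct, Matrix.mulVec, Finset.mul_sum]
      have hdd : ∀ i j, DifferentiableAt ℝ (fun z => S μ z i j * u z j) y :=
        fun i j => ((hS μ).diff i j).mul (hud j)
      have hm : ∀ i j, DifferentiableAt ℝ (fun z => u z i * (S μ z i j * u z j)) y :=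
        fun i j => (hud i).mul (hdd i j)
      rw [e2, partialDeriv_sum (F := fun i z => ∑ j, u z i * (S μ z i j * u z j))
        fun i _ => DifferentiableAt.fun_sum fun j _ => hm i j]
      refine Finset.sum_congr rfl fun i _ => ?_
      rw [partialDeriv_sum (F := fun j z => u z i * (S μ z i j * u z j)) fun j _ => hm i j]
      refine Finset.sum_congr rfl fun j _ => ?_
      rw [partialDeriv_mul (hud i) (hdd i j), partialDeriv_mul ((hS μ).diff i j) (hud j),
        matDeriv_apply]
    have e3 : (fun i => partialDeriv μ (fun z => u z i) y) ⬝ᵥ S μ y *ᵥ u y =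
        u y ⬝ᵥ S μ y *ᵥ fun i => partialDeriv μ (fun z => u z i) y := by
      rw [Matrix.dotProduct_mulVec, ← Matrix.mulVec_transpose, (hsymm μ).eq, dotProduct_comm]
    rw [e1, two_mul]
    nth_rewrite 1 [← e3]
    simp only [dotProduct, Matrix.mulVec, Finset.mul_sum, mul_add, Finset.sum_add_distrib]
    ring
  simp only [h1, Finset.sum_add_distrib, ← Finset.mul_sum, ← dotProduct_sum]
  rw [eq_neg_of_add_eq_zero_left heq, Matrix.sub_mulVec, dotProduct_sub, Matrix.smul_mulVec,
    dotProduct_neg, dotProduct_smul, Matrix.sum_mulVec, dotProduct_sum, smul_eq_mul]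
  ring

end Energy

/-! ### Uniqueness for symmetric hyperbolic systems in small cones. -/

section ConePropagation

variable {m k : ℕ}

lemma hasFDerivAt_coord_sub (z y : Fin (m + 1) → ℝ) (i : Fin (m + 1)) :
    HasFDerivAt (fun y : Fin (m + 1) → ℝ => y i - z i)
      (ContinuousLinearMap.proj (R := ℝ) (φ := fun _ : Fin (m + 1) => ℝ) i) y :=
  (ContinuousLinearMap.proj (R := ℝ) (φ := fun _ : Fin (m + 1) => ℝ) i).hasFDerivAt.sub_const _

lemma partialDeriv_coord_sub (z y : Fin (m + 1) → ℝ) (i μ : Fin (m + 1)) :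
    partialDeriv μ (fun y : Fin (m + 1) → ℝ => y i - z i) y = if i = μ then 1 else 0 := by
  rw [partialDeriv, (hasFDerivAt_coord_sub z y i).fderiv]
  simp [Pi.single_apply]

/-- The cut-off function of a solid cone with vertex `z`, in the time direction `-σ`. -/
noncomputable def coneCutoff (Q : Matrix (Fin (m + 1)) (Fin (m + 1)) ℝ) (κ σ : ℝ)
    (z y : Fin (m + 1) → ℝ) : ℝ :=
  (max (-(σ * (y 0 - z 0))) 0) ^ 2 *
    (max (κ * (y 0 - z 0) ^ 2 - (y - z) ⬝ᵥ Q *ᵥ (y - z)) 0) ^ 2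

variable {Q : Matrix (Fin (m + 1)) (Fin (m + 1)) ℝ} {κ σ : ℝ} {z : Fin (m + 1) → ℝ}

lemma contDiff_coneQuadratic :
    ContDiff ℝ 1 (fun y => κ * (y 0 - z 0) ^ 2 - (y - z) ⬝ᵥ Q *ᵥ (y - z)) := by
  have h : ∀ i, ContDiff ℝ 1 (fun y : Fin (m + 1) → ℝ => y i - z i) := fun i =>
    (contDiff_apply ℝ ℝ i).sub contDiff_const
  refine (contDiff_const.mul ((h 0).pow 2)).sub ?_
  simp only [dotProduct, Matrix.mulVec, Pi.sub_apply]
  exact ContDiff.sum fun i _ => (h i).mul (ContDiff.sum fun j _ => contDiff_const.mul (h j))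

lemma contDiff_coneCutoff : ContDiff ℝ 1 (coneCutoff Q κ σ z) := by
  have h : ContDiff ℝ 1 (fun y : Fin (m + 1) → ℝ => -(σ * (y 0 - z 0))) :=
    (contDiff_const.mul ((contDiff_apply ℝ ℝ 0).sub contDiff_const)).neg
  exact (contDiff_sq_posPart.comp h).mul (contDiff_sq_posPart.comp contDiff_coneQuadratic)

lemma partialDeriv_coneQuadratic (hQ : Q.IsSymm) (y : Fin (m + 1) → ℝ) (μ : Fin (m + 1)) :
    partialDeriv μ (fun y => κ * (y 0 - z 0) ^ 2 - (y - z) ⬝ᵥ Q *ᵥ (y - z)) y =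
      2 * κ * (y 0 - z 0) * (if 0 = μ then 1 else 0) - 2 * (Q *ᵥ (y - z)) μ := by
  have hd : ∀ i, DifferentiableAt ℝ (fun y : Fin (m + 1) → ℝ => y i - z i) y := fun i =>
    (hasFDerivAt_coord_sub z y i).differentiableAt
  have e2 : (fun y => (y - z) ⬝ᵥ Q *ᵥ (y - z)) =
      fun y => ∑ i, ∑ j, (y i - z i) * (Q i j * (y j - z j)) := by
    funext y
    simp only [dotProduct, Matrix.mulVec, Finset.mul_sum, Pi.sub_apply]
  have hQd : ∀ i j, DifferentiableAt ℝ (fun y : Fin (m + 1) → ℝ => Q i j * (y j - z j)) y :=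
    fun i j => (hd j).const_mul _
  have hm : ∀ i j, DifferentiableAt ℝ
      (fun y : Fin (m + 1) → ℝ => (y i - z i) * (Q i j * (y j - z j))) y :=
    fun i j => (hd i).mul (hQd i j)
  have e3 : partialDeriv μ (fun y => (y - z) ⬝ᵥ Q *ᵥ (y - z)) y = 2 * (Q *ᵥ (y - z)) μ := by
    rw [e2, partialDeriv_sum (F := fun i y => ∑ j, (y i - z i) * (Q i j * (y j - z j)))
      fun i _ => DifferentiableAt.fun_sum fun j _ => hm i j]
    have e4 : ∀ i, partialDeriv μ (fun y => ∑ j, (y i - z i) * (Q i j * (y j - z j))) y =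
        ∑ j, ((if i = μ then 1 else 0) * (Q i j * (y j - z j))
          + (y i - z i) * (Q i j * if j = μ then 1 else 0)) := by
      intro i
      rw [partialDeriv_sum (F := fun j y => (y i - z i) * (Q i j * (y j - z j))) fun j _ => hm i j]
      refine Finset.sum_congr rfl fun j _ => ?_
      rw [partialDeriv_mul (hd i) (hQd i j), partialDeriv_const_mul (hd j), partialDeriv_coord_sub,
        partialDeriv_coord_sub]
    simp only [e4, Finset.sum_add_distrib]
    have e5 : ∑ i, ∑ j, (y i - z i) * (Q i j * if j = μ then 1 else 0) = (Q *ᵥ (y - z)) μ := by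
      simp only [mul_ite, mul_one, mul_zero, Finset.sum_ite_eq', Finset.mem_univ, if_true,
        Matrix.mulVec, dotProduct, Pi.sub_apply]
      exact Finset.sum_congr rfl fun i _ => by rw [hQ.apply μ i, mul_comm]
    have e6 : ∑ i, ∑ j, (if i = μ then (1 : ℝ) else 0) * (Q i j * (y j - z j)) =
        (Q *ᵥ (y - z)) μ := by
      simp [Matrix.mulVec, dotProduct]
    rw [e5, e6, two_mul]
  have hd2 : DifferentiableAt ℝ (fun y => (y - z) ⬝ᵥ Q *ᵥ (y - z)) y := by
    rw [e2]
    exact DifferentiableAt.fun_sum fun i _ => DifferentiableAt.fun_sum fun j _ => hm i j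
  have e7 : (fun y : Fin (m + 1) → ℝ => κ * (y 0 - z 0) ^ 2) =
      fun y => κ * ((y 0 - z 0) * (y 0 - z 0)) := by
    funext y; ring
  have hd3 : DifferentiableAt ℝ (fun y : Fin (m + 1) → ℝ => κ * (y 0 - z 0) ^ 2) y :=
    ((hd 0).pow 2).const_mul _
  have e8 : partialDeriv μ (fun y : Fin (m + 1) → ℝ => κ * ((y 0 - z 0) * (y 0 - z 0))) y = _ :=
    partialDeriv_const_mul ((hd 0).mul (hd 0)) κ μ
  have e9 : partialDeriv μ ((fun y : Fin (m + 1) → ℝ => y 0 - z 0) * fun y => y 0 - z 0) y = _ :=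
    partialDeriv_mul (hd 0) (hd 0) μ
  rw [partialDeriv_sub hd3 hd2, e3, e7, e8, e9, partialDeriv_coord_sub]
  ring

lemma partialDeriv_coneCutoff (hQ : Q.IsSymm) (y : Fin (m + 1) → ℝ) (μ : Fin (m + 1)) :
    partialDeriv μ (coneCutoff Q κ σ z) y =
      (2 * max (-(σ * (y 0 - z 0))) 0 * (-σ * if 0 = μ then 1 else 0)) *
        (max (κ * (y 0 - z 0) ^ 2 - (y - z) ⬝ᵥ Q *ᵥ (y - z)) 0) ^ 2
      + (max (-(σ * (y 0 - z 0))) 0) ^ 2 *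
        (2 * max (κ * (y 0 - z 0) ^ 2 - (y - z) ⬝ᵥ Q *ᵥ (y - z)) 0 *
          (2 * κ * (y 0 - z 0) * (if 0 = μ then 1 else 0) - 2 * (Q *ᵥ (y - z)) μ)) := by
  have h1 := ((hasDerivAt_sq_posPart (-(σ * (y 0 - z 0)))).comp_hasFDerivAt y
    ((hasFDerivAt_coord_sub z y 0).const_mul σ).neg)
  have hq : HasFDerivAt (fun y => κ * (y 0 - z 0) ^ 2 - (y - z) ⬝ᵥ Q *ᵥ (y - z)) _ y :=
    ((contDiff_coneQuadratic (Q := Q) (κ := κ) (z := z)).contDiffAt.differentiableAt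
      one_ne_zero).hasFDerivAt
  have h2 := HasDerivAt.comp_hasFDerivAt y (hasDerivAt_sq_posPart _) hq
  have h3 := partialDeriv_mul h1.differentiableAt h2.differentiableAt μ
  refine (show partialDeriv μ (coneCutoff Q κ σ z) y = _ from h3).trans ?_
  have e1 := congrArg (fun L => L (Pi.single μ 1)) h1.fderiv
  have e2 := congrArg (fun L => L (Pi.single μ 1)) h2.fderiv
  have e3 := partialDeriv_coneQuadratic (κ := κ) (z := z) hQ y μ
  rw [partialDeriv] at e3
  simp only [partialDeriv]
  rw [e1, e2]
  simp only [_root_.smul_apply, _root_.neg_apply, Pi.neg_apply, e3,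
    ContinuousLinearMap.proj_apply, smul_eq_mul, Pi.single_apply, Function.comp]
  ring

/-- Where the cut-off is positive, `y` is reached from the vertex in elapsed time `s = -σ (y⁰ - z⁰)`
along a direction strictly inside the cone. Dividing the displacement by `-σ s` normalizes that
direction. -/
lemma exists_cone_direction {y : Fin (m + 1) → ℝ} (hσ : σ ^ 2 = 1) (hs : 0 < -(σ * (y 0 - z 0)))
    (hq : 0 < κ * (y 0 - z 0) ^ 2 - (y - z) ⬝ᵥ Q *ᵥ (y - z)) :
    ∃ V : Fin (m + 1) → ℝ, V 0 = 1 ∧ V ⬝ᵥ Q *ᵥ V < κ ∧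
      y - z = (-(σ * -(σ * (y 0 - z 0)))) • V := by
  set s := -(σ * (y 0 - z 0)) with hs'
  set V : Fin (m + 1) → ℝ := (-(σ / s)) • (y - z) with hV
  have hX : y - z = (-(σ * s)) • V := by
    rw [hV, smul_smul, show -(σ * s) * -(σ / s) = 1 by field_simp; exact hσ, one_smul]
  have hV0 : V 0 = 1 := by
    simp only [hV, Pi.smul_apply, Pi.sub_apply, smul_eq_mul]
    rw [show -(σ / s) * (y 0 - z 0) = s / s by rw [hs']; ring, div_self hs.ne']
  have hX0 : y 0 - z 0 = -(σ * s) := by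
    have := congrFun hX 0
    simpa [hV0] using this
  refine ⟨V, hV0, ?_, hX⟩
  have e1 : κ * (y 0 - z 0) ^ 2 - (y - z) ⬝ᵥ Q *ᵥ (y - z) = s ^ 2 * (κ - V ⬝ᵥ Q *ᵥ V) := by
    rw [hX, dotProduct_smul_mulVec_smul, hX0]
    linear_combination (κ - V ⬝ᵥ Q *ᵥ V) * s ^ 2 * hσ
  rw [e1] at hq
  have := (mul_pos_iff_of_pos_left (pow_pos hs 2)).1 hq
  linarith

/-- The gradient of the cut-off function of a cone pairs to a nonpositive number with every current
that crosses the cone outwards. -/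
lemma sum_partialDeriv_coneCutoff_mul_nonpos (hQ : Q.IsSymm) (hσ : σ ^ 2 = 1)
    {J : Fin (m + 1) → ℝ} (hJ0 : 0 ≤ J 0)
    (hJ : ∀ V : Fin (m + 1) → ℝ, V 0 = 1 → V ⬝ᵥ Q *ᵥ V ≤ κ → 0 ≤ κ * J 0 - (Q *ᵥ V) ⬝ᵥ J)
    (y : Fin (m + 1) → ℝ) :
    ∑ μ, partialDeriv μ (coneCutoff Q κ σ z) y * (σ * J μ) ≤ 0 := by
  set s := -(σ * (y 0 - z 0)) with hs
  set q := κ * (y 0 - z 0) ^ 2 - (y - z) ⬝ᵥ Q *ᵥ (y - z) with hq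
  -- The first term comes from the time factor and is nonpositive because `J 0 ≥ 0`. The second
  -- comes from the quadratic factor and, in the direction `V` from the vertex, is a nonpositive
  -- multiple of the quantity in `hJ`.
  have h1 : ∑ μ, partialDeriv μ (coneCutoff Q κ σ z) y * (σ * J μ) =
      -(2 * max s 0 * (max q 0) ^ 2 * J 0)
      + 4 * (max s 0) ^ 2 * max q 0 * (σ * (κ * (y 0 - z 0) * J 0 - (Q *ᵥ (y - z)) ⬝ᵥ J)) := by
    have : ∀ μ, partialDeriv μ (coneCutoff Q κ σ z) y * (σ * J μ) =
        (if 0 = μ then -(2 * max s 0 * (max q 0) ^ 2 * J μ) +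
          4 * (max s 0) ^ 2 * max q 0 * σ * κ * (y 0 - z 0) * J μ else 0)
        - 4 * (max s 0) ^ 2 * max q 0 * σ * ((Q *ᵥ (y - z)) μ * J μ) := by
      intro μ
      rw [partialDeriv_coneCutoff hQ, ← hs, ← hq]
      split_ifs
      · linear_combination (-(2 * max s 0 * (max q 0) ^ 2 * J μ)) * hσ
      · ring
    simp only [this, Finset.sum_sub_distrib, Finset.sum_ite_eq, Finset.mem_univ, if_true,
      ← Finset.mul_sum]
    rw [dotProduct]
    ring
  have h2 : 0 ≤ 2 * max s 0 * (max q 0) ^ 2 * J 0 := by positivity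
  rw [h1]
  rcases le_or_gt s 0 with hs0 | hs0
  · rw [max_eq_right hs0]; simp
  rcases le_or_gt q 0 with hq0 | hq0
  · rw [max_eq_right hq0]; simp
  obtain ⟨V, hV0, hVQ, hX⟩ := exists_cone_direction hσ hs0 hq0
  rw [← hs] at hX
  have hX0 : y 0 - z 0 = -(σ * s) := by
    have := congrFun hX 0
    simpa [hV0] using this
  have h3 := hJ V hV0 hVQ.le
  have h4 : σ * (κ * (y 0 - z 0) * J 0 - (Q *ᵥ (y - z)) ⬝ᵥ J) =
      -(s * (κ * J 0 - (Q *ᵥ V) ⬝ᵥ J)) := by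
    rw [hX0, hX, Matrix.mulVec_smul, smul_dotProduct, smul_eq_mul]
    linear_combination (-(s * (κ * J 0 - (Q *ᵥ V) ⬝ᵥ J))) * hσ
  rw [h4]
  have h5 : 0 ≤ 4 * (max s 0) ^ 2 * max q 0 * (s * (κ * J 0 - (Q *ᵥ V) ⬝ᵥ J)) := by positivity
  linarith

lemma isCompact_coneSlice {R : ℝ}
    (hR : ∀ V : Fin (m + 1) → ℝ, V 0 = 1 → V ⬝ᵥ Q *ᵥ V ≤ κ → ∀ i, |V i| ≤ R) :
    IsCompact {V : Fin (m + 1) → ℝ | V 0 = 1 ∧ V ⬝ᵥ Q *ᵥ V ≤ κ} := by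
  refine Metric.isCompact_of_isClosed_isBounded ?_ ?_
  · have h : IsClosed {V : Fin (m + 1) → ℝ | V ⬝ᵥ Q *ᵥ V ≤ κ} :=
      isClosed_le (continuous_id.dotProduct (continuous_const.matrix_mulVec continuous_id))
        continuous_const
    exact (isClosed_eq (continuous_apply 0) continuous_const).inter h
  · refine (Metric.isBounded_closedBall (x := (0 : Fin (m + 1) → ℝ)) (r := |R|)).subset ?_
    rintro V ⟨h0, hV⟩
    rw [mem_closedBall_zero_iff, pi_norm_le_iff_of_nonneg (abs_nonneg _)]
    exact fun i => (hR V h0 hV i).trans (le_abs_self R)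

variable {S : Fin (m + 1) → (Fin (m + 1) → ℝ) → Matrix (Fin k) (Fin k) ℝ}

/-- A strict inequality on a compact set of pairs (direction in the cone, unit vector) persists for
nearby coefficients. This lets the cone be frozen at `y₀` while the coefficients vary. -/
lemma eventually_cone_pos {y₀ : Fin (m + 1) → ℝ} (hS : ∀ μ i j, ContinuousAt (fun y => S μ y i j) y₀)
    {R : ℝ} (hR : ∀ V : Fin (m + 1) → ℝ, V 0 = 1 → V ⬝ᵥ Q *ᵥ V ≤ κ → ∀ i, |V i| ≤ R)
    (hcone : ∀ V : Fin (m + 1) → ℝ, V 0 = 1 → V ⬝ᵥ Q *ᵥ V ≤ κ → ∀ v : Fin k → ℝ, v ≠ 0 →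
      0 < κ * (v ⬝ᵥ S 0 y₀ *ᵥ v) - (Q *ᵥ V) ⬝ᵥ fun μ => v ⬝ᵥ S μ y₀ *ᵥ v) :
    ∀ᶠ y in 𝓝 y₀, ∀ V : Fin (m + 1) → ℝ, V 0 = 1 → V ⬝ᵥ Q *ᵥ V ≤ κ → ∀ v : Fin k → ℝ,
      0 ≤ κ * (v ⬝ᵥ S 0 y *ᵥ v) - (Q *ᵥ V) ⬝ᵥ fun μ => v ⬝ᵥ S μ y *ᵥ v := by
  have h := ((isCompact_coneSlice hR).prod
    (isCompact_sphere (0 : Fin k → ℝ) 1)).eventually_forall_of_forall_eventually (x₀ := y₀)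
    (P := fun y p => 0 < κ * (p.2 ⬝ᵥ S 0 y *ᵥ p.2) - (Q *ᵥ p.1) ⬝ᵥ fun μ => p.2 ⬝ᵥ S μ y *ᵥ p.2) (by
      rintro ⟨V, v⟩ ⟨⟨hV0, hV⟩, hv⟩
      have hv0 : v ≠ 0 := fun h => by simp [h] at hv
      have hc : ∀ μ, ContinuousAt (fun p : (Fin (m + 1) → ℝ) × ((Fin (m + 1) → ℝ) × (Fin k → ℝ)) =>
          p.2.2 ⬝ᵥ S μ p.1 *ᵥ p.2.2) (y₀, (V, v)) := by
        intro μ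
        have hs : ∀ i j, ContinuousAt
            (fun p : (Fin (m + 1) → ℝ) × ((Fin (m + 1) → ℝ) × (Fin k → ℝ)) => S μ p.1 i j)
            (y₀, (V, v)) := fun i j =>
          ContinuousAt.comp (f := Prod.fst) (g := fun y => S μ y i j) (hS μ i j) continuousAt_fst
        have hc : ∀ i, ContinuousAt
            (fun p : (Fin (m + 1) → ℝ) × ((Fin (m + 1) → ℝ) × (Fin k → ℝ)) => p.2.2 i)
            (y₀, (V, v)) := fun i =>
          ((continuous_apply i).comp (continuous_snd.comp continuous_snd)).continuousAt
        simp only [dotProduct, Matrix.mulVec]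
        refine tendsto_finsetSum _ fun i _ => Tendsto.mul (hc i) ?_
        exact tendsto_finsetSum _ fun j _ => Tendsto.mul (hs i j) (hc j)
      have hq : ∀ μ, ContinuousAt
          (fun p : (Fin (m + 1) → ℝ) × ((Fin (m + 1) → ℝ) × (Fin k → ℝ)) => (Q *ᵥ p.2.1) μ)
          (y₀, (V, v)) := fun μ => ((continuous_apply μ).comp
        (continuous_const.matrix_mulVec (continuous_fst.comp continuous_snd))).continuousAt
      have hct : ContinuousAt (fun p : (Fin (m + 1) → ℝ) × ((Fin (m + 1) → ℝ) × (Fin k → ℝ)) =>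
          κ * (p.2.2 ⬝ᵥ S 0 p.1 *ᵥ p.2.2) - (Q *ᵥ p.2.1) ⬝ᵥ fun μ => p.2.2 ⬝ᵥ S μ p.1 *ᵥ p.2.2)
          (y₀, (V, v)) :=
        Tendsto.sub (Tendsto.mul tendsto_const_nhds (hc 0))
          (tendsto_finsetSum _ fun μ _ => Tendsto.mul (hq μ) (hc μ))
      exact hct.tendsto.eventually (lt_mem_nhds (hcone V hV0 hV v hv0)))
  filter_upwards [h] with y hy V hV0 hV v
  rcases eq_or_ne v 0 with rfl | hv
  · simp [dotProduct]
  obtain ⟨w, hw, hvw⟩ := exists_smul_sphere v hv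
  have h1 := hy (V, w) ⟨⟨hV0, hV⟩, hw⟩
  have h2 : ∀ μ, v ⬝ᵥ S μ y *ᵥ v = ‖v‖ ^ 2 * (w ⬝ᵥ S μ y *ᵥ w) := fun μ => by
    rw [← dotProduct_smul_mulVec_smul, ← hvw]
  have h3 : (fun μ => v ⬝ᵥ S μ y *ᵥ v) = ‖v‖ ^ 2 • fun μ => w ⬝ᵥ S μ y *ᵥ w := funext h2
  rw [h2, h3, dotProduct_smul, smul_eq_mul]
  have := mul_nonneg (sq_nonneg ‖v‖) h1.le
  simp only at this
  linarith

/-- A solution of a symmetric hyperbolic system that vanishes on the base of a small cone vanishes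
at its vertex. -/
theorem eq_zero_of_eq_zero_on_cone_base {Ω : Set (Fin (m + 1) → ℝ)} (hΩ : IsOpen Ω)
    {K : (Fin (m + 1) → ℝ) → Matrix (Fin k) (Fin k) ℝ} {u : (Fin (m + 1) → ℝ) → Fin k → ℝ}
    (hS : ∀ y ∈ Ω, ∀ μ, MatContDiffAt 1 (S μ) y) (hsymm : ∀ y ∈ Ω, ∀ μ, (S μ y).IsSymm)
    (hpos : ∀ y ∈ Ω, (S 0 y).PosDef) (hK : ContinuousOn K Ω)
    (hu : ∀ y ∈ Ω, ∀ i, ContDiffAt ℝ 1 (fun z => u z i) y)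
    (heq : ∀ y ∈ Ω, (∑ μ, S μ y *ᵥ fun i => partialDeriv μ (fun z => u z i) y) + K y *ᵥ u y = 0)
    {y₀ : Fin (m + 1) → ℝ} (hy₀ : y₀ ∈ Ω) (hQ : Q.IsSymm) {R : ℝ}
    (hR : ∀ V : Fin (m + 1) → ℝ, V 0 = 1 → V ⬝ᵥ Q *ᵥ V ≤ κ → ∀ i, |V i| ≤ R)
    {V₀ : Fin (m + 1) → ℝ} (hV₀ : V₀ 0 = 1) (hV₀Q : V₀ ⬝ᵥ Q *ᵥ V₀ < κ)
    (hcone : ∀ V : Fin (m + 1) → ℝ, V 0 = 1 → V ⬝ᵥ Q *ᵥ V ≤ κ → ∀ v : Fin k → ℝ, v ≠ 0 →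
      0 < κ * (v ⬝ᵥ S 0 y₀ *ᵥ v) - (Q *ᵥ V) ⬝ᵥ fun μ => v ⬝ᵥ S μ y₀ *ᵥ v) :
    ∃ r > 0, ∀ z ∈ Metric.ball y₀ r, ∀ δ, 0 < δ → δ ≤ r → ∀ σ : ℝ, σ ^ 2 = 1 →
      (∀ V : Fin (m + 1) → ℝ, V 0 = 1 → V ⬝ᵥ Q *ᵥ V ≤ κ → u (z - (σ * δ) • V) = 0) → u z = 0 := by
  have hR1 : 1 ≤ R := by simpa [hV₀] using hR V₀ hV₀ hV₀Q.le 0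
  obtain ⟨r', hr', hball⟩ := Metric.nhds_basis_closedBall.mem_iff.1 (Filter.inter_mem (hΩ.mem_nhds hy₀)
    (eventually_cone_pos (fun μ i j => (hS y₀ hy₀ μ i j).continuousAt) hR hcone))
  have hcpt : IsCompact (Metric.closedBall y₀ r') := isCompact_closedBall _ _
  have hmat : ∀ {F : (Fin (m + 1) → ℝ) → Matrix (Fin k) (Fin k) ℝ},
      (∀ y ∈ Ω, ∀ i j, ContinuousAt (fun z => F z i j) y) → ContinuousOn F (Metric.closedBall y₀ r') :=
    fun h => continuousOn_pi.2 fun i => continuousOn_pi.2 fun j => fun y hy =>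
      (h y (hball hy).1 i j).continuousWithinAt
  obtain ⟨c, hc, hlow⟩ := exists_lower_quadratic_bound hcpt (F := S 0)
    (hmat fun y hy i j => (hS y hy 0 i j).continuousAt) fun y hy => hpos y (hball hy).1
  have hF : ContinuousOn (fun y => (∑ μ, matDeriv μ (S μ) y) - (2 : ℝ) • K y)
      (Metric.closedBall y₀ r') := by
    have h2 : ContinuousOn (fun y => (2 : ℝ) • K y) (Metric.closedBall y₀ r') :=
      (hK.mono fun y hy => (hball hy).1).const_smul (2 : ℝ)
    refine ContinuousOn.sub (hmat fun y hy i j => ?_) h2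
    exact (MatContDiffAt.sum (k := 0) fun μ _ =>
      (hS y hy μ).matDeriv (by norm_num) μ : MatContDiffAt 0 _ y) i j |>.continuousAt
  obtain ⟨C, hC⟩ := exists_upper_quadratic_bound hcpt hF
  have hR3 : 0 < R + 3 := by linarith
  refine ⟨r' / (R + 3), div_pos hr' hR3, fun z hz δ hδ hδr σ hσ hbase => ?_⟩
  have hr'' : r' / (R + 3) * (R + 3) = r' := div_mul_cancel₀ _ hR3.ne'
  set r := r' / (R + 3) with hr
  have hr0 : 0 < r := div_pos hr' hR3
  -- Spatially the box is wider than `R δ`, the reach of the cone in time `δ`, so the cone leaves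
  -- the box only through its base. The denominator `R + 3` in `r` keeps the box inside the ball on
  -- which the estimates hold.
  set d : Fin (m + 1) → ℝ := Fin.cons δ fun _ => (R + 1) * δ with hd
  have hd0 : ∀ i, 0 < d i := Fin.cases hδ fun i => by simp only [hd, Fin.cons_succ]; positivity
  have hdle : ∀ i, d i ≤ (R + 1) * δ := by
    refine Fin.cases ?_ fun i => ?_
    · simp only [hd, Fin.cons_zero]; nlinarith
    · simp [hd]
  have hσ1 : |σ| = 1 := by
    rw [← sq_eq_sq₀ (abs_nonneg _) zero_le_one, sq_abs, hσ, one_pow]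
  have hmem : ∀ y ∈ Icc (z - d) (z + d), y ∈ Metric.closedBall y₀ r' := by
    intro y hy
    have h1 : dist y z ≤ (R + 1) * r := by
      rw [dist_pi_le_iff (by positivity)]
      intro i
      have e1 := hy.1 i
      have e2 := hy.2 i
      have e3 := hdle i
      simp only [Pi.sub_apply, Pi.add_apply] at e1 e2
      rw [Real.dist_eq, abs_le]
      constructor <;> nlinarith
    have h2 := dist_triangle y z y₀
    have h3 := Metric.mem_ball.1 hz
    rw [Metric.mem_closedBall]
    nlinarith
  have hΩ' : ∀ y ∈ Icc (z - d) (z + d), y ∈ Ω := fun y hy => (hball (hmem y hy)).1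
  have hdJ : ∀ y ∈ Icc (z - d) (z + d), ∀ μ,
      ContDiffAt ℝ 1 (fun w => u w ⬝ᵥ S μ w *ᵥ u w) y := fun y hy μ =>
    contDiffAt_current (hS y (hΩ' y hy)) (hu y (hΩ' y hy)) μ
  -- The factor `σ` in the current treats past and future cones at once: `σ` times its time
  -- component is the positive definite energy.
  have key := mul_energy_eq_zero_of_box (a := z - d) (b := z + d)
    (J := fun μ y => σ * (u y ⬝ᵥ S μ y *ᵥ u y)) (Θ := coneCutoff Q κ σ z) (E := fun y => ‖u y‖ ^ 2)
    (σ := σ) (c := c) (C := C)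
    (fun i => by have := hd0 i; simp only [Pi.sub_apply, Pi.add_apply]; linarith)
    (fun y hy μ => contDiffAt_const.mul (hdJ y hy μ))
    (fun y _ => contDiff_coneCutoff.contDiffAt) (fun y _ => sq_nonneg _)
    (fun y _ => mul_nonneg (sq_nonneg _) (sq_nonneg _)) hc
    (fun y hy => by
      rw [← mul_assoc, ← pow_two, hσ, one_mul]
      exact hlow y (hmem y hy) _)
    (fun y hy => by
      have e1 : ∀ μ, partialDeriv μ (fun y => σ * (u y ⬝ᵥ S μ y *ᵥ u y)) y = _ := fun μ =>
        partialDeriv_const_mul ((hdJ y hy μ).differentiableAt one_ne_zero) σ μ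
      simp only [e1, ← Finset.mul_sum]
      rw [sum_partialDeriv_current (hS y (hΩ' y hy)) (hsymm y (hΩ' y hy)) (hu y (hΩ' y hy))
        (heq y (hΩ' y hy))]
      refine (le_abs_self _).trans ?_
      rw [abs_mul, hσ1, one_mul]
      exact hC y (hmem y hy) _)
    (fun y hy => sum_partialDeriv_coneCutoff_mul_nonpos hQ hσ
      ((mul_nonneg hc.le (sq_nonneg _)).trans (hlow y (hmem y hy) (u y)))
      (fun V hV0 hV => (hball (hmem y hy)).2 V hV0 hV (u y)) y)
    (by
      intro y hy i hi μ
      rcases le_or_gt (-(σ * (y 0 - z 0))) 0 with hs0 | hs0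
      · simp [coneCutoff, max_eq_right hs0]
      rcases le_or_gt (κ * (y 0 - z 0) ^ 2 - (y - z) ⬝ᵥ Q *ᵥ (y - z)) 0 with hq0 | hq0
      · rw [coneCutoff, max_eq_right hq0]; simp
      obtain ⟨V, hV0, hVQ, hX⟩ := exists_cone_direction hσ hs0 hq0
      set s := -(σ * (y 0 - z 0)) with hs
      have habs : |s| = |y 0 - z 0| := by rw [hs, abs_neg, abs_mul, hσ1, one_mul]
      have hi' : |y i - z i| = d i := by
        rw [← abs_of_pos (hd0 i), abs_eq_abs]
        simp only [Pi.sub_apply, Pi.add_apply] at hi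
        rcases hi with hi | hi
        · right; linarith
        · left; linarith
      have hsδ : s ≤ δ := by
        rw [← abs_of_pos hs0, habs, abs_le]
        have e1 := hy.1 0
        have e2 := hy.2 0
        simp only [Pi.sub_apply, Pi.add_apply, hd, Fin.cons_zero] at e1 e2
        constructor <;> linarith
      -- On a face where the cut-off does not vanish, either `y` lies on the base, where `u`
      -- vanishes by assumption, or it lies on a lateral face, which the cone does not reach.
      have hu0 : u y = 0 := by
        revert hi'
        refine Fin.cases (fun hi' => ?_) (fun i hi' => ?_) i
        · have hsd : s = δ := by
            rw [← abs_of_pos hs0, habs, hi', hd, Fin.cons_zero]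
          have : y = z - (σ * δ) • V := by
            rw [← hsd, sub_eq_add_neg, ← neg_smul, ← hX, add_sub_cancel]
          rw [this]
          exact hbase V hV0 hVQ.le
        · exfalso
          have e1 : y i.succ - z i.succ = -(σ * s) * V i.succ := congrFun hX i.succ
          rw [e1, abs_mul, abs_neg, abs_mul, hσ1, one_mul, abs_of_pos hs0, hd, Fin.cons_succ] at hi'
          have e2 := hR V hV0 hVQ.le i.succ
          have e3 : s * |V i.succ| ≤ δ * R := mul_le_mul hsδ e2 (abs_nonneg _) hδ.le
          nlinarith
      simp [hu0])
  have hV₀R := hR V₀ hV₀ hV₀Q.le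
  -- The cut-off vanishes at the vertex itself. Hence `u` is shown to vanish along the axis `V₀`,
  -- where the cut-off is positive, and the vertex is reached by continuity.
  have hzero : ∀ s, 0 < s → s < δ → u (z - (σ * s) • V₀) = 0 := by
    intro s hs hsδ
    have hX : z - (σ * s) • V₀ - z = (-(σ * s)) • V₀ := by rw [neg_smul]; abel
    have hmem' : z - (σ * s) • V₀ ∈ Icc (z - d) (z + d) := by
      have h1 : ∀ i, |(σ * s) * V₀ i| ≤ d i := by
        intro i
        rw [abs_mul, abs_mul, hσ1, one_mul, abs_of_pos hs]
        refine Fin.cases ?_ (fun i => ?_) i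
        · simp only [hV₀, hd, Fin.cons_zero, abs_one, mul_one]; exact hsδ.le
        · have := mul_le_mul hsδ.le (hV₀R i.succ) (abs_nonneg _) hδ.le
          simp only [hd, Fin.cons_succ]
          nlinarith
      constructor <;> intro i <;> have := abs_le.1 (h1 i) <;>
        simp only [Pi.sub_apply, Pi.add_apply, Pi.smul_apply, smul_eq_mul] <;> linarith
    have h0 := key _ hmem'
    have hc1 : 0 < coneCutoff Q κ σ z (z - (σ * s) • V₀) := by
      have e0 : (z - (σ * s) • V₀) 0 - z 0 = -(σ * s) := by simp [hV₀]
      have e1 : -(σ * -(σ * s)) = s := by linear_combination s * hσ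
      rw [coneCutoff, hX, dotProduct_smul_mulVec_smul, e0, e1]
      have e2 : κ * (-(σ * s)) ^ 2 - (-(σ * s)) ^ 2 * (V₀ ⬝ᵥ Q *ᵥ V₀) =
          s ^ 2 * (κ - V₀ ⬝ᵥ Q *ᵥ V₀) := by
        linear_combination (κ - V₀ ⬝ᵥ Q *ᵥ V₀) * s ^ 2 * hσ
      have e3 : 0 < s ^ 2 * (κ - V₀ ⬝ᵥ Q *ᵥ V₀) := mul_pos (pow_pos hs 2) (sub_pos.2 hV₀Q)
      rw [e2, max_eq_left hs.le, max_eq_left e3.le]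
      positivity
    simpa [hc1.ne'] using h0
  have hzΩ : z ∈ Ω := hΩ' z ⟨sub_le_self _ fun i => (hd0 i).le, le_add_of_nonneg_right fun i => (hd0 i).le⟩
  have hcz : ContinuousAt u z := continuousAt_pi.2 fun i => (hu z hzΩ i).continuousAt
  have hlim : Tendsto (fun s : ℝ => u (z - (σ * s) • V₀)) (𝓝[>] 0) (𝓝 (u z)) := by
    refine hcz.tendsto.comp ?_
    have h : Continuous fun s : ℝ => z - (σ * s) • V₀ := by fun_prop
    have := h.tendsto 0
    simp only [mul_zero, zero_smul, sub_zero] at this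
    exact this.mono_left nhdsWithin_le_nhds
  refine tendsto_nhds_unique hlim (tendsto_const_nhds.congr' ?_)
  filter_upwards [Ioo_mem_nhdsGT hδ] with s hs
  exact (hzero s hs.1 hs.2).symm

end ConePropagation

/-! ### Light cones and the energy current of the constraint system. -/

section LightCone

set_option linter.unusedSectionVars false

variable {n : ℕ} {M : Type*} [TopologicalSpace M] [ChartedSpace (EuclideanSpace ℝ (Fin n)) M]
  [IsManifold (𝓡 n) ∞ M] {e : OpenPartialHomeomorph M (EuclideanSpace ℝ (Fin n))}

namespace SplitData

/-- The space components `θ^i(V)` of a vector in the Cauchy adapted frame. -/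
noncomputable def spaceComp (D : SplitData n M)
    (e : OpenPartialHomeomorph M (EuclideanSpace ℝ (Fin n))) (y V : Fin (n + 1) → ℝ) : Fin n → ℝ :=
  fun i => V i.succ + V 0 * D.shiftComp e y i

/-- The quadratic form of the space metric, extended by `0` on the unit normal direction. -/
noncomputable def spaceForm₂ (D : SplitData n M)
    (e : OpenPartialHomeomorph M (EuclideanSpace ℝ (Fin n))) (y : Fin (n + 1) → ℝ) :
    Matrix (Fin (n + 1)) (Fin (n + 1)) ℝ :=
  (D.coframe e y)ᵀ * bordered 0 0 0 (D.spatialComp e y) * D.coframe e y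

variable {D : SplitData n M} {I : Set ℝ} {ρ : SpacetimeTwoTensor n M} {y : Fin (n + 1) → ℝ}

lemma coframe_mulVec (V : Fin (n + 1) → ℝ) :
    D.coframe e y *ᵥ V = Fin.cons (V 0) (D.spaceComp e y V) := by
  rw [coframe_eq]
  ext i
  refine Fin.cases ?_ (fun i => ?_) i
  · simp [Matrix.mulVec, dotProduct, Fin.sum_univ_succ]
  · simp [Matrix.mulVec, dotProduct, Fin.sum_univ_succ, spaceComp, Matrix.one_apply]
    ring

lemma bordered_mulVec_cons (a : ℝ) (A : Matrix (Fin n) (Fin n) ℝ) (s : ℝ) (w : Fin n → ℝ) :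
    bordered a 0 0 A *ᵥ (Fin.cons s w : Fin (n + 1) → ℝ) = Fin.cons (a * s) (A *ᵥ w) := by
  ext i
  refine Fin.cases ?_ (fun i => ?_) i <;>
    simp [Matrix.mulVec, dotProduct, Fin.sum_univ_succ]

lemma cons_dotProduct_cons (a b : ℝ) (v w : Fin n → ℝ) :
    (Fin.cons a v : Fin (n + 1) → ℝ) ⬝ᵥ Fin.cons b w = a * b + v ⬝ᵥ w := by
  simp [dotProduct, Fin.sum_univ_succ]

lemma dotProduct_congruence {m : ℕ} (T A : Matrix (Fin m) (Fin m) ℝ) (V W : Fin m → ℝ) :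
    ((Tᵀ * A * T) *ᵥ V) ⬝ᵥ W = (A *ᵥ (T *ᵥ V)) ⬝ᵥ (T *ᵥ W) := by
  rw [← Matrix.mulVec_mulVec, ← Matrix.mulVec_mulVec, Matrix.mulVec_transpose,
    ← Matrix.dotProduct_mulVec]

lemma spaceForm₂_mulVec_dotProduct (V W : Fin (n + 1) → ℝ) :
    (D.spaceForm₂ e y *ᵥ V) ⬝ᵥ W =
      (D.spatialComp e y *ᵥ D.spaceComp e y V) ⬝ᵥ D.spaceComp e y W := by
  rw [spaceForm₂, dotProduct_congruence, coframe_mulVec, coframe_mulVec, bordered_mulVec_cons,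
    cons_dotProduct_cons, zero_mul, zero_mul, zero_add]

lemma dotProduct_spaceForm₂_mulVec (V : Fin (n + 1) → ℝ) :
    V ⬝ᵥ D.spaceForm₂ e y *ᵥ V =
      D.spaceComp e y V ⬝ᵥ D.spatialComp e y *ᵥ D.spaceComp e y V := by
  rw [dotProduct_comm, spaceForm₂_mulVec_dotProduct, dotProduct_comm]

lemma spaceForm₂_isSymm (hD : D.IsRegular I) (he : e ∈ IsManifold.maximalAtlas (𝓡 n) ∞ M)
    (hy : y ∈ coordDomain e I) : (D.spaceForm₂ e y).IsSymm := by
  rw [Matrix.IsSymm, spaceForm₂, Matrix.transpose_mul, Matrix.transpose_mul,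
    Matrix.transpose_transpose, bordered_transpose, spatialComp_transpose hD he hy, Matrix.mul_assoc]

lemma dotProduct_metric_comp (he : e ∈ IsManifold.maximalAtlas (𝓡 n) ∞ M)
    (hy : spacePart y ∈ e.target) (V : Fin (n + 1) → ℝ) :
    V ⬝ᵥ D.metric.comp e y *ᵥ V =
      D.spaceComp e y V ⬝ᵥ D.spatialComp e y *ᵥ D.spaceComp e y V
        - (D.lapseComp e y) ^ 2 * (V 0) ^ 2 := by
  rw [dotProduct_comm, D.metric_comp_eq he hy, dotProduct_congruence, coframe_mulVec, frameMetric,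
    bordered_mulVec_cons, cons_dotProduct_cons, dotProduct_comm]
  ring

variable {B : (Fin (n + 1) → ℝ) → Matrix (Fin (n + 1)) (Fin (n + 1)) ℝ}

lemma dotProduct_symmetrized_zero (v : Fin (n + 1) → ℝ) :
    v ⬝ᵥ (D.symmetrizer e y * (D.constraintSystem e B).A 0 y) *ᵥ v =
      (v 0) ^ 2 + ((D.lapseComp e y) ^ 2)⁻¹ *
        (Fin.tail v ⬝ᵥ D.spatialComp e y *ᵥ Fin.tail v) := by
  change v ⬝ᵥ (D.symmetrizer e y * D.principalTime e y) *ᵥ v = _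
  rw [symmetrizer_mul_principalTime, ← Fin.cons_self_tail v, bordered_mulVec_cons,
    cons_dotProduct_cons, Matrix.smul_mulVec, dotProduct_smul, Fin.cons_zero, Fin.tail_cons,
    smul_eq_mul]
  ring

/-- The shift terms in the coefficients of `∂/∂x^j` are exactly compensated by passing to frame
components, and the shift disappears from the energy flux. -/
lemma spaceComp_current (hD : D.IsRegular I) (he : e ∈ IsManifold.maximalAtlas (𝓡 n) ∞ M)
    (hy : y ∈ coordDomain e I) (v : Fin (n + 1) → ℝ) :
    D.spaceComp e y (fun μ => v ⬝ᵥ (D.symmetrizer e y * (D.constraintSystem e B).A μ y) *ᵥ v) =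
      (2 * v 0) • Fin.tail v := by
  ext i
  change v ⬝ᵥ (D.symmetrizer e y * (D.principalSpace e i y - D.shiftComp e y i •
    D.principalTime e y)) *ᵥ v + v ⬝ᵥ (D.symmetrizer e y * D.principalTime e y) *ᵥ v *
      D.shiftComp e y i = _
  rw [Matrix.mul_sub, Matrix.mul_smul, Matrix.sub_mulVec, Matrix.smul_mulVec, dotProduct_sub,
    dotProduct_smul, symmetrizer_mul_principalSpace hD he hy, smul_eq_mul, mul_comm _ (D.shiftComp e y i),
    sub_add_cancel]
  simp [Matrix.mulVec, dotProduct, Fin.sum_univ_succ, Fin.tail, Pi.single_apply]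
  ring

lemma symm_dotProduct_mulVec {m : ℕ} {A : Matrix (Fin m) (Fin m) ℝ} (hA : A.IsSymm)
    (v w : Fin m → ℝ) : v ⬝ᵥ A *ᵥ w = w ⬝ᵥ A *ᵥ v := by
  rw [Matrix.dotProduct_mulVec, ← Matrix.mulVec_transpose, hA.eq, dotProduct_comm]

/-- The energy current of the constraint system lies strictly inside every cone that is wider than
the light cone. -/
lemma current_pos (hD : D.IsRegular I) (he : e ∈ IsManifold.maximalAtlas (𝓡 n) ∞ M)
    (hy : y ∈ coordDomain e I) {κ : ℝ} (hκ : (D.lapseComp e y) ^ 2 < κ) {V : Fin (n + 1) → ℝ}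
    (hV : V ⬝ᵥ D.spaceForm₂ e y *ᵥ V ≤ κ) {v : Fin (n + 1) → ℝ} (hv : v ≠ 0) :
    0 < κ * (v ⬝ᵥ (D.symmetrizer e y * (D.constraintSystem e B).A 0 y) *ᵥ v)
      - (D.spaceForm₂ e y *ᵥ V) ⬝ᵥ
        fun μ => v ⬝ᵥ (D.symmetrizer e y * (D.constraintSystem e B).A μ y) *ᵥ v := by
  rw [spaceForm₂_mulVec_dotProduct, spaceComp_current hD he hy, dotProduct_symmetrized_zero]
  rw [dotProduct_spaceForm₂_mulVec] at hV
  have hγ := spatialComp_posDef hD he hy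
  have hN := lapseComp_pos hD hy
  have hsymm : (D.spatialComp e y).IsSymm := spatialComp_transpose hD he hy
  set w := D.spaceComp e y V
  set γ := D.spatialComp e y
  set N := D.lapseComp e y
  set x := Fin.tail v with hx
  -- Cauchy–Schwarz in the form of a completed square. With `γ(w, w) ≤ κ` it bounds the flux by `κ
  -- (v 0)² + γ(x, x)`, and strictness comes from `κ N⁻² > 1`, or from `v 0 ≠ 0` when `x = 0`.
  have h1 : 0 ≤ (v 0 • w - x) ⬝ᵥ γ *ᵥ (v 0 • w - x) := by
    simpa using hγ.posSemidef.dotProduct_mulVec_nonneg (v 0 • w - x)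
  have h2 : (v 0 • w - x) ⬝ᵥ γ *ᵥ (v 0 • w - x) =
      (v 0) ^ 2 * (w ⬝ᵥ γ *ᵥ w) - 2 * v 0 * (x ⬝ᵥ γ *ᵥ w) + x ⬝ᵥ γ *ᵥ x := by
    rw [Matrix.mulVec_sub, Matrix.mulVec_smul, dotProduct_sub, sub_dotProduct, sub_dotProduct,
      dotProduct_smul, dotProduct_smul, smul_dotProduct, smul_dotProduct,
      symm_dotProduct_mulVec hsymm w x]
    simp only [smul_eq_mul]
    ring
  have h3 : (γ *ᵥ w) ⬝ᵥ (2 * v 0) • x = 2 * v 0 * (x ⬝ᵥ γ *ᵥ w) := by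
    rw [dotProduct_smul, dotProduct_comm, smul_eq_mul]
  have h4 : (v 0) ^ 2 * (w ⬝ᵥ γ *ᵥ w) ≤ (v 0) ^ 2 * κ := mul_le_mul_of_nonneg_left hV (sq_nonneg _)
  have hκ0 : 0 < κ := (sq_nonneg N).trans_lt hκ
  have h5 : 1 < κ * (N ^ 2)⁻¹ := by
    rw [← div_eq_mul_inv, one_lt_div (pow_pos hN 2)]
    exact hκ
  rw [h3]
  rcases eq_or_ne x 0 with hx0 | hx0
  · have hv0 : v 0 ≠ 0 := by
      intro h
      refine hv ?_
      rw [← Fin.cons_self_tail v, ← hx, hx0, h]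
      ext i
      refine Fin.cases rfl (fun i => rfl) i
    rw [hx0]
    simp only [Matrix.mulVec_zero, dotProduct_zero, zero_dotProduct, mul_zero, add_zero, sub_zero]
    positivity
  · have h6 : 0 < x ⬝ᵥ γ *ᵥ x := by simpa using hγ.dotProduct_mulVec_pos hx0
    have h7 := mul_lt_mul_of_pos_right h5 h6
    have h8 : κ * ((v 0) ^ 2 + (N ^ 2)⁻¹ * (x ⬝ᵥ γ *ᵥ x)) =
        (v 0) ^ 2 * κ + κ * (N ^ 2)⁻¹ * (x ⬝ᵥ γ *ᵥ x) := by ring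
    rw [h8]
    linarith

/-- The vectors `V` with `V^0 = 1` and `g(V, V) ≤ ε`. -/
def coneAt (D : SplitData n M) (e : OpenPartialHomeomorph M (EuclideanSpace ℝ (Fin n)))
    (y : Fin (n + 1) → ℝ) (ε : ℝ) : Set (Fin (n + 1) → ℝ) :=
  {V | V 0 = 1 ∧ V ⬝ᵥ D.metric.comp e y *ᵥ V ≤ ε}

lemma mem_coneAt_iff (he : e ∈ IsManifold.maximalAtlas (𝓡 n) ∞ M)
    (hy : spacePart y ∈ e.target) {V : Fin (n + 1) → ℝ} (hV : V 0 = 1) {ε : ℝ} :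
    V ∈ D.coneAt e y ε ↔ V ⬝ᵥ D.spaceForm₂ e y *ᵥ V ≤ (D.lapseComp e y) ^ 2 + ε := by
  simp only [coneAt, mem_ofPred_eq, hV, true_and]
  rw [dotProduct_metric_comp he hy, dotProduct_spaceForm₂_mulVec, hV]
  constructor <;> intro h <;> linarith

lemma continuousOn_spatialComp (hI : IsOpen I) (hD : D.IsRegular I)
    (he : e ∈ IsManifold.maximalAtlas (𝓡 n) ∞ M) :
    ContinuousOn (D.spatialComp e) (coordDomain e I) :=
  continuousOn_matrix fun _ hy => (matContDiffAt_spatialComp hI hD he hy).of_le (by norm_num)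

/-- The slices of the cones are bounded, uniformly on compact sets. -/
lemma exists_coneAt_bound (hI : IsOpen I) (hD : D.IsRegular I)
    (he : e ∈ IsManifold.maximalAtlas (𝓡 n) ∞ M) {K : Set (Fin (n + 1) → ℝ)} (hK : IsCompact K)
    (hKI : K ⊆ coordDomain e I) (ε : ℝ) :
    ∃ R, ∀ y ∈ K, ∀ V ∈ D.coneAt e y ε, ∀ i, |V i| ≤ R := by
  obtain ⟨c, hc, hlow⟩ := exists_lower_quadratic_bound hK
    ((continuousOn_spatialComp hI hD he).mono hKI) fun y hy => spatialComp_posDef hD he (hKI hy)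
  obtain ⟨A, hA⟩ := hK.exists_bound_of_continuousOn (f := D.lapseComp e) fun y hy =>
    (contDiffAt_lapseComp hI hD he (hKI hy)).continuousAt.continuousWithinAt
  obtain ⟨b, hb⟩ := hK.exists_bound_of_continuousOn (f := D.shiftComp e) fun y hy =>
    (continuousAt_pi.2 fun i =>
      (contDiffAt_shiftComp hI hD he (hKI hy) i).continuousAt).continuousWithinAt
  refine ⟨1 + (A ^ 2 + |ε|) / c + |b| + 1, fun y hy V hV i => ?_⟩
  have hV' := hV.2
  rw [dotProduct_metric_comp he (hKI hy).2, hV.1] at hV'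
  set w := D.spaceComp e y V with hw
  have h1 := hlow y hy w
  have h2 : (D.lapseComp e y) ^ 2 ≤ A ^ 2 := sq_le_sq' (by
    have := hA y hy; rw [Real.norm_eq_abs] at this; linarith [neg_abs_le (D.lapseComp e y)])
    ((le_abs_self _).trans (hA y hy))
  have h3 : ‖w‖ ^ 2 ≤ (A ^ 2 + |ε|) / c := by
    rw [le_div_iff₀ hc]
    have := le_abs_self ε
    linarith
  have h4 : ‖w‖ ≤ 1 + (A ^ 2 + |ε|) / c := by nlinarith [sq_nonneg (‖w‖ - 1)]
  have h0 : 0 ≤ (A ^ 2 + |ε|) / c := by positivity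
  refine Fin.cases ?_ (fun i => ?_) i
  · rw [hV.1, abs_one]
    linarith [abs_nonneg b]
  · have h5 : V i.succ = w i - D.shiftComp e y i := by simp [hw, spaceComp, hV.1]
    have h6 := norm_le_pi_norm w i
    have h7 := (norm_le_pi_norm (D.shiftComp e y) i).trans ((hb y hy).trans (le_abs_self b))
    rw [Real.norm_eq_abs] at h6 h7
    rw [h5]
    linarith [abs_sub (w i) (D.shiftComp e y i)]

/-- Where the constraints are violated, they are also violated at the base of every small cone that
is slightly wider than the light cone. -/
theorem exists_coneAt_constraint_ne_zero (hI : IsOpen I) (hD : D.IsRegular I)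
    (hρ : D.SolvesEvolution ρ I) (he : e ∈ IsManifold.maximalAtlas (𝓡 n) ∞ M)
    (hy : y ∈ coordDomain e I) {ε : ℝ} (hε : 0 < ε) :
    ∃ r > 0, ∀ z ∈ Metric.ball y r, ∀ δ, 0 < δ → δ ≤ r → ∀ σ : ℝ, σ ^ 2 = 1 →
      D.constraint ρ e z ≠ 0 →
        ∃ V ∈ D.coneAt e y ε, D.constraint ρ e (z - (σ * δ) • V) ≠ 0 := by
  obtain ⟨R, hR⟩ := exists_coneAt_bound hI hD he (isCompact_singleton (x := y))
    (singleton_subset_iff.2 hy) ε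
  -- The vector `e_0`: its space part vanishes, so it lies strictly inside the cone and serves as
  -- the axis.
  set V₀ : Fin (n + 1) → ℝ := Fin.cons 1 (-D.shiftComp e y) with hV₀
  have hw₀ : D.spaceComp e y V₀ = 0 := by
    ext i; simp [spaceComp, hV₀]
  have hN := lapseComp_pos hD hy
  obtain ⟨r, hr, h⟩ := eq_zero_of_eq_zero_on_cone_base (Q := D.spaceForm₂ e y)
    (κ := (D.lapseComp e y) ^ 2 + ε) (isOpen_coordDomain e hI)
    (S := fun μ y => D.symmetrizer e y * (D.constraintSystem e (D.constraintCoeff e)).A μ y)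
    (K := fun y => D.symmetrizer e y * D.constraintCoeff e y) (u := D.constraint ρ e)
    (fun z hz μ => ((matContDiffAt_symmetrizer hI hD he hz).mul
      (matContDiffAt_constraintSystem_A hI hD he hz _ μ)).of_le (by norm_num))
    (fun z hz μ => symmetrizer_mul_A_symm hD he hz _ μ)
    (fun z hz => symmetrizer_mul_A_zero_posDef hD he hz _)
    (continuousOn_matrix fun z hz => ((matContDiffAt_symmetrizer hI hD he hz).of_le
      (by norm_num)).mul (matContDiffAt_constraintCoeff hI hD he hz))
    (fun z hz i => contDiffAt_constraint hI hD hρ he hz i)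
    (fun z hz => by
      have h := congrArg (fun w => D.symmetrizer e z *ᵥ w)
        ((isSolutionOn_constraint hI hD hρ he).2 z hz)
      simp only [Matrix.mulVec_add, Matrix.mulVec_sum, Matrix.mulVec_mulVec, Matrix.mulVec_zero] at h
      exact h)
    hy (spaceForm₂_isSymm hD he hy)
    (fun V hV0 hV i => hR y rfl V ((mem_coneAt_iff he hy.2 hV0).2 hV) i)
    (V₀ := V₀) (by simp [hV₀])
    (by rw [dotProduct_spaceForm₂_mulVec, hw₀, zero_dotProduct]; positivity)
    (fun V _ hV v hv => current_pos hD he hy (by linarith) hV hv)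
  refine ⟨r, hr, fun z hz δ hδ hδr σ hσ hne => ?_⟩
  by_contra! hcon
  exact hne (h z hz δ hδ hδr σ hσ fun V hV0 hV => hcon V ((mem_coneAt_iff he hy.2 hV0).2 hV))

end SplitData

end LightCone

/-! ### Convexity and continuity of the cones; propagation off a slice. -/

section ConeField

set_option linter.unusedSectionVars false

variable {n : ℕ} {M : Type*} [TopologicalSpace M] [ChartedSpace (EuclideanSpace ℝ (Fin n)) M]
  [IsManifold (𝓡 n) ∞ M] {e : OpenPartialHomeomorph M (EuclideanSpace ℝ (Fin n))}

namespace SplitData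

variable {D : SplitData n M} {I : Set ℝ} {ρ : SpacetimeTwoTensor n M} {y : Fin (n + 1) → ℝ}

/-- On `V^0 = 1` the metric differs by a constant from a positive semidefinite quadratic form, whose
sublevel sets are convex. -/
lemma convex_coneAt (hD : D.IsRegular I) (he : e ∈ IsManifold.maximalAtlas (𝓡 n) ∞ M)
    (hy : y ∈ coordDomain e I) (ε : ℝ) : Convex ℝ (D.coneAt e y ε) := by
  intro V hV W hW a b ha hb hab
  have h0 : (a • V + b • W) 0 = 1 := by simp [hV.1, hW.1, hab]
  rw [mem_coneAt_iff he hy.2 h0]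
  have hV' := (mem_coneAt_iff he hy.2 hV.1).1 hV
  have hW' := (mem_coneAt_iff he hy.2 hW.1).1 hW
  have hsymm := spaceForm₂_isSymm hD he hy
  have h1 : 0 ≤ (V - W) ⬝ᵥ D.spaceForm₂ e y *ᵥ (V - W) := by
    rw [dotProduct_spaceForm₂_mulVec]
    simpa using (spatialComp_posDef hD he hy).posSemidef.dotProduct_mulVec_nonneg
      (D.spaceComp e y (V - W))
  set Q := D.spaceForm₂ e y
  have h2 : (V - W) ⬝ᵥ Q *ᵥ (V - W) = V ⬝ᵥ Q *ᵥ V - 2 * (V ⬝ᵥ Q *ᵥ W) + W ⬝ᵥ Q *ᵥ W := by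
    rw [Matrix.mulVec_sub, dotProduct_sub, sub_dotProduct, sub_dotProduct,
      symm_dotProduct_mulVec hsymm W V]
    ring
  have h3 : (a • V + b • W) ⬝ᵥ Q *ᵥ (a • V + b • W) =
      a ^ 2 * (V ⬝ᵥ Q *ᵥ V) + 2 * (a * b) * (V ⬝ᵥ Q *ᵥ W) + b ^ 2 * (W ⬝ᵥ Q *ᵥ W) := by
    rw [Matrix.mulVec_add, dotProduct_add, add_dotProduct, add_dotProduct, Matrix.mulVec_smul,
      Matrix.mulVec_smul, dotProduct_smul, dotProduct_smul, dotProduct_smul, dotProduct_smul,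
      smul_dotProduct, smul_dotProduct, smul_dotProduct, smul_dotProduct,
      symm_dotProduct_mulVec hsymm W V]
    simp only [smul_eq_mul]
    ring
  rw [h3]
  rw [h2] at h1
  obtain rfl : b = 1 - a := by linarith
  nlinarith [mul_nonneg (mul_nonneg ha hb) h1, mul_le_mul_of_nonneg_left hV' ha,
    mul_le_mul_of_nonneg_left hW' hb]

lemma isClosed_coneAt (ε : ℝ) : IsClosed (D.coneAt e y ε) := by
  have h : IsClosed {V : Fin (n + 1) → ℝ | V ⬝ᵥ D.metric.comp e y *ᵥ V ≤ ε} :=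
    isClosed_le (continuous_id.dotProduct (continuous_const.matrix_mulVec continuous_id))
      continuous_const
  exact (isClosed_eq (continuous_apply 0) continuous_const).inter h

lemma coneAt_mono {ε ε' : ℝ} (h : ε ≤ ε') : D.coneAt e y ε ⊆ D.coneAt e y ε' :=
  fun _ hV => ⟨hV.1, hV.2.trans h⟩

lemma norm_le_of_abs_le {m : ℕ} {V : Fin (m + 1) → ℝ} {R : ℝ} (h : ∀ i, |V i| ≤ R) : ‖V‖ ≤ R :=
  (pi_norm_le_iff_of_nonempty _).2 h

/-- The cones depend continuously on the base point. -/
lemma exists_coneAt_subset (hI : IsOpen I) (hD : D.IsRegular I)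
    (he : e ∈ IsManifold.maximalAtlas (𝓡 n) ∞ M) (hy : y ∈ coordDomain e I) {η : ℝ} (hη : 0 < η) :
    ∃ r > 0, ∀ z ∈ Metric.ball y r, ∀ z' ∈ Metric.ball y r,
      D.coneAt e z (η / 2) ⊆ D.coneAt e z' η := by
  obtain ⟨r, hr, hball⟩ := Metric.nhds_basis_closedBall.mem_iff.1
    ((isOpen_coordDomain e hI).mem_nhds hy)
  have hK : IsCompact (Metric.closedBall y r) := isCompact_closedBall _ _
  obtain ⟨R, hR⟩ := exists_coneAt_bound hI hD he hK hball (η / 2)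
  have hc : ContinuousOn (D.metric.comp e) (Metric.closedBall y r) :=
    continuousOn_matrix fun z hz i j =>
      ((isMetricAt_metric_comp hI hD he (hball hz)).smooth i j).of_le (by norm_num)
  have hu := (hK.prod (isCompact_closedBall (0 : Fin (n + 1) → ℝ) R)).uniformContinuousOn_of_continuous
    (continuousOn_dotProduct_mulVec hc _)
  -- Uniform continuity of `g(V, V)` over bounded `V`: moving the base point changes the value by
  -- less than `η / 2`, the difference between the two widths.
  obtain ⟨d₀, hd₀, h⟩ := Metric.uniformContinuousOn_iff.1 hu (η / 2) (half_pos hη)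
  refine ⟨min r (d₀ / 2), lt_min hr (half_pos hd₀), fun z hz z' hz' V hV => ⟨hV.1, ?_⟩⟩
  have hzr : ∀ w ∈ Metric.ball y (min r (d₀ / 2)), w ∈ Metric.closedBall y r := fun w hw =>
    Metric.mem_closedBall.2 ((Metric.mem_ball.1 hw).le.trans (min_le_left _ _))
  have hVR : V ∈ Metric.closedBall (0 : Fin (n + 1) → ℝ) R :=
    mem_closedBall_zero_iff.2 (norm_le_of_abs_le (hR z (hzr z hz) V hV))
  have hd : dist z z' < d₀ := by
    have h1 := (Metric.mem_ball.1 hz).trans_le (min_le_right _ _)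
    have h2 := (Metric.mem_ball'.1 hz').trans_le (min_le_right _ _)
    linarith [dist_triangle z y z']
  have h1 := h (z, V) ⟨hzr z hz, hVR⟩ (z', V) ⟨hzr z' hz', hVR⟩ (by
    rw [Prod.dist_eq, dist_self, max_eq_left dist_nonneg]; exact hd)
  rw [Real.dist_eq] at h1
  have h2 := (abs_lt.1 h1).1
  have h3 := hV.2
  simp only at h2
  linarith

/-- If the constraints hold near an event on its time slice, then they hold near that event. -/
lemma eventually_constraint_eq_zero_of_slice (hI : IsOpen I) (hD : D.IsRegular I)
    (hρ : D.SolvesEvolution ρ I) (he : e ∈ IsManifold.maximalAtlas (𝓡 n) ∞ M)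
    (hy : y ∈ coordDomain e I)
    (h : ∀ᶠ z in 𝓝 y, z 0 = y 0 → D.constraint ρ e z = 0) :
    ∀ᶠ z in 𝓝 y, D.constraint ρ e z = 0 := by
  obtain ⟨r, hr, hstep⟩ := exists_coneAt_constraint_ne_zero hI hD hρ he hy one_pos
  obtain ⟨R, hR⟩ := exists_coneAt_bound hI hD he (isCompact_singleton (x := y))
    (singleton_subset_iff.2 hy) 1
  obtain ⟨d₀, hd₀, hball⟩ := Metric.mem_nhds_iff.1 h
  have hR2 : 0 < |R| + 2 := by positivity
  refine Metric.eventually_nhds_iff_ball.2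
    ⟨min r (min d₀ (d₀ / (|R| + 2))), by positivity, fun z hz => ?_⟩
  have hzr := (Metric.mem_ball.1 hz).trans_le (min_le_left _ _)
  have hzd := (Metric.mem_ball.1 hz).trans_le ((min_le_right _ _).trans (min_le_left _ _))
  have hzR := (Metric.mem_ball.1 hz).trans_le ((min_le_right _ _).trans (min_le_right _ _))
  rw [lt_div_iff₀ hR2] at hzR
  rcases eq_or_ne (z 0) (y 0) with h0 | h0
  · exact hball hzd h0
  by_contra hne
  have h0' : z 0 - y 0 ≠ 0 := sub_ne_zero.2 h0
  have hδ : |z 0 - y 0| ≤ dist z y := by rw [← Real.dist_eq]; exact dist_le_pi_dist z y 0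
  -- Height and direction are chosen so that the base of the cone lies on the time slice of `y`. The
  -- factor `|R| + 2` in the radius keeps the base inside the region where the constraints are
  -- known.
  obtain ⟨V, hV, hV'⟩ := hstep z hzr |z 0 - y 0| (abs_pos.2 h0') (hδ.trans hzr.le)
    (SignType.sign (z 0 - y 0)) (by
      rcases h0'.lt_or_gt with h | h
      · simp [sign_neg h]
      · simp [sign_pos h]) hne
  rw [sign_mul_abs] at hV'
  have hVR := norm_le_of_abs_le (hR y rfl V hV)
  refine hV' (hball ?_ ?_)
  · have h1 : dist (z - (z 0 - y 0) • V) z ≤ dist z y * |R| := by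
      rw [dist_eq_norm, sub_sub_cancel_left, norm_neg, norm_smul, Real.norm_eq_abs]
      exact mul_le_mul hδ (hVR.trans (le_abs_self R)) (norm_nonneg _) dist_nonneg
    have h2 := dist_triangle (z - (z 0 - y 0) • V) z y
    rw [Metric.mem_ball]
    nlinarith [dist_nonneg (x := z) (y := y)]
  · simp [hV.1]

end SplitData

end ConeField

/-! ### From discrete steps in cones to limit curves. -/

section CurveLimit

open scoped Pointwise

variable {m : ℕ}

/-- A decreasing family of closed convex sets `C y ε` of vectors with time component `1`, bounded
and depending continuously on the base point `y`. -/
structure IsConeField (Ω : Set (Fin (m + 1) → ℝ))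
    (C : (Fin (m + 1) → ℝ) → ℝ → Set (Fin (m + 1) → ℝ)) : Prop where
  time : ∀ y ε, ∀ V ∈ C y ε, V 0 = 1
  mono : ∀ y ε ε', ε ≤ ε' → C y ε ⊆ C y ε'
  nonempty : ∀ y ∈ Ω, ∀ ε, 0 < ε → (C y ε).Nonempty
  convex : ∀ y ∈ Ω, ∀ ε, Convex ℝ (C y ε)
  isClosed : ∀ y ε, IsClosed (C y ε)
  bound : ∀ K, IsCompact K → K ⊆ Ω → ∃ R, ∀ y ∈ K, ∀ V ∈ C y 1, ‖V‖ ≤ R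
  cont : ∀ y ∈ Ω, ∀ η, 0 < η → ∃ r > 0, ∀ z ∈ Metric.ball y r, ∀ z' ∈ Metric.ball y r,
    C z (η / 2) ⊆ C z' η

variable {Ω : Set (Fin (m + 1) → ℝ)} {C : (Fin (m + 1) → ℝ) → ℝ → Set (Fin (m + 1) → ℝ)}
  {P : (Fin (m + 1) → ℝ) → Prop} {σ : ℝ}

/-- From every point with property `P`, small steps inside slightly widened cones lead to points
with property `P`. -/
def HasConeSteps (Ω : Set (Fin (m + 1) → ℝ)) (C : (Fin (m + 1) → ℝ) → ℝ → Set (Fin (m + 1) → ℝ))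
    (P : (Fin (m + 1) → ℝ) → Prop) (σ : ℝ) : Prop :=
  ∀ y ∈ Ω, ∀ ε, 0 < ε → ∃ r > 0, ∀ z ∈ Metric.ball y r, ∀ δ, 0 < δ → δ ≤ r → P z →
    ∃ V ∈ C y ε, P (z + (σ * δ) • V)

/-- One step size for a compact set, and the cone taken at the actual point instead of a fixed
centre. At the centre only the width `ε / 2` is used, so that continuity of the cones covers the
difference. -/
lemma HasConeSteps.uniform (hstep : HasConeSteps Ω C P σ) (hC : IsConeField Ω C)
    {K : Set (Fin (m + 1) → ℝ)} (hK : IsCompact K) (hKΩ : K ⊆ Ω) {ε : ℝ} (hε : 0 < ε) :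
    ∃ τ > 0, ∀ z ∈ K, P z → ∀ δ, 0 < δ → δ ≤ τ → ∃ V ∈ C z ε, P (z + (σ * δ) • V) := by
  refine hK.induction_on (p := fun s => ∃ τ > 0, ∀ z ∈ s, P z → ∀ δ, 0 < δ → δ ≤ τ →
    ∃ V ∈ C z ε, P (z + (σ * δ) • V)) ⟨1, one_pos, by simp⟩ ?_ ?_ ?_
  · rintro s t hst ⟨τ, hτ, h⟩
    exact ⟨τ, hτ, fun z hz => h z (hst hz)⟩
  · rintro s t ⟨τ, hτ, h⟩ ⟨τ', hτ', h'⟩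
    refine ⟨min τ τ', lt_min hτ hτ', fun z hz hP δ hδ hδτ => ?_⟩
    rcases hz with hz | hz
    · exact h z hz hP δ hδ (hδτ.trans (min_le_left _ _))
    · exact h' z hz hP δ hδ (hδτ.trans (min_le_right _ _))
  · intro y hy
    obtain ⟨r, hr, h⟩ := hC.cont y (hKΩ hy) ε hε
    obtain ⟨r', hr', h'⟩ := hstep y (hKΩ hy) (ε / 2) (half_pos hε)
    refine ⟨Metric.ball y (min r r'), mem_nhdsWithin_of_mem_nhds
      (Metric.ball_mem_nhds y (lt_min hr hr')), r', hr', fun z hz hP δ hδ hδr => ?_⟩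
    obtain ⟨V, hV, hPV⟩ := h' z (Metric.ball_subset_ball (min_le_right _ _) hz) δ hδ hδr hP
    exact ⟨V, h y (Metric.mem_ball_self hr) z (Metric.ball_subset_ball (min_le_left _ _) hz) hV, hPV⟩

/-- Step functions through points with property `P` whose increments lie in the widened cones. -/
lemma HasConeSteps.exists_approx (hstep : HasConeSteps Ω C P σ) (hC : IsConeField Ω C)
    (hσ : σ ^ 2 = 1) {K : Set (Fin (m + 1) → ℝ)} (hK : IsCompact K) (hKΩ : K ⊆ Ω) {R : ℝ}
    (hR0 : 0 ≤ R) (hR : ∀ y ∈ K, ∀ V ∈ C y 1, ‖V‖ ≤ R) {τ : ℝ} (hτ : 0 < τ)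
    {z : Fin (m + 1) → ℝ} (hz : Metric.closedBall z (R * τ) ⊆ K) (hPz : P z) {ε : ℝ} (hε : 0 < ε)
    (hε1 : ε ≤ 1) :
    ∃ γ : ℝ → Fin (m + 1) → ℝ, γ 0 = z ∧ (∀ s ∈ Icc 0 τ, P (γ s) ∧ γ s ∈ K) ∧
      ∀ s s', 0 ≤ s → s ≤ s' → s' ≤ τ → ∃ h, 0 ≤ h ∧ |h - (s' - s)| ≤ ε ∧
        ‖γ s' - γ s‖ ≤ R * h ∧ ∀ T : Set (Fin (m + 1) → ℝ), Convex ℝ T → T.Nonempty →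
          (∀ y ∈ K, ‖y - γ s‖ ≤ R * h → C y ε ⊆ T) → σ • (γ s' - γ s) ∈ h • T := by
  obtain ⟨τ', hτ', hu⟩ := hstep.uniform hC hK hKΩ hε
  -- The step `τ / N` is at most `τ'`, so that steps exist, and at most `ε`, so that rounding times
  -- to multiples of it costs at most `ε`.
  obtain ⟨N, hN⟩ := exists_nat_gt (τ / min τ' ε)
  have hmin : 0 < min τ' ε := lt_min hτ' hε
  have hN0 : (0 : ℝ) < N := (div_pos hτ hmin).trans hN
  set δ := τ / N with hδ'
  have hδ : 0 < δ := div_pos hτ hN0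
  have hNδ : N * δ = τ := mul_div_cancel₀ _ hN0.ne'
  have hδle : δ ≤ min τ' ε := by
    rw [div_lt_iff₀ hmin] at hN
    rw [hδ', div_le_iff₀ hN0]
    linarith
  have hex : ∀ w, ∃ w', w ∈ K → P w → ∃ V ∈ C w ε, w' = w + (σ * δ) • V ∧ P w' := by
    intro w
    by_cases hw : w ∈ K ∧ P w
    · obtain ⟨V, hV, hPV⟩ := hu w hw.1 hw.2 δ hδ (hδle.trans (min_le_left _ _))
      exact ⟨_, fun _ _ => ⟨V, hV, rfl, hPV⟩⟩
    · exact ⟨w, fun h1 h2 => absurd ⟨h1, h2⟩ hw⟩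
  choose f hf using hex
  set Z : ℕ → Fin (m + 1) → ℝ := fun j => f^[j] z with hZ
  have hZs : ∀ j, Z (j + 1) = f (Z j) := fun j => Function.iterate_succ_apply' f j z
  have hnorm : ∀ {w V}, w ∈ K → V ∈ C w ε → ‖(σ * δ) • V‖ ≤ R * δ := by
    intro w V hw hV
    have hσ1 : |σ| = 1 := by
      rw [← sq_eq_sq₀ (abs_nonneg _) zero_le_one, sq_abs, hσ, one_pow]
    rw [norm_smul, Real.norm_eq_abs, abs_mul, hσ1, one_mul, abs_of_pos hδ, mul_comm]
    exact mul_le_mul_of_nonneg_right (hR w hw V (hC.mono w ε 1 hε1 hV)) hδ.le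
  have hmem : ∀ j ≤ N, ‖Z j - z‖ ≤ R * (j * δ) → Z j ∈ K := by
    intro j hj h
    refine hz (Metric.mem_closedBall.2 ?_)
    rw [dist_eq_norm]
    refine h.trans (mul_le_mul_of_nonneg_left ?_ hR0)
    rw [← hNδ]
    exact mul_le_mul_of_nonneg_right (by exact_mod_cast hj) hδ.le
  have h1 : ∀ j ≤ N, P (Z j) ∧ ‖Z j - z‖ ≤ R * (j * δ) := by
    intro j
    induction j with
    | zero => intro _; simpa [hZ] using hPz
    | succ j ih =>
      intro hj
      obtain ⟨hP, hn⟩ := ih (by omega)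
      obtain ⟨V, hV, hw, hPw⟩ := hf (Z j) (hmem j (by omega) hn) hP
      rw [hZs]
      refine ⟨hPw, ?_⟩
      have e1 : f (Z j) - z = (Z j - z) + (σ * δ) • V := by rw [hw]; abel
      rw [e1]
      push_cast
      linarith [norm_add_le (Z j - z) ((σ * δ) • V), hnorm (hmem j (by omega) hn) hV]
  have hZK : ∀ j ≤ N, Z j ∈ K := fun j hj => hmem j hj (h1 j hj).2
  -- If a convex `T` contains all cones that can be met, the sum of `l` increments lies in `(l δ)
  -- T`; the induction uses `(l δ) T + δ T = (l δ + δ) T` for convex `T`.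
  have h2 : ∀ a l, a + l ≤ N → ‖Z (a + l) - Z a‖ ≤ R * (l * δ) ∧
      ∀ T : Set (Fin (m + 1) → ℝ), Convex ℝ T → T.Nonempty →
        (∀ y ∈ K, ‖y - Z a‖ ≤ R * (l * δ) → C y ε ⊆ T) →
          σ • (Z (a + l) - Z a) ∈ (l * δ : ℝ) • T := by
    intro a l
    induction l with
    | zero =>
      intro _
      refine ⟨by simp, fun T _ hT _ => ?_⟩
      simp [zero_smul_set hT]
    | succ l ih =>
      intro hl
      obtain ⟨hn, hT⟩ := ih (by omega)
      obtain ⟨V, hV, hw, -⟩ := hf (Z (a + l)) (hZK _ (by omega)) (h1 _ (by omega)).1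
      have e1 : Z (a + (l + 1)) - Z a = (Z (a + l) - Z a) + (σ * δ) • V := by
        rw [← add_assoc, hZs, hw]; abel
      have hle : R * (l * δ) ≤ R * ((l + 1 : ℕ) * δ) := by
        push_cast
        nlinarith [mul_nonneg hR0 hδ.le]
      refine ⟨?_, fun T hTc hTn hsub => ?_⟩
      · rw [e1]
        push_cast
        linarith [norm_add_le (Z (a + l) - Z a) ((σ * δ) • V), hnorm (hZK _ (by omega)) hV]
      · have e2 : ((l + 1 : ℕ) * δ : ℝ) = l * δ + δ := by push_cast; ring
        rw [e2, hTc.add_smul (by positivity) hδ.le, e1, smul_add]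
        refine add_mem_add (hT T hTc hTn fun y hy hya => hsub y hy (hya.trans hle)) ?_
        rw [smul_smul, ← mul_assoc, ← pow_two, hσ, one_mul]
        exact smul_mem_smul_set (hsub _ (hZK _ (by omega)) (hn.trans hle) hV)
  have hfl : ∀ s, s ≤ τ → ⌊s / δ⌋₊ ≤ N := fun s hs => Nat.floor_le_of_le (by
    rw [div_le_iff₀ hδ, hNδ]; exact hs)
  refine ⟨fun s => Z ⌊s / δ⌋₊, by simp [hZ], fun s hs => ⟨(h1 _ (hfl s hs.2)).1, hZK _ (hfl s hs.2)⟩,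
    fun s s' hs hss hs' => ?_⟩
  -- The time `h` attached to the increment is `l δ`, with `l` the number of whole steps between the
  -- two rounded times.
  obtain ⟨l, hl⟩ := Nat.exists_eq_add_of_le (Nat.floor_mono ((div_le_div_iff_of_pos_right hδ).2 hss))
  have hl' := hl ▸ hfl s' hs'
  obtain ⟨hn, hT⟩ := h2 ⌊s / δ⌋₊ l hl'
  refine ⟨l * δ, by positivity, ?_, by simpa only [hl] using hn, by simpa only [hl] using hT⟩
  have a1 := Nat.floor_le (div_nonneg hs hδ.le)
  have a2 := Nat.lt_floor_add_one (s / δ)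
  have b1 := Nat.floor_le (div_nonneg (hs.trans hss) hδ.le)
  have b2 := Nat.lt_floor_add_one (s' / δ)
  rw [hl] at b1 b2
  push_cast at b1 b2
  rw [le_div_iff₀ hδ] at a1 b1
  rw [div_lt_iff₀ hδ] at a2 b2
  have hδε := hδle.trans (min_le_right _ _)
  rw [abs_le]
  constructor <;> linarith

/-- Limits of step functions: curves in the closure of `P` whose chords lie in the cones. -/
theorem HasConeSteps.exists_curve (hstep : HasConeSteps Ω C P σ) (hC : IsConeField Ω C)
    (hΩ : IsOpen Ω) (hσ : σ ^ 2 = 1) {y : Fin (m + 1) → ℝ} (hy : y ∈ Ω) :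
    ∃ r > 0, ∃ τ > 0, ∃ R : NNReal, ∀ z ∈ Metric.ball y r, z ∈ closure {w | P w} →
      ∃ γ : ℝ → Fin (m + 1) → ℝ, γ 0 = z ∧
        (∀ s ∈ Icc 0 τ, γ s ∈ closure {w | P w} ∧ γ s ∈ Ω ∧ γ s 0 = z 0 + σ * s) ∧
        LipschitzOnWith R γ (Icc 0 τ) ∧
        ∀ s ∈ Ico 0 τ, ∀ η > 0, ∀ᶠ s' in 𝓝[>] s,
          (s' - s)⁻¹ • σ • (γ s' - γ s) ∈ C (γ s) η := by
  obtain ⟨ρ, hρ, hball⟩ := Metric.nhds_basis_closedBall.mem_iff.1 (hΩ.mem_nhds hy)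
  have hK : IsCompact (Metric.closedBall y ρ) := isCompact_closedBall _ _
  obtain ⟨R', hR'⟩ := hC.bound _ hK hball
  set R : ℝ := max R' 1 with hRdef
  have hR1 : 1 ≤ R := le_max_right _ _
  have hR0 : 0 ≤ R := zero_le_one.trans hR1
  have hR : ∀ w ∈ Metric.closedBall y ρ, ∀ V ∈ C w 1, ‖V‖ ≤ R := fun w hw V hV =>
    (hR' w hw V hV).trans (le_max_left _ _)
  set τ : ℝ := ρ / (2 * R) with hτdef
  have hτ : 0 < τ := by positivity
  have hRτ : R * τ = ρ / 2 := by rw [hτdef]; field_simp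
  refine ⟨ρ / 2, half_pos hρ, τ, hτ, NNReal.mk R hR0, fun z hz hzP => ?_⟩
  set ε : ℕ → ℝ := fun k => 1 / ((k : ℝ) + 1) with hεdef
  have hε0 : ∀ k, 0 < ε k := fun k => Nat.one_div_pos_of_nat
  have hε1 : ∀ k, ε k ≤ 1 := fun k => by
    rw [hεdef]; exact (div_le_one (by positivity)).2 (by linarith [(Nat.cast_nonneg k : (0 : ℝ) ≤ k)])
  have hεlim : Tendsto ε atTop (𝓝 0) := tendsto_one_div_add_atTop_nhds_zero_nat
  -- Steps start only from points with property `P`, whereas `z` is merely in the closure, so the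
  -- approximations start at points converging to `z`.
  have hzk : ∀ k, ∃ w, P w ∧ w ∈ Metric.ball y (ρ / 2) ∧ dist w z < ε k := by
    intro k
    obtain ⟨w, hw1, hw2⟩ := mem_closure_iff_nhds.1 hzP _ (inter_mem (Metric.isOpen_ball.mem_nhds hz)
      (Metric.ball_mem_nhds z (hε0 k)))
    exact ⟨w, hw2, hw1.1, hw1.2⟩
  choose zk hzkP hzkb hzkd using hzk
  have happ := fun k => hstep.exists_approx hC hσ hK hball hR0 hR hτ (z := zk k) (by
    rw [hRτ]
    refine Metric.closedBall_subset_closedBall' ?_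
    have := Metric.mem_ball.1 (hzkb k)
    linarith) (hzkP k) (hε0 k) (hε1 k)
  choose g hg0 hgP hg using happ
  -- Pointwise limits along an ultrafilter replace the Arzelà–Ascoli theorem: the step functions are
  -- not continuous, and the Lipschitz bound appears only in the limit.
  set U : Ultrafilter ℕ := hyperfilter ℕ with hU
  have hUle : (U : Filter ℕ) ≤ atTop := Nat.hyperfilter_le_atTop
  have hεU : Tendsto ε U (𝓝 0) := hεlim.mono_left hUle
  have hlim : ∀ s, ∃ x, s ∈ Icc 0 τ → x ∈ Metric.closedBall y ρ ∧ Tendsto (fun k => g k s) U (𝓝 x) := by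
    intro s
    by_cases hs : s ∈ Icc 0 τ
    · obtain ⟨x, hx, hx'⟩ := hK.ultrafilter_le_nhds' (U.map fun k => g k s)
        (Filter.mem_map.2 (univ_mem' fun k => (hgP k s hs).2))
      exact ⟨x, fun _ => ⟨hx, hx'⟩⟩
    · exact ⟨0, fun h => absurd h hs⟩
  choose γ hγ using hlim
  have hγ0 : γ 0 = z := by
    refine tendsto_nhds_unique (hγ 0 ⟨le_rfl, hτ.le⟩).2 ?_
    simp only [hg0]
    exact tendsto_iff_dist_tendsto_zero.2 (squeeze_zero (fun _ => dist_nonneg)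
      (fun k => (hzkd k).le) hεU)
  choose! h hh0 hhε hhR hhT using hg
  have hhlim : ∀ s s', 0 ≤ s → s ≤ s' → s' ≤ τ → Tendsto (fun k => h k s s') U (𝓝 (s' - s)) := by
    intro s s' hs hss hs'
    refine tendsto_iff_dist_tendsto_zero.2 (squeeze_zero (fun _ => dist_nonneg) (fun k => ?_) hεU)
    rw [Real.dist_eq]
    exact hhε k s s' hs hss hs'
  have hlip : ∀ s s', 0 ≤ s → s ≤ s' → s' ≤ τ → ‖γ s' - γ s‖ ≤ R * (s' - s) := by
    intro s s' hs hss hs'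
    have l1 := ((hγ s' ⟨hs.trans hss, hs'⟩).2.sub (hγ s ⟨hs, hss.trans hs'⟩).2).norm
    exact le_of_tendsto_of_tendsto' l1 ((hhlim s s' hs hss hs').const_mul R)
      fun k => hhR k s s' hs hss hs'
  -- The hyperplane `V 0 = 1` is a convex set containing all the cones. The increments therefore
  -- have time component exactly `σ h`, and `h` tends to `s`.
  have htime : ∀ s ∈ Icc 0 τ, γ s 0 = z 0 + σ * s := by
    intro s hs
    have hT : Convex ℝ {V : Fin (m + 1) → ℝ | V 0 = 1} := by
      intro V hV W hW a b _ _ hab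
      have hV : V 0 = 1 := hV
      have hW : W 0 = 1 := hW
      show (a • V + b • W) 0 = 1
      simp [hV, hW, hab]
    have l1 : ∀ k, σ * (g k s 0 - zk k 0) = h k 0 s := by
      intro k
      obtain ⟨V, hV, hVe⟩ := hhT k 0 s le_rfl hs.1 hs.2 _ hT ⟨fun _ => 1, rfl⟩
        fun w _ _ V hV => hC.time w _ V hV
      have hV : V 0 = 1 := hV
      have := congrFun hVe 0
      simp only [hg0, Pi.smul_apply, Pi.sub_apply, smul_eq_mul, hV, mul_one] at this
      exact this.symm
    have l2 : Tendsto (fun k => h k 0 s) U (𝓝 (σ * (γ s 0 - γ 0 0))) := by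
      simp only [← l1, ← hg0]
      exact (((continuous_apply 0).tendsto _).comp (hγ s hs).2 |>.sub
        (((continuous_apply 0).tendsto _).comp (hγ 0 ⟨le_rfl, hτ.le⟩).2)).const_mul σ
    have l3 := tendsto_nhds_unique l2 (hhlim 0 s le_rfl hs.1 hs.2)
    rw [hγ0] at l3
    linear_combination σ * l3 - (γ s 0 - z 0) * hσ
  refine ⟨γ, hγ0, fun s hs => ⟨?_, hball (hγ s hs).1, htime s hs⟩, ?_, ?_⟩
  · exact mem_closure_of_tendsto (hγ s hs).2 (Eventually.of_forall fun k => (hgP k s hs).1)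
  · refine LipschitzOnWith.of_dist_le_mul fun s hs s' hs' => ?_
    rw [NNReal.coe_mk]
    rcases le_total s s' with hss | hss
    · rw [dist_comm, dist_comm s, dist_eq_norm, Real.dist_eq, abs_of_nonneg (sub_nonneg.2 hss)]
      exact hlip s s' hs.1 hss hs'.2
    · rw [dist_eq_norm, Real.dist_eq, abs_of_nonneg (sub_nonneg.2 hss)]
      exact hlip s' s hs'.1 hss hs.2
  · intro s hs η hη
    have hsτ : s ∈ Icc 0 τ := ⟨hs.1, hs.2.le⟩
    have hγΩ := hball (hγ s hsτ).1
    obtain ⟨r, hr, hcont⟩ := hC.cont (γ s) hγΩ η hη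
    have hIoo : ∀ᶠ s' in 𝓝[>] s, s < s' ∧ s' < τ ∧ R * (s' - s) < r / 2 := by
      have c1 : ∀ᶠ s' in 𝓝 s, R * (s' - s) < r / 2 := by
        have : Continuous fun s' => R * (s' - s) := by fun_prop
        exact this.continuousAt.eventually_lt continuousAt_const (by simpa using half_pos hr)
      filter_upwards [self_mem_nhdsWithin, nhdsWithin_le_nhds (Iio_mem_nhds hs.2),
        nhdsWithin_le_nhds c1] with s' h1 h2 h3 using ⟨h1, h2, h3⟩
    filter_upwards [hIoo] with s' ⟨hss, hs'τ, hsr⟩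
    have hl := hhlim s s' hs.1 hss.le hs'τ.le
    have hpos : 0 < s' - s := sub_pos.2 hss
    -- For `s'` close to `s` the steps stay near `γ s`, where all cones of width `ε k < η / 2` lie
    -- in the convex set `C (γ s) η`. Closedness passes the normalized increments to the limit.
    have ev : ∀ᶠ k in (U : Filter ℕ), (h k s s')⁻¹ • σ • (g k s' - g k s) ∈ C (γ s) η := by
      have c1 : ∀ᶠ k in (U : Filter ℕ), 0 < h k s s' := hl.eventually (lt_mem_nhds hpos)
      have c2 : ∀ᶠ k in (U : Filter ℕ), R * h k s s' < r / 2 :=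
        (hl.const_mul R).eventually (gt_mem_nhds hsr)
      have c3 : ∀ᶠ k in (U : Filter ℕ), ε k < η / 2 := hεU.eventually (gt_mem_nhds (half_pos hη))
      have c4 : ∀ᶠ k in (U : Filter ℕ), g k s ∈ Metric.ball (γ s) (r / 2) :=
        (hγ s hsτ).2.eventually (Metric.ball_mem_nhds _ (half_pos hr))
      filter_upwards [c1, c2, c3, c4] with k k1 k2 k3 k4
      have := hhT k s s' hs.1 hss.le hs'τ.le (C (γ s) η) (hC.convex _ hγΩ η)
        (hC.nonempty _ hγΩ η hη) fun w _ hw => by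
          refine (hC.mono w _ _ k3.le).trans (hcont w ?_ (γ s) (Metric.mem_ball_self hr))
          have t1 := dist_triangle w (g k s) (γ s)
          have t2 := Metric.mem_ball.1 k4
          rw [← dist_eq_norm] at hw
          rw [Metric.mem_ball]
          linarith
      exact (mem_smul_set_iff_inv_smul_mem₀ k1.ne' _ _).1 this
    refine (hC.isClosed (γ s) η).mem_of_tendsto ?_ ev
    exact (hl.inv₀ hpos.ne').smul (((hγ s' ⟨hs.1.trans hss.le, hs'τ.le⟩).2.sub
      (hγ s hsτ).2).const_smul σ)

end CurveLimit

/-! ### Local causal curves inside the closure of a set of events. -/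

section LocalCurve

set_option linter.unusedSectionVars false

variable {n : ℕ} {M : Type*} [TopologicalSpace M] [ChartedSpace (EuclideanSpace ℝ (Fin n)) M]
  [IsManifold (𝓡 n) ∞ M] {e : OpenPartialHomeomorph M (EuclideanSpace ℝ (Fin n))}

lemma coordVector_sum (y V : Fin (n + 1) → ℝ) :
    ∑ μ, V μ • coordVector e y μ =
      (mfderiv (𝓡 n) (𝓡 n) e.symm (spacePart y) (spacePart V), V 0) := by
  have h1 : chartSymmDeriv e (spacePart y) (spacePart V) =
      ∑ i : Fin n, V i.succ • chartSymmDeriv e (spacePart y) (EuclideanSpace.single i 1) := by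
    rw [euclidean_eq_sum_single (spacePart V), map_sum]
    exact Finset.sum_congr rfl fun i _ => map_smul _ _ _
  have h2 : ∑ μ, V μ • modelVector e y μ = (chartSymmDeriv e (spacePart y) (spacePart V), V 0) := by
    rw [Fin.sum_univ_succ, h1]
    simp only [modelVector, Fin.cons_zero, Fin.cons_succ, Prod.smul_mk, smul_zero, smul_eq_mul,
      mul_one]
    ext1
    · simp [Prod.fst_sum]
    · simp [Prod.snd_sum]
  exact h2

lemma SpacetimeTwoTensor.apply_eq_dotProduct (h : SpacetimeTwoTensor n M) (y V : Fin (n + 1) → ℝ) :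
    h (e.symm (spacePart y)) (y 0)
      (mfderiv (𝓡 n) (𝓡 n) e.symm (spacePart y) (spacePart V), V 0)
      (mfderiv (𝓡 n) (𝓡 n) e.symm (spacePart y) (spacePart V), V 0) =
      V ⬝ᵥ h.comp e y *ᵥ V := by
  rw [← coordVector_sum]
  simp only [map_sum, LinearMap.sum_apply, map_smul, LinearMap.smul_apply, smul_eq_mul, dotProduct,
    Matrix.mulVec, SpacetimeTwoTensor.comp, Matrix.of_apply, Finset.mul_sum]
  rw [Finset.sum_comm]
  refine Finset.sum_congr rfl fun i _ => Finset.sum_congr rfl fun j _ => by ring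

lemma continuousAt_eventCoords {p : M × ℝ} (hp : p.1 ∈ e.source) :
    ContinuousAt (fun p : M × ℝ => eventCoords e p.1 p.2) p := by
  refine continuousAt_pi.2 (Fin.cases continuousAt_snd fun i => ?_)
  have h1 : ContinuousAt (fun p : M × ℝ => e p.1) p :=
    ContinuousAt.comp (e.continuousAt hp) continuousAt_fst
  exact ((EuclideanSpace.proj i : EuclideanSpace ℝ (Fin n) →L[ℝ] ℝ).continuous.continuousAt).comp h1

namespace SplitData

variable {D : SplitData n M} {I : Set ℝ} {ρ : SpacetimeTwoTensor n M} {P : M → ℝ → Prop} {σ : ℝ}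

theorem isConeField_coneAt (hI : IsOpen I) (hD : D.IsRegular I)
    (he : e ∈ IsManifold.maximalAtlas (𝓡 n) ∞ M) : IsConeField (coordDomain e I) (D.coneAt e) where
  time _ _ _ hV := hV.1
  mono _ _ _ h := coneAt_mono h
  nonempty y hy ε hε := by
    refine ⟨Fin.cons 1 (-D.shiftComp e y), rfl, ?_⟩
    have hw : D.spaceComp e y (Fin.cons 1 (-D.shiftComp e y)) = 0 := by
      ext i; simp [spaceComp]
    rw [dotProduct_metric_comp he hy.2, hw, zero_dotProduct]
    simp only [Fin.cons_zero, one_pow, mul_one, zero_sub]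
    linarith [sq_nonneg (D.lapseComp e y)]
  convex _ hy ε := convex_coneAt hD he hy ε
  isClosed _ ε := isClosed_coneAt ε
  bound K hK hKI := by
    obtain ⟨R, hR⟩ := exists_coneAt_bound hI hD he hK hKI 1
    exact ⟨R, fun y hy V hV => norm_le_of_abs_le (hR y hy V hV)⟩
  cont _ hy _ hη := exists_coneAt_subset hI hD he hy hη

/-- In every chart, small steps inside slightly widened light cones stay in the set of events with
property `P`. -/
def HasChartSteps (D : SplitData n M) (I : Set ℝ) (P : M → ℝ → Prop) (σ : ℝ) : Prop :=
  ∀ e ∈ IsManifold.maximalAtlas (𝓡 n) ∞ M, HasConeSteps (coordDomain e I) (D.coneAt e)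
    (fun y => y ∈ coordDomain e I ∧ P (e.symm (spacePart y)) (y 0)) σ

/-- The cones are bounded, so short steps do not leave the coordinate domain, and membership there
need not be produced by the hypothesis. -/
lemma hasChartSteps_of_coneAt (hI : IsOpen I) (hD : D.IsRegular I) (hσ : σ ^ 2 = 1)
    (h : ∀ e ∈ IsManifold.maximalAtlas (𝓡 n) ∞ M, ∀ y ∈ coordDomain e I, ∀ ε, 0 < ε →
      ∃ r > 0, ∀ z ∈ Metric.ball y r, ∀ δ, 0 < δ → δ ≤ r → z ∈ coordDomain e I →
        P (e.symm (spacePart z)) (z 0) → ∃ V ∈ D.coneAt e y ε, z + (σ * δ) • V ∈ coordDomain e I →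
          P (e.symm (spacePart (z + (σ * δ) • V))) ((z + (σ * δ) • V) 0)) :
    D.HasChartSteps I P σ := by
  intro e he y hy ε hε
  obtain ⟨r, hr, hstep⟩ := h e he y hy ε hε
  obtain ⟨R, hR⟩ := exists_coneAt_bound hI hD he (isCompact_singleton (x := y))
    (singleton_subset_iff.2 hy) ε
  obtain ⟨d, hd, hball⟩ := Metric.mem_nhds_iff.1 ((isOpen_coordDomain e hI).mem_nhds hy)
  have hR2 : 0 < |R| + 1 := by positivity
  refine ⟨min r (d / (|R| + 1)), by positivity, fun z hz δ hδ hδr hP => ?_⟩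
  obtain ⟨V, hV, hPV⟩ := hstep z (Metric.ball_subset_ball (min_le_left _ _) hz) δ hδ
    (hδr.trans (min_le_left _ _)) hP.1 hP.2
  have hmem : z + (σ * δ) • V ∈ coordDomain e I := by
    refine hball ?_
    have h1 := (Metric.mem_ball.1 hz).trans_le (min_le_right _ _)
    have h2 := hδr.trans (min_le_right _ _)
    have h3 : dist (z + (σ * δ) • V) z ≤ δ * |R| := by
      have hσ1 : |σ| = 1 := by
        rw [← sq_eq_sq₀ (abs_nonneg _) zero_le_one, sq_abs, hσ, one_pow]
      rw [dist_eq_norm, add_sub_cancel_left, norm_smul, Real.norm_eq_abs, abs_mul, hσ1, one_mul,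
        abs_of_pos hδ]
      exact mul_le_mul_of_nonneg_left ((norm_le_of_abs_le (hR y rfl V hV)).trans (le_abs_self R)) hδ.le
    have h4 := dist_triangle (z + (σ * δ) • V) z y
    have h5 : d / (|R| + 1) * (|R| + 1) = d := div_mul_cancel₀ _ hR2.ne'
    rw [Metric.mem_ball]
    nlinarith [mul_le_mul_of_nonneg_right h2 (abs_nonneg R)]
  exact ⟨V, hV, hmem, hPV hmem⟩

/-- Supplies the half of the inextendible curve on which nothing is required. -/
lemma hasChartSteps_true (hI : IsOpen I) (hD : D.IsRegular I) (hσ : σ ^ 2 = 1) :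
    D.HasChartSteps I (fun _ _ => True) σ :=
  hasChartSteps_of_coneAt hI hD hσ fun e he y hy ε hε => by
    obtain ⟨V, hV⟩ := (isConeField_coneAt hI hD he).nonempty y hy ε hε
    exact ⟨1, one_pos, fun _ _ _ _ _ _ _ => ⟨V, hV, fun _ => trivial⟩⟩

lemma constraintsAt_symm_iff (hI : IsOpen I) (hD : D.IsRegular I)
    (he : e ∈ IsManifold.maximalAtlas (𝓡 n) ∞ M) {y : Fin (n + 1) → ℝ} (hy : y ∈ coordDomain e I) :
    D.ConstraintsAt ρ (e.symm (spacePart y)) (y 0) ↔ D.constraint ρ e y = 0 := by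
  rw [constraintsAt_iff hI hD he (e.map_target hy.2) hy.1, eventCoords_symm hy.2]

lemma hasChartSteps_not_constraintsAt (hI : IsOpen I) (hD : D.IsRegular I)
    (hρ : D.SolvesEvolution ρ I) (hσ : σ ^ 2 = 1) :
    D.HasChartSteps I (fun x t => ¬ D.ConstraintsAt ρ x t) σ :=
  hasChartSteps_of_coneAt hI hD hσ fun e he y hy ε hε => by
    obtain ⟨r, hr, h⟩ := exists_coneAt_constraint_ne_zero hI hD hρ he hy hε
    refine ⟨r, hr, fun z hz δ hδ hδr hzI hP => ?_⟩
    rw [constraintsAt_symm_iff hI hD he hzI] at hP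
    -- The base of that cone is displaced by `-σ δ V` from its vertex; a step in direction `σ` needs
    -- the opposite sign.
    obtain ⟨V, hV, hV'⟩ := h z hz δ hδ hδr (-σ) (by rw [neg_sq, hσ]) hP
    refine ⟨V, hV, fun hmem => ?_⟩
    rw [constraintsAt_symm_iff hI hD he hmem]
    rwa [neg_mul, neg_smul, sub_neg_eq_add] at hV'

/-- The closure of the set of events in `M × I` with property `P`. -/
def eventClosure (I : Set ℝ) (P : M → ℝ → Prop) : Set (M × ℝ) :=
  closure {p | p.2 ∈ I ∧ P p.1 p.2}

/-- A Lipschitz curve in a chart whose velocities lie in the light cones is a causal curve. -/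
lemma isCausalCurve_of_chart (he : e ∈ IsManifold.maximalAtlas (𝓡 n) ∞ M) {a b : ℝ}
    {Γ : ℝ → Fin (n + 1) → ℝ} {R : NNReal} (hΓ : LipschitzOnWith R Γ (Icc a b))
    (hmem : ∀ s ∈ Icc a b, spacePart (Γ s) ∈ e.target) (htime : ∀ s ∈ Icc a b, Γ s 0 = s)
    (hcone : ∀ s ∈ Ioo a b, ∀ W, HasDerivAt Γ W s → ∀ η > 0, W ∈ D.coneAt e (Γ s) η) :
    D.IsCausalCurve (Icc a b) fun s => e.symm (spacePart (Γ s)) where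
  continuousOn := by
    refine e.continuousOn_symm.comp (continuous_spacePart.comp_continuousOn hΓ.continuousOn) ?_
    exact hmem
  locallyLipschitz s hs := by
    set e' := chartAt (EuclideanSpace ℝ (Fin n)) (e.symm (spacePart (Γ s))) with he'
    have h1 : ContDiffAt ℝ 1 (fun z => e' (e.symm (spacePart z))) (Γ s) :=
      ((contDiffAt_transition (IsManifold.chart_mem_maximalAtlas _) he (hmem s hs)
        (mem_chart_source _ _)).of_le (by simp)).comp (Γ s) contDiff_spacePart.contDiffAt
    obtain ⟨K, t, ht, hK⟩ := h1.exists_lipschitzOnWith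
    refine ⟨K * R, Icc a b ∩ Γ ⁻¹' t, ?_, hK.comp (hΓ.mono inter_subset_left) fun _ hr => hr.2⟩
    exact inter_mem self_mem_nhdsWithin (hΓ.continuousOn s hs ht)
  causal := by
    -- Rademacher's theorem. The two endpoints form a null set and are discarded, so
    -- within-derivatives become derivatives.
    have h1 := hΓ.ae_differentiableWithinAt (μ := volume) measurableSet_Icc
    rw [← restrict_Ioo_eq_restrict_Icc] at h1 ⊢
    filter_upwards [h1, ae_restrict_mem measurableSet_Ioo] with s hs hsI
    have hsI' := Ioo_subset_Icc_self hsI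
    have hd : HasDerivAt Γ (deriv Γ s) s :=
      (hs.differentiableAt (Icc_mem_nhds hsI.1 hsI.2)).hasDerivAt
    set W := deriv Γ s with hW
    have hd2 : HasFDerivAt (fun r => spacePart (Γ r)) _ s :=
      (hasFDerivAt_spacePart (Γ s)).comp s hd.hasFDerivAt
    have hm1 := (mdifferentiable_of_mem_maximalAtlas he).mdifferentiableAt_symm (hmem s hsI')
    have hm2 : MDifferentiableAt 𝓘(ℝ, ℝ) (𝓡 n) (fun r => spacePart (Γ r)) s :=
      hd2.differentiableAt.mdifferentiableAt
    have hv : mfderiv 𝓘(ℝ, ℝ) (𝓡 n) (fun r => e.symm (spacePart (Γ r))) s (1 : ℝ) =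
        mfderiv (𝓡 n) (𝓡 n) e.symm (spacePart (Γ s)) (spacePart W) := by
      have h2 := mfderiv_comp s hm1 hm2
      have h3 := congrArg (fun L => L (1 : ℝ)) h2
      refine h3.trans (congrArg (mfderiv (𝓡 n) (𝓡 n) e.symm (spacePart (Γ s))) ?_)
      rw [mfderiv_eq_fderiv, hd2.fderiv]
      change spacePartL n ((1 : ℝ) • W) = spacePart W
      rw [one_smul]
      rfl
    refine ⟨hm1.comp s hm2, ?_⟩
    have hW0 : ∀ η > 0, W ⬝ᵥ D.metric.comp e (Γ s) *ᵥ W ≤ η := fun η hη => (hcone s hsI W hd η hη).2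
    have hW1 : W 0 = 1 := (hcone s hsI W hd 1 one_pos).1
    rw [hv]
    have h4 := D.metric.apply_eq_dotProduct (e := e) (Γ s) W
    rw [htime s hsI', hW1] at h4
    rw [h4]
    exact le_of_forall_pos_le_add fun η hη => by rw [zero_add]; exact hW0 η hη

lemma mul_sub_mem_Icc (hσ : σ ^ 2 = 1) {t τ s : ℝ} (hτ : 0 ≤ τ)
    (hs : s ∈ Icc (min t (t + σ * τ)) (max t (t + σ * τ))) : σ * (s - t) ∈ Icc 0 τ := by
  rcases mul_self_eq_one_iff.1 (pow_two σ ▸ hσ) with rfl | rfl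
  · rw [one_mul, min_eq_left (by linarith), max_eq_right (by linarith)] at hs
    constructor <;> linarith [hs.1, hs.2]
  · rw [neg_one_mul, min_eq_right (by linarith), max_eq_left (by linarith)] at hs
    constructor <;> linarith [hs.1, hs.2]

lemma mul_sub_mem_Ioo (hσ : σ ^ 2 = 1) {t τ s : ℝ} (hτ : 0 ≤ τ)
    (hs : s ∈ Ioo (min t (t + σ * τ)) (max t (t + σ * τ))) : σ * (s - t) ∈ Ioo 0 τ := by
  rcases mul_self_eq_one_iff.1 (pow_two σ ▸ hσ) with rfl | rfl
  · rw [one_mul, min_eq_left (by linarith), max_eq_right (by linarith)] at hs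
    constructor <;> linarith [hs.1, hs.2]
  · rw [neg_one_mul, min_eq_right (by linarith), max_eq_left (by linarith)] at hs
    constructor <;> linarith [hs.1, hs.2]

/-- Local existence of causal curves in the closure of a set of events that is stable under small
steps in the light cones. -/
theorem HasChartSteps.exists_local_causalCurve (hP : D.HasChartSteps I P σ) (hI : IsOpen I)
    (hD : D.IsRegular I) (hσ : σ ^ 2 = 1) (q : M) {b : ℝ} (hb : b ∈ I) :
    ∃ τ > 0, ∀ᶠ p : M × ℝ in 𝓝 (q, b), p ∈ eventClosure I P → ∃ c : ℝ → M, c p.2 = p.1 ∧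
      D.IsCausalCurve (Icc (min p.2 (p.2 + σ * τ)) (max p.2 (p.2 + σ * τ))) c ∧
      ∀ s ∈ Icc (min p.2 (p.2 + σ * τ)) (max p.2 (p.2 + σ * τ)),
        s ∈ I ∧ (c s, s) ∈ eventClosure I P := by
  set e := chartAt (EuclideanSpace ℝ (Fin n)) q with he'
  have he : e ∈ IsManifold.maximalAtlas (𝓡 n) ∞ M := IsManifold.chart_mem_maximalAtlas q
  have hq : q ∈ e.source := mem_chart_source _ q
  obtain ⟨r, hr, τ, hτ, R, h⟩ := (hP e he).exists_curve (isConeField_coneAt hI hD he)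
    (isOpen_coordDomain e hI) hσ (eventCoords_mem_coordDomain hq hb)
  refine ⟨τ, hτ, ?_⟩
  filter_upwards [(continuousAt_eventCoords (p := (q, b)) hq).eventually (Metric.ball_mem_nhds _ hr),
    continuousAt_fst.eventually (e.open_source.mem_nhds hq)] with p hp1 hp2 hp
  have hp2 : p.1 ∈ e.source := hp2
  have hcl : eventCoords e p.1 p.2 ∈
      closure {y | y ∈ coordDomain e I ∧ P (e.symm (spacePart y)) (y 0)} := by
    have h1 : p ∈ closure ((Prod.fst ⁻¹' e.source) ∩ {p : M × ℝ | p.2 ∈ I ∧ P p.1 p.2}) :=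
      (e.open_source.preimage continuous_fst).inter_closure ⟨hp2, hp⟩
    refine (continuousAt_eventCoords hp2).continuousWithinAt.mem_closure h1 fun p' hp' => ?_
    have hp'1 : p'.1 ∈ e.source := hp'.1
    refine ⟨eventCoords_mem_coordDomain hp'1 hp'.2.1, ?_⟩
    rw [spacePart_eventCoords, e.left_inv hp'1]
    exact hp'.2.2
  obtain ⟨γ, hγ0, hγ, hlip, hchord⟩ := h _ hp1 hcl
  set t := p.2 with ht
  set J := Icc (min t (t + σ * τ)) (max t (t + σ * τ)) with hJ
  have hJmem : ∀ s ∈ J, σ * (s - t) ∈ Icc 0 τ := fun s hs => mul_sub_mem_Icc hσ hτ.le hs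
  -- Reparametrization from elapsed time to coordinate time, which works for both signs of `σ`.
  set Γ : ℝ → Fin (n + 1) → ℝ := fun s => γ (σ * (s - t)) with hΓ
  have hσ1 : |σ| = 1 := by
    rw [← sq_eq_sq₀ (abs_nonneg _) zero_le_one, sq_abs, hσ, one_pow]
  have hΓlip : LipschitzOnWith R Γ J := by
    refine LipschitzOnWith.of_dist_le_mul fun s hs s' hs' => ?_
    refine (hlip.dist_le_mul _ (hJmem s hs) _ (hJmem s' hs')).trans (le_of_eq ?_)
    rw [Real.dist_eq, Real.dist_eq, ← mul_sub, abs_mul, hσ1, one_mul, sub_sub_sub_cancel_right]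
  have htime : ∀ s ∈ J, Γ s 0 = s := by
    intro s hs
    refine (hγ _ (hJmem s hs)).2.2.trans ?_
    change t + σ * (σ * (s - t)) = s
    linear_combination (s - t) * hσ
  have hmem : ∀ s ∈ J, Γ s ∈ coordDomain e I := fun s hs => (hγ _ (hJmem s hs)).2.1
  refine ⟨fun s => e.symm (spacePart (Γ s)), ?_, ?_, fun s hs => ⟨?_, ?_⟩⟩
  · rw [hΓ]
    simp only [sub_self, mul_zero, hγ0, spacePart_eventCoords]
    exact e.left_inv hp2
  · refine isCausalCurve_of_chart he hΓlip (fun s hs => (hmem s hs).2) htime fun s hs W hW η hη => ?_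
    have hs1 : σ * (s - t) ∈ Ico 0 τ := Ioo_subset_Ico_self (mul_sub_mem_Ioo hσ hτ.le hs)
    have hc := hchord _ hs1 η hη
    have hslope := (hasDerivAt_iff_tendsto_slope.1 hW)
    have hmap : Tendsto (fun s' => t + σ * s') (𝓝[>] (σ * (s - t))) (𝓝[≠] s) := by
      refine tendsto_nhdsWithin_iff.2 ⟨?_, ?_⟩
      · have hcn : Continuous fun s' => t + σ * s' := by fun_prop
        have := (hcn.tendsto (σ * (s - t))).mono_left (nhdsWithin_le_nhds (s := Ioi (σ * (s - t))))
        rwa [show t + σ * (σ * (s - t)) = s by linear_combination (s - t) * hσ] at this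
      · filter_upwards [self_mem_nhdsWithin] with s' hs' heq
        have heq : t + σ * s' = s := heq
        have : s' = σ * (s - t) := by linear_combination σ * heq - s' * hσ
        exact (mem_Ioi.1 hs').ne' this
    -- Where `Γ` is differentiable, its velocity is the limit of the one-sided chords that are known
    -- to lie in the closed cone.
    refine (isClosed_coneAt η).mem_of_tendsto (hslope.comp hmap) ?_
    filter_upwards [hc, self_mem_nhdsWithin] with s' hs' hgt
    have e1 : Γ (t + σ * s') = γ s' := by
      change γ (σ * (t + σ * s' - t)) = γ s'
      rw [show σ * (t + σ * s' - t) = s' by linear_combination s' * hσ]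
    have e2 : ((t + σ * s') - s)⁻¹ = (s' - σ * (s - t))⁻¹ * σ := by
      have h1 : s' - σ * (s - t) ≠ 0 := sub_ne_zero.2 (mem_Ioi.1 hgt).ne'
      have h2 : (t + σ * s') - s = σ * (s' - σ * (s - t)) := by linear_combination (s - t) * hσ
      have h3 : σ⁻¹ = σ := inv_eq_of_mul_eq_one_left (by rw [← pow_two, hσ])
      rw [h2, mul_inv, h3, mul_comm]
    rw [Function.comp, slope, vsub_eq_sub, e1, e2, mul_smul]
    exact hs'
  · rw [← htime s hs]; exact (hmem s hs).1
  · have hs2 := hmem s hs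
    have hG : ContinuousAt (fun y : Fin (n + 1) → ℝ => (e.symm (spacePart y), y 0)) (Γ s) :=
      ((e.continuousAt_symm hs2.2).comp continuous_spacePart.continuousAt).prodMk
        (continuous_apply 0).continuousAt
    have h2 := hG.continuousWithinAt.mem_closure (hγ _ (hJmem s hs)).1
      (t := {p : M × ℝ | p.2 ∈ I ∧ P p.1 p.2}) fun y hy => ⟨hy.1.1, hy.2⟩
    change (e.symm (spacePart (Γ s)), Γ s 0) ∈ _ at h2
    rwa [htime s hs] at h2

end SplitData

end LocalCurve

/-! ### Greedy continuation to a curve without endpoint. -/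

section MaximalCurve

/-- Concatenation of local curves to a curve without endpoint. -/
theorem exists_maximal_curve {X : Type*} [TopologicalSpace X] {I : Set ℝ} {S : Set (X × ℝ)}
    {𝒞 : ℝ → ℝ → (ℝ → X) → Prop}
    (hcongr : ∀ a b c c', 𝒞 a b c → EqOn c c' (Icc a b) → 𝒞 a b c')
    (hglue : ∀ a b d c, a ≤ b → b ≤ d → 𝒞 a b c → 𝒞 b d c → 𝒞 a d c)
    (hloc : ∀ q : X, ∀ b ∈ I, ∃ τ > 0, ∀ᶠ p : X × ℝ in 𝓝 (q, b), p ∈ S → ∃ c : ℝ → X,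
      c p.2 = p.1 ∧ 𝒞 p.2 (p.2 + τ) c ∧ ∀ s ∈ Icc p.2 (p.2 + τ), s ∈ I ∧ (c s, s) ∈ S)
    {x : X} {t : ℝ} (ht : t ∈ I) (hx : (x, t) ∈ S) :
    ∃ (T : ℕ → ℝ) (c : ℝ → X), StrictMono T ∧ t < T 0 ∧ c t = x ∧ (∀ k, 𝒞 t (T k) c) ∧
      (∀ k, ∀ s ∈ Icc t (T k), s ∈ I ∧ (c s, s) ∈ S) ∧
      ∀ a ∈ I, Tendsto T atTop (𝓝 a) → ¬ ∃ q, Tendsto (fun k => c (T k)) atTop (𝓝 q) := by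
  classical
  set A : X × ℝ → ℝ → (ℝ → X) → Prop := fun p τ c =>
    0 < τ ∧ c p.2 = p.1 ∧ 𝒞 p.2 (p.2 + τ) c ∧ ∀ s ∈ Icc p.2 (p.2 + τ), s ∈ I ∧ (c s, s) ∈ S with hA
  -- Every extension is chosen at least half as long as any possible one, lengths being capped at
  -- `1` because they may be unbounded.
  have hgreedy : ∀ p : {p : X × ℝ // p.2 ∈ I ∧ p ∈ S}, ∃ δ c, A p δ c ∧
      ∀ τ c', A p τ c' → min τ 1 / 2 ≤ δ := by
    rintro ⟨p, hpI, hpS⟩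
    obtain ⟨τ, hτ, h⟩ := hloc p.1 p.2 hpI
    obtain ⟨c, hc⟩ := h.self_of_nhds hpS
    by_cases hbig : ∃ δ c, A p δ c ∧ 1 / 2 ≤ δ
    · obtain ⟨δ, c, h1, h2⟩ := hbig
      exact ⟨δ, c, h1, fun τ _ _ => (div_le_div_of_nonneg_right (min_le_right τ 1) zero_le_two).trans h2⟩
    · push Not at hbig
      set B := {δ | ∃ c, A p δ c} with hB
      have hτB : τ ∈ B := ⟨c, hτ, hc⟩
      have hbdd : BddAbove B := ⟨1 / 2, by rintro δ ⟨c, h⟩; exact (hbig δ c h).le⟩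
      have hle : τ ≤ sSup B := le_csSup hbdd hτB
      obtain ⟨δ, ⟨c', hc'⟩, hδ⟩ := exists_lt_of_lt_csSup ⟨τ, hτB⟩ (half_lt_self (hτ.trans_le hle))
      refine ⟨δ, c', hc', fun τ' c'' h => ?_⟩
      have := le_csSup hbdd (⟨c'', h⟩ : τ' ∈ B)
      linarith [min_le_left τ' 1]
  choose δ cv hcv hmax using hgreedy
  set nxt : {p : X × ℝ // p.2 ∈ I ∧ p ∈ S} → {p : X × ℝ // p.2 ∈ I ∧ p ∈ S} := fun p =>
    ⟨(cv p (p.1.2 + δ p), p.1.2 + δ p), (hcv p).2.2.2 _ (right_mem_Icc.2 (by linarith [(hcv p).1]))⟩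
    with hnxt
  set Y : ℕ → {p : X × ℝ // p.2 ∈ I ∧ p ∈ S} := fun k => nxt^[k] ⟨(x, t), ht, hx⟩ with hY
  have hYs : ∀ k, Y (k + 1) = nxt (Y k) := fun k => Function.iterate_succ_apply' nxt k _
  set T : ℕ → ℝ := fun k => (Y k).1.2 with hT
  have hTs : ∀ k, T (k + 1) = T k + δ (Y k) := fun k => by
    change (Y (k + 1)).1.2 = _
    rw [hYs]
  have hTmono : StrictMono T := strictMono_nat_of_lt_succ fun k => by
    rw [hTs]; linarith [(hcv (Y k)).1]
  -- The concatenation uses at `s` the first segment whose end is not before `s`; beyond all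
  -- segments the value `x` is a mere default.
  have hex : ∀ s, ∃ y, ∀ k, (s ≤ T (k + 1) ∧ ∀ j < k, T (j + 1) < s) → y = cv (Y k) s := by
    intro s
    by_cases h : ∃ k, s ≤ T (k + 1)
    · refine ⟨cv (Y (Nat.find h)) s, fun k hk => ?_⟩
      have : Nat.find h = k := (Nat.find_eq_iff h).2 ⟨hk.1, fun j hj => not_le.2 (hk.2 j hj)⟩
      rw [this]
    · exact ⟨x, fun k hk => absurd ⟨k, hk.1⟩ h⟩
  choose c hc using hex
  have hcT : ∀ k, cv (Y k) (T k) = (Y k).1.1 := fun k => (hcv (Y k)).2.1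
  have hcs : ∀ k, ∀ s ∈ Ioc (T k) (T (k + 1)), c s = cv (Y k) s := fun k s hs =>
    hc s k ⟨hs.2, fun j hj => (hTmono.monotone (Nat.succ_le_of_lt hj)).trans_lt hs.1⟩
  have hcY : ∀ k, c (T k) = (Y k).1.1 := by
    intro k
    cases k with
    | zero =>
      rw [← hcT 0]
      exact hc _ 0 ⟨(hTmono (Nat.lt_succ_self 0)).le, fun j hj => absurd hj (Nat.not_lt_zero j)⟩
    | succ k =>
      rw [hcs k _ ⟨hTmono (Nat.lt_succ_self k), le_rfl⟩, hTs, hYs]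
  have hEq : ∀ k, EqOn (cv (Y k)) c (Icc (T k) (T (k + 1))) := by
    intro k s hs
    rcases hs.1.eq_or_lt with h | h
    · rw [← h, hcT, hcY]
    · exact (hcs k s ⟨h, hs.2⟩).symm
  have hseg : ∀ k, 𝒞 (T k) (T (k + 1)) c := fun k =>
    hcongr _ _ _ _ (by rw [hTs]; exact (hcv (Y k)).2.2.1) (hEq k)
  have hall : ∀ k, 𝒞 (T 0) (T (k + 1)) c := by
    intro k
    induction k with
    | zero => exact hseg 0
    | succ k ih =>
      exact hglue _ _ _ _ (hTmono.monotone (Nat.zero_le _)) (hTmono (Nat.lt_succ_self _)).le ih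
        (hseg (k + 1))
  have hSall : ∀ k, ∀ s ∈ Icc (T k) (T (k + 1)), s ∈ I ∧ (c s, s) ∈ S := by
    intro k s hs
    rw [← hEq k hs]
    exact (hcv (Y k)).2.2.2 s (by rwa [hTs] at hs)
  refine ⟨fun k => T (k + 1), c, fun i j h => hTmono (Nat.succ_lt_succ h), hTmono (Nat.lt_succ_self 0),
    hcY 0, hall, fun k => ?_, ?_⟩
  · induction k with
    | zero => exact hSall 0
    | succ k ih =>
      intro s hs
      rcases le_total s (T (k + 1)) with h | h
      · exact ih s ⟨hs.1, h⟩
      · exact hSall (k + 1) s ⟨h, hs.2⟩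
  -- If the curve had an endpoint, local existence there would offer extensions of one length `τ`
  -- from all late nodes. Greediness would keep the steps at least `min τ 1 / 2`, while convergence
  -- of the times sends them to zero.
  · rintro a ha hTa ⟨q, hq⟩
    obtain ⟨τ, hτ, h⟩ := hloc q a ha
    have hev := (hq.prodMk_nhds hTa).eventually h
    have hdiff : Tendsto (fun k => T (k + 1 + 1) - T (k + 1)) atTop (𝓝 0) := by
      simpa using (hTa.comp (tendsto_add_atTop_nat 1)).sub hTa
    have hlt : ∀ᶠ k in atTop, T (k + 1 + 1) - T (k + 1) < min τ 1 / 2 :=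
      hdiff.eventually (gt_mem_nhds (by positivity))
    obtain ⟨k, hk1, hk2⟩ := (hev.and hlt).exists
    rw [hcY] at hk1
    obtain ⟨c', h1⟩ := hk1 (Y (k + 1)).2.2
    have := hmax (Y (k + 1)) τ c' ⟨hτ, h1⟩
    rw [hTs (k + 1)] at hk2
    linarith

end MaximalCurve

/-! ### Gluing causal curves; half-curves in either time direction. -/

section CausalCurves

set_option linter.unusedSectionVars false

variable {n : ℕ} {M : Type*} [TopologicalSpace M] [ChartedSpace (EuclideanSpace ℝ (Fin n)) M]
  [IsManifold (𝓡 n) ∞ M]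

lemma LipschitzOnWith.union_of_le {X : Type*} [PseudoMetricSpace X] {f : ℝ → X} {K L : NNReal}
    {s t : Set ℝ} {b : ℝ} (hf : LipschitzOnWith K f s) (hg : LipschitzOnWith L f t) (hbs : b ∈ s)
    (hbt : b ∈ t) (hs : ∀ x ∈ s, x ≤ b) (ht : ∀ x ∈ t, b ≤ x) :
    LipschitzOnWith (max K L) f (s ∪ t) := by
  have key : ∀ x ∈ s, ∀ y ∈ t, dist (f x) (f y) ≤ (max K L : NNReal) * dist x y := by
    intro x hx y hy
    have h1 := hf.dist_le_mul x hx b hbs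
    have h2 := hg.dist_le_mul b hbt y hy
    have h3 := dist_triangle (f x) (f b) (f y)
    have e1 : dist x y = dist x b + dist b y := by
      rw [Real.dist_eq, Real.dist_eq, Real.dist_eq, abs_of_nonpos, abs_of_nonpos, abs_of_nonpos] <;>
        linarith [hs x hx, ht y hy]
    have h4 : (K : ℝ) * dist x b ≤ (max K L : NNReal) * dist x b :=
      mul_le_mul_of_nonneg_right (by exact_mod_cast le_max_left K L) dist_nonneg
    have h5 : (L : ℝ) * dist b y ≤ (max K L : NNReal) * dist b y :=
      mul_le_mul_of_nonneg_right (by exact_mod_cast le_max_right K L) dist_nonneg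
    rw [e1, mul_add]
    linarith
  refine LipschitzOnWith.of_dist_le_mul ?_
  rintro x (hx | hx) y (hy | hy)
  · exact (hf.weaken (le_max_left K L)).dist_le_mul x hx y hy
  · exact key x hx y hy
  · rw [dist_comm, dist_comm x]
    exact key y hy x hx
  · exact (hg.weaken (le_max_right K L)).dist_le_mul x hx y hy

namespace SplitData

variable {D : SplitData n M} {I : Set ℝ} {P : M → ℝ → Prop} {σ : ℝ}

/-- The velocity of a curve, as a vector of the model space. -/
noncomputable def curveVelocity (c : ℝ → M) (s : ℝ) : EuclideanSpace ℝ (Fin n) :=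
  mfderiv 𝓘(ℝ, ℝ) (𝓡 n) c s (1 : ℝ)

lemma curveVelocity_congr {c c' : ℝ → M} {s : ℝ} (h : c' =ᶠ[𝓝 s] c) :
    curveVelocity (n := n) c' s = curveVelocity c s :=
  congrArg (fun L : ℝ →L[ℝ] EuclideanSpace ℝ (Fin n) => L (1 : ℝ)) h.mfderiv_eq

lemma metric_congr {x x' : M} (h : x = x') (t : ℝ) {v w : EuclideanSpace ℝ (Fin n)} (hvw : v = w) :
    D.metric x t (show TangentSpace (𝓡 n) x × ℝ from (v, 1))
      (show TangentSpace (𝓡 n) x × ℝ from (v, 1)) =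
    D.metric x' t (show TangentSpace (𝓡 n) x' × ℝ from (w, 1))
      (show TangentSpace (𝓡 n) x' × ℝ from (w, 1)) := by
  subst h hvw
  rfl

lemma metric_velocity_congr {c c' : ℝ → M} {s : ℝ} (h : c' =ᶠ[𝓝 s] c) :
    D.metric (c' s) s (mfderiv 𝓘(ℝ, ℝ) (𝓡 n) c' s (1 : ℝ), 1)
      (mfderiv 𝓘(ℝ, ℝ) (𝓡 n) c' s (1 : ℝ), 1) =
    D.metric (c s) s (mfderiv 𝓘(ℝ, ℝ) (𝓡 n) c s (1 : ℝ), 1)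
      (mfderiv 𝓘(ℝ, ℝ) (𝓡 n) c s (1 : ℝ), 1) :=
  metric_congr h.self_of_nhds s (curveVelocity_congr h)

lemma IsCausalCurve.congr {a b : ℝ} {c c' : ℝ → M} (h : D.IsCausalCurve (Icc a b) c)
    (heq : EqOn c c' (Icc a b)) : D.IsCausalCurve (Icc a b) c' where
  continuousOn := h.continuousOn.congr heq.symm
  locallyLipschitz s hs := by
    obtain ⟨K, w, hw, hK⟩ := h.locallyLipschitz s hs
    refine ⟨K, Icc a b ∩ w, inter_mem self_mem_nhdsWithin hw, ?_⟩
    rw [← heq hs]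
    intro x hx y hy
    have h1 := hK hx.2 hy.2
    simp only [heq hx.1, heq hy.1] at h1
    exact h1
  causal := by
    have h1 := h.causal
    rw [← restrict_Ioo_eq_restrict_Icc] at h1 ⊢
    filter_upwards [h1, ae_restrict_mem measurableSet_Ioo] with s hs hsI
    have hev : c' =ᶠ[𝓝 s] c := by
      filter_upwards [Icc_mem_nhds hsI.1 hsI.2] with r hr using (heq hr).symm
    refine ⟨hs.1.congr_of_eventuallyEq hev, ?_⟩
    rw [metric_velocity_congr hev]
    exact hs.2

lemma IsCausalCurve.glue {a b d : ℝ} {c : ℝ → M} (hab : a ≤ b) (hbd : b ≤ d)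
    (h : D.IsCausalCurve (Icc a b) c) (h' : D.IsCausalCurve (Icc b d) c) :
    D.IsCausalCurve (Icc a d) c where
  continuousOn := by
    rw [← Icc_union_Icc_eq_Icc hab hbd]
    exact h.continuousOn.union_of_isClosed h'.continuousOn isClosed_Icc isClosed_Icc
  locallyLipschitz s hs := by
    rcases lt_trichotomy s b with hsb | rfl | hsb
    · obtain ⟨K, w, hw, hK⟩ := h.locallyLipschitz s ⟨hs.1, hsb.le⟩
      refine ⟨K, w, ?_, hK⟩
      rwa [nhdsWithin_eq_nhdsWithin (t := Icc a d) (u := Icc a b) (s := Iio b) hsb isOpen_Iio]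
      ext r
      simp only [mem_inter_iff, mem_Icc, mem_Iio]
      constructor <;> rintro ⟨⟨h1, h2⟩, h3⟩
      · exact ⟨⟨h1, h3.le⟩, h3⟩
      · exact ⟨⟨h1, h2.trans hbd⟩, h3⟩
    · obtain ⟨K, w, hw, hK⟩ := h.locallyLipschitz s ⟨hab, le_rfl⟩
      obtain ⟨K', w', hw', hK'⟩ := h'.locallyLipschitz s ⟨le_rfl, hbd⟩
      refine ⟨max K K', (w ∩ Icc a s) ∪ (w' ∩ Icc s d), ?_,
        (hK.mono inter_subset_left).union_of_le (hK'.mono inter_subset_left)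
          ⟨mem_of_mem_nhdsWithin (right_mem_Icc.2 hab) hw, hab, le_rfl⟩
          ⟨mem_of_mem_nhdsWithin (left_mem_Icc.2 hbd) hw', le_rfl, hbd⟩
          (fun x hx => hx.2.2) fun x hx => hx.2.1⟩
      rw [← Icc_union_Icc_eq_Icc hab hbd, nhdsWithin_union]
      exact ⟨mem_of_superset (inter_mem hw self_mem_nhdsWithin) subset_union_left,
        mem_of_superset (inter_mem hw' self_mem_nhdsWithin) subset_union_right⟩
    · obtain ⟨K, w, hw, hK⟩ := h'.locallyLipschitz s ⟨hsb.le, hs.2⟩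
      refine ⟨K, w, ?_, hK⟩
      rwa [nhdsWithin_eq_nhdsWithin (t := Icc a d) (u := Icc b d) (s := Ioi b) hsb isOpen_Ioi]
      ext r
      simp only [mem_inter_iff, mem_Icc, mem_Ioi]
      constructor <;> rintro ⟨⟨h1, h2⟩, h3⟩
      · exact ⟨⟨h3.le, h2⟩, h3⟩
      · exact ⟨⟨hab.trans h1, h2⟩, h3⟩
  causal := by
    rw [← Icc_union_Icc_eq_Icc hab hbd]
    exact ae_restrict_union_iff _ _ _ |>.2 ⟨h.causal, h'.causal⟩

/-- Strict monotonicity puts every point into the interior of the next interval, so the local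
conditions can be read off there; a countable union preserves the almost-everywhere condition. -/
lemma IsCausalCurve.iUnion {a b : ℕ → ℝ} {c : ℝ → M} (ha : StrictAnti a) (hb : StrictMono b)
    (h : ∀ k, D.IsCausalCurve (Icc (a k) (b k)) c) :
    D.IsCausalCurve (⋃ k, Icc (a k) (b k)) c := by
  have hnhds : ∀ k, ∀ s ∈ Icc (a k) (b k), Icc (a (k + 1)) (b (k + 1)) ∈ 𝓝 s := fun k s hs =>
    Icc_mem_nhds ((ha (Nat.lt_succ_self k)).trans_le hs.1) (hs.2.trans_lt (hb (Nat.lt_succ_self k)))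
  refine ⟨fun s hs => ?_, fun s hs => ?_, ?_⟩
  · obtain ⟨k, hk⟩ := mem_iUnion.1 hs
    exact ((h (k + 1)).continuousOn.continuousAt (hnhds k s hk)).continuousWithinAt
  · obtain ⟨k, hk⟩ := mem_iUnion.1 hs
    obtain ⟨K, w, hw, hK⟩ := (h (k + 1)).locallyLipschitz s (mem_of_mem_nhds (hnhds k s hk))
    rw [nhdsWithin_eq_nhds.2 (hnhds k s hk)] at hw
    exact ⟨K, w, mem_nhdsWithin_of_mem_nhds hw, hK⟩
  · exact ae_restrict_iUnion_iff _ _ |>.2 fun k => (h k).causal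

/-- Half-curves: existence of causal curves, in the time direction `σ`, that stay in the closure of
a set of events that is stable under small steps in the light cones and have no endpoint. -/
theorem HasChartSteps.exists_halfCurve (hP : D.HasChartSteps I P σ) (hI : IsOpen I)
    (hD : D.IsRegular I) (hσ : σ ^ 2 = 1) {x : M} {t : ℝ} (ht : t ∈ I)
    (hx : (x, t) ∈ eventClosure I P) :
    ∃ (T : ℕ → ℝ) (c : ℝ → M), StrictMono (fun k => σ * T k) ∧ σ * t < σ * T 0 ∧ c t = x ∧
      (∀ k, D.IsCausalCurve (Icc (min t (T k)) (max t (T k))) c) ∧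
      (∀ k, ∀ s ∈ Icc (min t (T k)) (max t (T k)), s ∈ I ∧ (c s, s) ∈ eventClosure I P) ∧
      ∀ a ∈ I, Tendsto T atTop (𝓝 a) → ¬ ∃ q, Tendsto (fun k => c (T k)) atTop (𝓝 q) := by
  have hσσ : ∀ s : ℝ, σ * (σ * s) = s := fun s => by linear_combination s * hσ
  have hmem : ∀ a b s, a ≤ b → (s ∈ Icc (min (σ * a) (σ * b)) (max (σ * a) (σ * b)) ↔
      σ * s ∈ Icc a b) := by
    intro a b s hab
    rcases mul_self_eq_one_iff.1 (pow_two σ ▸ hσ) with rfl | rfl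
    · simp [min_eq_left hab, max_eq_right hab]
    · simp only [neg_one_mul, min_eq_right (neg_le_neg hab), max_eq_left (neg_le_neg hab), mem_Icc]
      constructor <;> rintro ⟨h1, h2⟩ <;> constructor <;> linarith
  -- The continuation theorem only goes forward, so it is applied in the time `r = σ s`, which
  -- reverses time for `σ = -1`.
  obtain ⟨T, c, hT, hT0, hc0, hcC, hcS, hlim⟩ := exists_maximal_curve (X := M)
    (I := {r | σ * r ∈ I}) (S := {p | (p.1, σ * p.2) ∈ eventClosure I P})
    (𝒞 := fun a b c => a ≤ b ∧ D.IsCausalCurve (Icc (min (σ * a) (σ * b)) (max (σ * a) (σ * b)))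
      fun s => c (σ * s))
    (x := x) (t := σ * t)
    (fun a b c c' h heq => ⟨h.1, h.2.congr fun s hs => heq ((hmem a b s h.1).1 hs)⟩)
    (by
      rintro a b d c hab hbd ⟨-, h1⟩ ⟨-, h2⟩
      refine ⟨hab.trans hbd, ?_⟩
      rcases mul_self_eq_one_iff.1 (pow_two σ ▸ hσ) with rfl | rfl
      · simp only [one_mul, min_eq_left hab, max_eq_right hab, min_eq_left hbd, max_eq_right hbd,
          min_eq_left (hab.trans hbd), max_eq_right (hab.trans hbd)] at *
        exact h1.glue hab hbd h2
      · simp only [neg_one_mul, min_eq_right (neg_le_neg hab), max_eq_left (neg_le_neg hab),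
          min_eq_right (neg_le_neg hbd), max_eq_left (neg_le_neg hbd),
          min_eq_right (neg_le_neg (hab.trans hbd)), max_eq_left (neg_le_neg (hab.trans hbd))] at *
        exact h2.glue (neg_le_neg hbd) (neg_le_neg hab) h1)
    (by
      intro q b hb
      obtain ⟨τ, hτ, h⟩ := hP.exists_local_causalCurve hI hD hσ q hb
      refine ⟨τ, hτ, ?_⟩
      have hcont : Continuous fun p : M × ℝ => (p.1, σ * p.2) := by fun_prop
      filter_upwards [(hcont.tendsto (q, b)).eventually h] with p hp hpS
      obtain ⟨c, h1, h2, h3⟩ := hp hpS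
      simp only [← mul_add] at h2 h3
      refine ⟨fun r => c (σ * r), h1, ⟨by linarith, ?_⟩, fun s hs => ?_⟩
      · simpa only [hσσ] using h2
      · exact h3 (σ * s) ((hmem _ _ _ (by linarith)).2 (by rwa [hσσ])))
    (by simpa only [mem_ofPred_eq, hσσ] using ht) (by simpa only [mem_ofPred_eq, hσσ] using hx)
  refine ⟨fun k => σ * T k, fun s => c (σ * s), ?_, ?_, hc0, fun k => ?_, fun k s hs => ?_, ?_⟩
  · simpa only [hσσ] using hT
  · simpa only [hσσ] using hT0
  · simpa only [hσσ] using (hcC k).2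
  · have h1 := hcS k (σ * s) ((hmem _ _ _ (hcC k).1).1 (by simpa only [hσσ] using hs))
    simpa only [mem_ofPred_eq, hσσ] using h1
  · intro a ha hTa
    have h1 := hlim (σ * a) (by simpa only [mem_ofPred_eq, hσσ] using ha) (by
      simpa only [hσσ] using hTa.const_mul σ)
    simpa only [hσσ] using h1

end SplitData

end CausalCurves

/-! ### Inextendible curves and propagation to the domain of dependence. -/

section Propagation

set_option linter.unusedSectionVars false

variable {n : ℕ} {M : Type*} [TopologicalSpace M] [ChartedSpace (EuclideanSpace ℝ (Fin n)) M]
  [IsManifold (𝓡 n) ∞ M]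

namespace SplitData

variable {D : SplitData n M} {I : Set ℝ} {P Q : M → ℝ → Prop} {ρ : SpacetimeTwoTensor n M}

/-- Through every event there are inextendible causal curves whose past and future halves stay in
given closures of sets of events that are stable under small steps in the light cones. -/
theorem exists_inextendible_causalCurve (hP : D.HasChartSteps I P (-1))
    (hQ : D.HasChartSteps I Q 1) (hI : IsOpen I) (hD : D.IsRegular I) {x : M} {t : ℝ} (ht : t ∈ I)
    (hx : (x, t) ∈ eventClosure I P) (hx' : (x, t) ∈ eventClosure I Q) :
    ∃ (J : Set ℝ) (c : ℝ → M), J.OrdConnected ∧ J ⊆ I ∧ t ∈ J ∧ c t = x ∧ D.IsCausalCurve J c ∧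
      IsInextendible I J c ∧ (∀ s ∈ J, s ≤ t → (c s, s) ∈ eventClosure I P) ∧
      ∀ s ∈ J, t ≤ s → (c s, s) ∈ eventClosure I Q := by
  obtain ⟨a, c₁, ha, hat, hc₁, hC₁, hS₁, hl₁⟩ := hP.exists_halfCurve hI hD (by norm_num) ht hx
  obtain ⟨b, c₂, hb, hbt, hc₂, hC₂, hS₂, hl₂⟩ := hQ.exists_halfCurve hI hD (by norm_num) ht hx'
  have ha : StrictAnti a := fun i j h => by
    have := ha h
    simp only at this
    linarith
  have hb : StrictMono b := by simpa only [one_mul] using hb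
  have hat0 : ∀ k, a k < t := fun k => by linarith [ha.antitone (Nat.zero_le k)]
  have hbt0 : ∀ k, t < b k := fun k => by linarith [hb.monotone (Nat.zero_le k)]
  simp only [fun k => min_eq_right (hat0 k).le, fun k => max_eq_left (hat0 k).le] at hC₁ hS₁
  simp only [fun k => min_eq_left (hbt0 k).le, fun k => max_eq_right (hbt0 k).le] at hC₂ hS₂
  -- The two half-curves agree at `t`, so either formula may be used there.
  set c : ℝ → M := fun s => if s ≤ t then c₁ s else c₂ s with hc
  have h1 : ∀ s, s ≤ t → c s = c₁ s := fun s hs => if_pos hs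
  have h2 : ∀ s, t ≤ s → c s = c₂ s := by
    intro s hs
    rcases hs.eq_or_lt with rfl | hs
    · rw [h1 t le_rfl, hc₁, hc₂]
    · exact if_neg (not_le.2 hs)
  have hcausal : ∀ k, D.IsCausalCurve (Icc (a k) (b k)) c := fun k =>
    ((hC₁ k).congr fun s hs => (h1 s hs.2).symm).glue (hat0 k).le (hbt0 k).le
      ((hC₂ k).congr fun s hs => (h2 s hs.1).symm)
  set J := ⋃ k, Icc (a k) (b k) with hJ
  have hmono : Monotone fun k => Icc (a k) (b k) := fun i j h =>
    Icc_subset_Icc (ha.antitone h) (hb.monotone h)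
  have haJ : ∀ k, a k ∈ J := fun k => mem_iUnion.2 ⟨k, left_mem_Icc.2 ((hat0 k).trans (hbt0 k)).le⟩
  have hbJ : ∀ k, b k ∈ J := fun k => mem_iUnion.2 ⟨k, right_mem_Icc.2 ((hat0 k).trans (hbt0 k)).le⟩
  have hleft : ∀ s ∈ J, s ≤ t → s ∈ I ∧ (c s, s) ∈ eventClosure I P := by
    intro s hs hst
    obtain ⟨k, hk⟩ := mem_iUnion.1 hs
    rw [h1 s hst]
    exact hS₁ k s ⟨hk.1, hst⟩
  have hright : ∀ s ∈ J, t ≤ s → s ∈ I ∧ (c s, s) ∈ eventClosure I Q := by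
    intro s hs hst
    obtain ⟨k, hk⟩ := mem_iUnion.1 hs
    rw [h2 s hst]
    exact hS₂ k s ⟨hst, hk.2⟩
  refine ⟨J, c, ⟨fun r hr s hs z hz => ?_⟩, fun s hs => ?_, mem_iUnion.2 ⟨0, (hat0 0).le, (hbt0 0).le⟩,
    (h1 t le_rfl).trans hc₁, IsCausalCurve.iUnion ha hb hcausal, ?_, fun s hs hst => (hleft s hs hst).2,
    fun s hs hst => (hright s hs hst).2⟩
  · obtain ⟨i, hi⟩ := mem_iUnion.1 hr
    obtain ⟨j, hj⟩ := mem_iUnion.1 hs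
    have hi' := hmono (le_max_left i j) hi
    have hj' := hmono (le_max_right i j) hj
    exact mem_iUnion.2 ⟨max i j, hi'.1.trans hz.1, hz.2.trans hj'.2⟩
  · rcases le_total s t with hst | hst
    · exact (hleft s hs hst).1
    · exact (hright s hs hst).1
  · rintro r hr (hglb | hlub) ⟨q, hq⟩
    · have hlim : Tendsto a atTop (𝓝 r) := by
        refine tendsto_atTop_isGLB ha.antitone ⟨?_, fun w hw => hglb.2 ?_⟩
        · rintro _ ⟨k, rfl⟩
          exact hglb.1 (haJ k)
        · intro s hs
          obtain ⟨k, hk⟩ := mem_iUnion.1 hs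
          exact (hw ⟨k, rfl⟩).trans hk.1
      refine hl₁ r hr hlim ⟨q, ?_⟩
      have h := hq.comp (tendsto_nhdsWithin_iff.2 ⟨hlim, Eventually.of_forall haJ⟩)
      exact h.congr fun k => h1 _ (hat0 k).le
    · have hlim : Tendsto b atTop (𝓝 r) := by
        refine tendsto_atTop_isLUB hb.monotone ⟨?_, fun w hw => hlub.2 ?_⟩
        · rintro _ ⟨k, rfl⟩
          exact hlub.1 (hbJ k)
        · intro s hs
          obtain ⟨k, hk⟩ := mem_iUnion.1 hs
          exact hk.2.trans (hw ⟨k, rfl⟩)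
      refine hl₂ r hr hlim ⟨q, ?_⟩
      have h := hq.comp (tendsto_nhdsWithin_iff.2 ⟨hlim, Eventually.of_forall hbJ⟩)
      exact h.congr fun k => h2 _ (hbt0 k).le

/-- If the constraints hold on an open part of a time slice, they hold in a neighbourhood of it. -/
lemma not_mem_eventClosure_of_slice (hI : IsOpen I) (hD : D.IsRegular I)
    (hρ : D.SolvesEvolution ρ I) {t₀ : ℝ} (ht₀ : t₀ ∈ I) {U : Set M} (hU : IsOpen U)
    (h : ∀ x ∈ U, D.ConstraintsAt ρ x t₀) {q : M} (hq : q ∈ U) :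
    (q, t₀) ∉ eventClosure I fun x t => ¬ D.ConstraintsAt ρ x t := by
  set e := chartAt (EuclideanSpace ℝ (Fin n)) q with he'
  have he : e ∈ IsManifold.maximalAtlas (𝓡 n) ∞ M := IsManifold.chart_mem_maximalAtlas q
  have hqe : q ∈ e.source := mem_chart_source _ q
  have hy : eventCoords e q t₀ ∈ coordDomain e I := eventCoords_mem_coordDomain hqe ht₀
  have hsymm : ContinuousAt (fun z : Fin (n + 1) → ℝ => e.symm (spacePart z)) (eventCoords e q t₀) :=
    ContinuousAt.comp (e.continuousAt_symm hy.2) continuous_spacePart.continuousAt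
  have hq' : e.symm (spacePart (eventCoords e q t₀)) = q := by
    rw [spacePart_eventCoords, e.left_inv hqe]
  have hslice : ∀ᶠ z in 𝓝 (eventCoords e q t₀), z 0 = eventCoords e q t₀ 0 →
      D.constraint ρ e z = 0 := by
    filter_upwards [(isOpen_coordDomain e hI).mem_nhds hy,
      hsymm.eventually (hU.mem_nhds (hq'.symm ▸ hq :
        e.symm (spacePart (eventCoords e q t₀)) ∈ U))] with z hz hzU hz0
    rw [← constraintsAt_symm_iff hI hD he hz, hz0]
    exact h _ hzU
  have hev := eventually_constraint_eq_zero_of_slice hI hD hρ he hy hslice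
  have hcont : ContinuousAt (fun p : M × ℝ => eventCoords e p.1 p.2) (q, t₀) :=
    continuousAt_eventCoords hqe
  rw [eventClosure, mem_closure_iff_nhds]
  intro hcl
  obtain ⟨p, ⟨hp1, hp2⟩, hpI, hpP⟩ := hcl _ (inter_mem (hcont.eventually hev)
    (continuousAt_fst.eventually (e.open_source.mem_nhds hqe)))
  exact hpP ((constraintsAt_iff hI hD he hp2 hpI).2 hp1)

/-- The constraints propagate to the domain of dependence. -/
theorem constraintsAt_of_inDomainOfDependence (hI : IsOpen I) (hD : D.IsRegular I)
    (hρ : D.SolvesEvolution ρ I) {t₀ : ℝ} (ht₀ : t₀ ∈ I) {U : Set M} (hU : IsOpen U)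
    (h : ∀ x ∈ U, D.ConstraintsAt ρ x t₀) {x : M} {t : ℝ} (ht : t ∈ I)
    (hx : D.InDomainOfDependence I t₀ U x t) : D.ConstraintsAt ρ x t := by
  by_contra hcon
  have hb : (x, t) ∈ eventClosure I fun x t => ¬ D.ConstraintsAt ρ x t :=
    subset_closure ⟨ht, hcon⟩
  have hT : (x, t) ∈ eventClosure (M := M) I fun _ _ => True := subset_closure ⟨ht, trivial⟩
  -- The half-curve running from the event towards `t₀` is kept in the closure of the violations;
  -- the other half is unrestricted. The curve must cross `U × {t₀}`, a neighbourhood of which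
  -- contains no violations.
  rcases le_total t₀ t with h0 | h0
  · obtain ⟨J, c, hJ, hJI, htJ, hct, hc, hin, hpast, -⟩ := exists_inextendible_causalCurve
      (hasChartSteps_not_constraintsAt hI hD hρ (by norm_num))
      (hasChartSteps_true hI hD (by norm_num)) hI hD ht hb hT
    obtain ⟨h1, h2⟩ := hx J c hJ hJI htJ hct hc hin
    exact not_mem_eventClosure_of_slice hI hD hρ ht₀ hU h h2 (hpast t₀ h1 h0)
  · obtain ⟨J, c, hJ, hJI, htJ, hct, hc, hin, -, hfut⟩ := exists_inextendible_causalCurve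
      (hasChartSteps_true hI hD (by norm_num))
      (hasChartSteps_not_constraintsAt hI hD hρ (by norm_num)) hI hD ht hT hb
    obtain ⟨h1, h2⟩ := hx J c hJ hJI htJ hct hc hin
    exact not_mem_eventClosure_of_slice hI hD hρ ht₀ hU h h2 (hfut t₀ h1 h0)

end SplitData

end Propagation
theorem mainTheorem1 {n : ℕ} (hn : 1 ≤ n) {M : Type*} [TopologicalSpace M] [T2Space M]
    [ChartedSpace (EuclideanSpace ℝ (Fin n)) M] [IsManifold (𝓡 n) ∞ M]
    (I : Set ℝ) (hI : IsOpen I) (hI' : I.OrdConnected)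
    (D : SplitData n M) (hD : D.IsRegular I) :
    -- in all local coordinates, the constraint quantities satisfy a linear homogeneous first-order
    -- symmetrizable hyperbolic system, whose coefficients depend only on the metric
    (∀ e ∈ IsManifold.maximalAtlas (𝓡 n) ∞ M,
      ∃ B : (Fin (n + 1) → ℝ) → Matrix (Fin (n + 1)) (Fin (n + 1)) ℝ,
        (D.constraintSystem e B).IsSymmetrizableHyperbolicOn (coordDomain e I) ∧
        (∀ y ∈ coordDomain e I, ∀ η : Fin (n + 1) → ℝ,
          ((D.constraintSystem e B).symbol y η).det =
            (((D.lapseComp e y) ^ 2)⁻¹ * (D.frame e y 0 ⬝ᵥ η)) ^ (n - 1) *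
              (-(η ⬝ᵥ ((D.metric.comp e y)⁻¹ *ᵥ η)))) ∧
        ∀ ρ : SpacetimeTwoTensor n M, D.SolvesEvolution ρ I →
          (D.constraintSystem e B).IsSolutionOn (D.constraint ρ e) (coordDomain e I)) ∧
    -- the constraints propagate, with domain of dependence given by the light cone
    (∀ ρ : SpacetimeTwoTensor n M, D.SolvesEvolution ρ I → ∀ t₀ ∈ I,
      (∀ U : Set M, IsOpen U → (∀ x ∈ U, D.ConstraintsAt ρ x t₀) →
        ∀ x, ∀ t ∈ I, D.InDomainOfDependence I t₀ U x t → D.ConstraintsAt ρ x t) ∧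
      (D.IsCauchySlice I t₀ → (∀ x, D.ConstraintsAt ρ x t₀) →
        ∀ x, ∀ t ∈ I, D.ConstraintsAt ρ x t)) := by
  refine ⟨fun e he => ⟨D.constraintCoeff e,
      SplitData.isSymmetrizableHyperbolicOn_constraintSystem hI hD he,
      fun y hy η => SplitData.det_symbol_constraintSystem hn hD he hy _ η,
      fun ρ hρ => SplitData.isSolutionOn_constraint hI hD hρ he⟩, fun ρ hρ t₀ ht₀ =>
    ⟨fun U hU h x t ht hx => SplitData.constraintsAt_of_inDomainOfDependence hI hD hρ ht₀ hU h ht hx,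
      fun hC h x t ht => SplitData.constraintsAt_of_inDomainOfDependence hI hD hρ ht₀ isOpen_univ
        (fun y _ => h y) ht (hC x t ht)⟩⟩
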